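/- **Conventions.** For a real number $t$ write $[t]=\{n\in\mathbb Z: 1\le n\le t\}$. A function $f:\mathbb Z\to\mathbb C$ is *1-bounded* if $|f(x)|\le 1$ for all $x$. For $h\in\mathbb Z$ put $\Delta_h f(x)=f(x+h)\overline{f(x)}$, and $\Delta_{h_1,\dots,h_s}f=\Delta_{h_1}\cdots\Delta_{h_s}f$. For $f$ of finite support, an integer $s\ge1$ and $T\subset\mathbb Z$, the norms $\|f\|_{U^s}\ge 0$ and $\|f\|_{U^s(T)}$ are defined by $$\|f\|_{U^s}^{2^s}=\sum_{x,h_1,\dots,h_s\in\mathbb Z}\Delta_{h_1,\dots,h_s}f(x),\qquad \|f\|_{U^s(T)}=\|f1_T\|_{U^s}.$$ For positive integers $N,q$ and $f_0,f_1,f_2:\mathbb Z\to\mathbb C$ supported in $[N]$, put $$\Lambda_q(f_0,f_1,f_2)=\sum_{x\in\mathbb Z}\ \sum_{y\in[(N/q)^{1/2}]}f_0(x)f_1(x+y)f_2(x+qy^2).$$ **Theorem ($U^5$-control).** There are absolute constants $c,C>0$ such that the following holds. Let $N,q$ be positive integers, let $\delta>0$, let $f_0,f_1,f_2:\mathbb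 Z\to\mathbb C$ be 1-bounded functions supported in $[N]$, and put $M=(N/q)^{1/2}$. If $N\ge C\,q\,\delta^{-72}$ and $$|\Lambda_q(f_0,f_1,f_2)|\ge\delta NM,$$ then $$\frac1q\sum_{u=1}^{q}\|f_2\|_{U^5(u+q\mathbb Z)}^{2^5}\ \ge\ c\,\delta^{2^{33}}(N/q)^6 .$$ -/

import Mathlib

open scoped BigOperators ComplexConjugate

namespace NonlinearRoth

noncomputable section

/-- The integer interval `[t] = {1, 2, ..., ⌊t⌋}` attached to a real number `t`. -/
def intInterval (t : ℝ) : Finset ℤ := Finset.Icc 1 ⌊t⌋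

/-- A function `f : ℤ → ℂ` is `1`-bounded if `|f| ≤ 1` everywhere. -/
def OneBounded (f : ℤ → ℂ) : Prop := ∀ x, ‖f x‖ ≤ 1

/-- The function `f : ℤ → ℂ` is supported in the interval `[N]`. -/
def SupportedIn (N : ℕ) (f : ℤ → ℂ) : Prop :=
  Function.support f ⊆ (intInterval (N : ℝ) : Set ℤ)

/-- The counting operator
`Λ_q(f₀, f₁, f₂) = ∑_x ∑_{y ∈ [(N/q)^{1/2}]} f₀(x) f₁(x+y) f₂(x+qy²)`.
The sum over `x` has finitely many nonzero terms as soon as `f₀` has finite support. -/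
def countingOp (N q : ℕ) (f₀ f₁ f₂ : ℤ → ℂ) : ℂ :=
  ∑' x : ℤ, ∑ y ∈ intInterval (Real.sqrt ((N : ℝ) / (q : ℝ))),
    f₀ x * f₁ (x + y) * f₂ (x + (q : ℤ) * y ^ 2)

/-- The multiplicative difference `Δ_h f (x) = f(x+h) * conj (f(x))`. -/
def mulDiff (h : ℤ) (f : ℤ → ℂ) : ℤ → ℂ := fun x => f (x + h) * conj (f x)

/-- The iterated difference `Δ_{h₁, ..., h_s} f = Δ_{h₁} (Δ_{h₂} ( ⋯ (Δ_{h_s} f)))`. -/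
def mulDiffs (hs : List ℤ) (f : ℤ → ℂ) : ℤ → ℂ := hs.foldr mulDiff f

/-- The sum `∑_{x, h₁, ..., h_s ∈ ℤ} Δ_{h₁, ..., h_s} f(x)`
(finitely many nonzero terms when `f` has finite support). -/
def gowersSum (s : ℕ) (f : ℤ → ℂ) : ℂ :=
  ∑' p : ℤ × (Fin s → ℤ), mulDiffs (List.ofFn p.2) f p.1

/-- The `U^s`-norm (`s ≥ 1`) of a finitely supported function: the nonnegative `2^s`-th root of
`∑_{x, h₁, ..., h_s} Δ_{h₁, ..., h_s} f(x)`. This sum is a nonnegative real number, so that taking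
its real part loses nothing; see `gowersNorm_pow`. -/
def gowersNorm (s : ℕ) (f : ℤ → ℂ) : ℝ :=
  (gowersSum s f).re ^ ((1 : ℝ) / (2 : ℝ) ^ s)

/-- The localized norm `‖f‖_{U^s(T)} = ‖f 1_T‖_{U^s}`. -/
def gowersNormOn (s : ℕ) (T : Set ℤ) (f : ℤ → ℂ) : ℝ :=
  gowersNorm s (T.indicator f)

/-- The residue class `u + qℤ`. -/
def progression (u : ℤ) (q : ℕ) : Set ℤ := Set.range fun k : ℤ => u + (q : ℤ) * k

theorem mulDiff_support_finite (h : ℤ) {f : ℤ → ℂ} (hf : (Function.support f).Finite) :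
    (Function.support (mulDiff h f)).Finite := by
  refine hf.subset fun x hx => ?_
  simp only [Function.mem_support, mulDiff] at hx ⊢
  exact fun h0 => hx (by simp [h0])

theorem mulDiffs_support_subset (hs : List ℤ) (f : ℤ → ℂ) :
    Function.support (mulDiffs hs f) ⊆ Function.support f := by
  induction hs with
  | nil => exact subset_rfl
  | cons h t ih =>
    intro x hx
    apply ih
    simp only [Function.mem_support] at hx ⊢
    exact fun h0 => hx (by
      change mulDiff h (mulDiffs t f) x = 0
      simp [mulDiff, h0])

theorem mulDiffs_shift_ne_zero (hs : List ℤ) (f : ℤ → ℂ) (x : ℤ)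
    (hx : mulDiffs hs f x ≠ 0) : ∀ h ∈ hs, f (x + h) ≠ 0 := by
  induction hs with
  | nil => simp
  | cons h t ih =>
    have hx' : mulDiffs t f (x + h) * conj (mulDiffs t f x) ≠ 0 := hx
    have h1 := left_ne_zero_of_mul hx'
    have h2 : mulDiffs t f x ≠ 0 := fun h0 => right_ne_zero_of_mul hx' (by simp [h0])
    intro k hk
    rcases List.mem_cons.1 hk with rfl | hk
    · exact mulDiffs_support_subset t f h1
    · exact ih h2 k hk

theorem gowersSum_support_finite (s : ℕ) {f : ℤ → ℂ} (hf : (Function.support f).Finite) :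
    (Function.support fun p : ℤ × (Fin s → ℤ) => mulDiffs (List.ofFn p.2) f p.1).Finite := by
  have hfin : (Function.support f ×ˢ
      Set.pi Set.univ (fun _ : Fin s => Set.image2 (fun a b => a - b)
        (Function.support f) (Function.support f))).Finite :=
    hf.prod (Set.Finite.pi fun _ => hf.image2 _ hf)
  refine hfin.subset ?_
  rintro ⟨x, h⟩ hx
  have hx0 : f x ≠ 0 := mulDiffs_support_subset _ f hx
  refine ⟨hx0, fun i _ => ⟨x + h i, ?_, x, hx0, by simp⟩⟩
  exact mulDiffs_shift_ne_zero _ f x hx (h i) (by simp [List.mem_ofFn])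

theorem tsum_mulDiff {g : ℤ → ℂ} (hg : (Function.support g).Finite) :
    ∑' p : ℤ × ℤ, mulDiff p.2 g p.1 = ((‖∑' x, g x‖ ^ 2 : ℝ) : ℂ) := by
  have hs : Summable g := summable_of_hasFiniteSupport hg
  have hc : Summable fun x => conj (g x) := by
    refine summable_of_hasFiniteSupport (hg.subset fun x hx => ?_)
    simpa using hx
  have hprod : Summable fun p : ℤ × ℤ => g p.1 * conj (g p.2) := by
    refine summable_of_hasFiniteSupport ((hg.prod hg).subset fun p hp => ?_)
    have hp' : g p.1 * conj (g p.2) ≠ 0 := hp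
    exact ⟨left_ne_zero_of_mul hp', fun h0 => right_ne_zero_of_mul hp' (by simp [h0])⟩
  let e : ℤ × ℤ ≃ ℤ × ℤ :=
    { toFun := fun p => (p.1 + p.2, p.1)
      invFun := fun p => (p.2, p.1 - p.2)
      left_inv := fun p => by simp
      right_inv := fun p => by simp }
  have h1 : ∑' p : ℤ × ℤ, mulDiff p.2 g p.1 = ∑' p : ℤ × ℤ, g p.1 * conj (g p.2) :=
    e.tsum_eq (fun p : ℤ × ℤ => g p.1 * conj (g p.2))
  rw [h1, ← hs.tsum_mul_tsum hc hprod, ← Complex.conj_tsum, Complex.mul_conj,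
    Complex.normSq_eq_norm_sq]

/-- For `s ≥ 1` the defining sum of the `U^s`-norm is a sum of squares. -/
theorem gowersSum_succ (s : ℕ) {f : ℤ → ℂ} (hf : (Function.support f).Finite) :
    gowersSum (s + 1) f =
      ((∑' h : Fin s → ℤ, ‖∑' x, mulDiffs (List.ofFn h) f x‖ ^ 2 : ℝ) : ℂ) := by
  let e : (Fin s → ℤ) × (ℤ × ℤ) ≃ ℤ × (Fin (s + 1) → ℤ) :=
    { toFun := fun p => (p.2.1, Fin.cons p.2.2 p.1)
      invFun := fun p => (Fin.tail p.2, (p.1, p.2 0))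
      left_inv := fun p => by simp
      right_inv := fun p => by simp }
  have hsum : Summable fun p : ℤ × (Fin (s + 1) → ℤ) => mulDiffs (List.ofFn p.2) f p.1 :=
    summable_of_hasFiniteSupport (gowersSum_support_finite (s + 1) hf)
  have key : ∀ p : (Fin s → ℤ) × (ℤ × ℤ), mulDiffs (List.ofFn (e p).2) f (e p).1 =
      mulDiff p.2.2 (mulDiffs (List.ofFn p.1) f) p.2.1 := by
    intro p
    simp [e, List.ofFn_succ, mulDiffs]
  have hsum' : Summable fun p : (Fin s → ℤ) × (ℤ × ℤ) =>
      mulDiff p.2.2 (mulDiffs (List.ofFn p.1) f) p.2.1 := by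
    have := (e.summable_iff).2 hsum
    refine this.congr fun p => ?_
    exact key p
  unfold gowersSum
  rw [← e.tsum_eq, tsum_congr key, hsum'.tsum_prod, Complex.ofReal_tsum]
  exact tsum_congr fun h => tsum_mulDiff (hf.subset (mulDiffs_support_subset (List.ofFn h) f))

/-- The defining identity `‖f‖_{U^s}^{2^s} = ∑_{x, h₁, ..., h_s} Δ_{h₁, ..., h_s} f(x)`. -/
theorem gowersNorm_pow {s : ℕ} (hs : 1 ≤ s) {f : ℤ → ℂ} (hf : (Function.support f).Finite) :
    ((gowersNorm s f ^ (2 ^ s) : ℝ) : ℂ) = gowersSum s f := by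
  obtain ⟨t, rfl⟩ : ∃ t, s = t + 1 := ⟨s - 1, by omega⟩
  have h := gowersSum_succ t hf
  have h0 : 0 ≤ (gowersSum (t + 1) f).re := by
    rw [h, Complex.ofReal_re]
    exact tsum_nonneg fun _ => by positivity
  have h2 : ((2 ^ (t + 1) : ℕ) : ℝ) = (2 : ℝ) ^ (t + 1) := by push_cast; rfl
  have h1 : gowersNorm (t + 1) f ^ (2 ^ (t + 1)) = (gowersSum (t + 1) f).re := by
    unfold gowersNorm
    rw [← Real.rpow_natCast, ← Real.rpow_mul h0, h2, one_div_mul_cancel (by positivity),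
      Real.rpow_one]
  rw [h1, h, Complex.ofReal_re]

end

end NonlinearRoth

/-! Two applications of Cauchy–Schwarz remove `f₀` and `f₁`. What remains (`linearise`), for typical
shifts `a`, `b`, is a correlation of four translates of `f₂` by fixed amounts plus `0`, `2qay`,
`2qby`, `2q(a+b)y`: the terms quadratic in `y` cancel after a translation of `x`. All `y`-dependent
shifts are multiples of `q`, so each residue class modulo `q` can be treated separately, as a copy
of `ℤ/nℤ` with `n = 16M²`.

Replacing `y` by `p + i + j + k` with `i, j, k` in a short interval of length `H ≈ δ⁴M` and
translating again, one factor is evaluated at `2q(ai + bj + (a+b)k)`, while each of the other three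
misses one of `i`, `j`, `k` (`exists_cubeCorrelation`). So `f₂` has large box correlations along the
directions `a`, `b`, `a + b`, for many pairs `(a, b)`.

A single direction `a` yields only a sparse progression of `H` points in a group of order about
`M²`. The gain comes from averaging over directions: if `gcd(a, a')` is small, the sums `2ai +
2a'i'` take each value few times (`card_dilate_solutions_le`), hence fill a proportion about `H²/n ≈
δ⁸` of the group. Few pairs have a large gcd (`card_large_gcd_le`). Since the norm of a derivative
is a positive-definite function of the shift (`gU_gDiff_expect_sq_le`), the averaged norms of
derivatives along many such directions are bounded by the next uniformity norm (`concatenation`,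
`gU_succ_lower`).

The triples `(a, c - a, c)` are handled by fixing `c`. Cauchy–Schwarz differentiates `f₂` along `c`
and leaves two-dimensional correlations along `(a, c - a)`. These are dualised: correlations of dual
functions for `a` and `a'` are bounded by a box average along `a'`, `c - a'` of an average along
`a`, which is controlled by the `U³`-norm of derivatives along `c - a`. Concatenation over `a` gives
`U⁴` (`two_dimensional_control`), and concatenation over `c` gives `U⁵`
(`three_dimensional_control`). Every loss is polynomial in `δ`. -/

namespace NonlinearRoth

/-! ### Cauchy–Schwarz and rearrangement for finite averages. -/

section Expect

open Finset

variable {ι κ : Type*}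

theorem norm_expect_sq_le (s : Finset ι) (f : ι → ℂ) :
    ‖𝔼 i ∈ s, f i‖ ^ 2 ≤ 𝔼 i ∈ s, ‖f i‖ ^ 2 := by
  have h1 : ‖𝔼 i ∈ s, f i‖ ≤ 𝔼 i ∈ s, ‖f i‖ := RCLike.norm_expect_le (K := ℂ)
  have h2 := expect_mul_sq_le_sq_mul_sq s (fun i => ‖f i‖) (fun _ => (1 : ℝ))
  rcases s.eq_empty_or_nonempty with rfl | hs
  · simp
  · simp only [mul_one, one_pow, expect_const hs] at h2
    exact (pow_le_pow_left₀ (norm_nonneg _) h1 2).trans h2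

theorem expect_pow_le (s : Finset ι) (f : ι → ℝ) (hf : ∀ i ∈ s, 0 ≤ f i) (k : ℕ) (hk : k ≠ 0) :
    (𝔼 i ∈ s, f i) ^ k ≤ 𝔼 i ∈ s, f i ^ k := by
  rcases s.eq_empty_or_nonempty with rfl | hs
  · simp [hk]
  · have hc : (0 : ℝ) < #s := by exact_mod_cast hs.card_pos
    have := Real.pow_arith_mean_le_arith_mean_pow s (fun _ => (#s : ℝ)⁻¹) f
      (fun _ _ => by positivity) (by simp [hc.ne']) hf k
    simpa [expect_eq_sum_div_card, ← mul_sum, div_eq_inv_mul] using this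

theorem norm_expect_mul_sq_le (s : Finset ι) (a b : ι → ℂ) (ha : ∀ i ∈ s, ‖a i‖ ≤ 1) :
    ‖𝔼 i ∈ s, a i * b i‖ ^ 2 ≤ 𝔼 i ∈ s, ‖b i‖ ^ 2 := by
  refine (norm_expect_sq_le s _).trans (expect_le_expect fun i hi => ?_)
  rw [norm_mul]
  exact pow_le_pow_left₀ (by positivity) (mul_le_of_le_one_left (norm_nonneg _) (ha i hi)) 2

theorem conj_expect (s : Finset ι) (f : ι → ℂ) :
    conj (𝔼 i ∈ s, f i) = 𝔼 i ∈ s, conj (f i) := by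
  simp only [expect_eq_sum_div_card, map_div₀, map_sum, map_natCast]

theorem norm_expect_sq_eq (s : Finset ι) (f : ι → ℂ) :
    ((‖𝔼 i ∈ s, f i‖ ^ 2 : ℝ) : ℂ) = 𝔼 i ∈ s, 𝔼 j ∈ s, f i * conj (f j) := by
  rw [← Complex.normSq_eq_norm_sq, ← Complex.mul_conj, conj_expect, expect_mul_expect]

theorem norm_expect_le_of_le (s : Finset ι) (f : ι → ℂ) (c : ℝ) (hc : 0 ≤ c)
    (hf : ∀ i ∈ s, ‖f i‖ ≤ c) : ‖𝔼 i ∈ s, f i‖ ≤ c := by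
  refine (RCLike.norm_expect_le (K := ℂ)).trans ?_
  rcases s.eq_empty_or_nonempty with rfl | hs
  · simpa using hc
  · exact expect_le hs hf

theorem expect_le_of_le (s : Finset ι) (f : ι → ℝ) (c : ℝ) (hc : 0 ≤ c)
    (hf : ∀ i ∈ s, f i ≤ c) : 𝔼 i ∈ s, f i ≤ c := by
  rcases s.eq_empty_or_nonempty with rfl | hs
  · simpa using hc
  · exact expect_le hs hf

theorem ofReal_expect (s : Finset ι) (f : ι → ℝ) :
    ((𝔼 i ∈ s, f i : ℝ) : ℂ) = 𝔼 i ∈ s, (f i : ℂ) := by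
  simp [expect_eq_sum_div_card]

theorem re_expect (s : Finset ι) (f : ι → ℂ) : (𝔼 i ∈ s, f i).re = 𝔼 i ∈ s, (f i).re := by
  rw [expect_eq_sum_div_card, expect_eq_sum_div_card, ← Complex.re_sum,
    ← Complex.ofReal_natCast, Complex.div_ofReal_re]

theorem expect_rotate {μ : Type*} (s : Finset ι) (t : Finset κ) (u : Finset μ)
    (f : ι → κ → μ → ℂ) : 𝔼 a ∈ s, 𝔼 b ∈ t, 𝔼 c ∈ u, f a b c =
      𝔼 c ∈ u, 𝔼 a ∈ s, 𝔼 b ∈ t, f a b c := by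
  symm
  rw [expect_comm]
  exact expect_congr rfl fun i _ => by rw [expect_comm]

theorem expect_rotate_five {μ : Type*} (s : Finset ι) (u : Finset μ)
    (f : ι → ι → ι → ι → ι → ι → μ → ℂ) :
    𝔼 a ∈ s, 𝔼 b ∈ s, 𝔼 c ∈ s, 𝔼 d ∈ s, 𝔼 e ∈ s, 𝔼 g ∈ s, 𝔼 x ∈ u, f a b c d e g x =
      𝔼 c ∈ s, 𝔼 d ∈ s, 𝔼 e ∈ s, 𝔼 g ∈ s, 𝔼 x ∈ u, 𝔼 a ∈ s, 𝔼 b ∈ s, f a b c d e g x := by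
  refine (expect_rotate s s s _).trans (expect_congr rfl fun c _ => ?_)
  refine (expect_rotate s s s _).trans (expect_congr rfl fun d _ => ?_)
  refine (expect_rotate s s s _).trans (expect_congr rfl fun e _ => ?_)
  refine (expect_rotate s s s _).trans (expect_congr rfl fun g _ => ?_)
  exact expect_rotate s s u _

/-- Cauchy–Schwarz: an outer average of coefficients not depending on the inner variable can be
removed. -/
theorem norm_expect_expect_mul_sq_le (S : Finset ι) (J : Finset κ) (ρ : ι → ℂ) (φ : ι → κ → ℂ)
    (hρ : ∀ p ∈ S, ‖ρ p‖ ≤ 1) :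
    ((‖𝔼 j ∈ J, 𝔼 p ∈ S, ρ p * φ p j‖ ^ 2 : ℝ)) ≤
      (𝔼 j ∈ J, 𝔼 k ∈ J, 𝔼 p ∈ S, φ p j * conj (φ p k)).re := by
  have h1 : 𝔼 j ∈ J, 𝔼 p ∈ S, ρ p * φ p j = 𝔼 p ∈ S, ρ p * 𝔼 j ∈ J, φ p j := by
    rw [expect_comm]; simp only [mul_expect]
  have h2 : (𝔼 j ∈ J, 𝔼 k ∈ J, 𝔼 p ∈ S, φ p j * conj (φ p k))
      = ((𝔼 p ∈ S, ‖𝔼 j ∈ J, φ p j‖ ^ 2 : ℝ) : ℂ) := by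
    rw [ofReal_expect]
    simp only [norm_expect_sq_eq]
    symm
    rw [expect_comm]
    refine expect_congr rfl fun j _ => ?_
    rw [expect_comm]
  rw [h1, h2, Complex.ofReal_re]
  exact norm_expect_mul_sq_le S _ _ hρ

end Expect

section Translate

open Finset

variable {G : Type*} [AddCommGroup G] [Fintype G] {M : Type*} [AddCommMonoid M] [Module ℚ≥0 M]

theorem expect_add_right (t : G) (f : G → M) : 𝔼 x, f (x + t) = 𝔼 x, f x :=
  Fintype.expect_equiv (Equiv.addRight t) _ _ fun _ => rfl

theorem expect_sub_right (t : G) (f : G → M) : 𝔼 x, f (x - t) = 𝔼 x, f x :=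
  Fintype.expect_equiv (Equiv.subRight t) _ _ fun _ => rfl

end Translate

/-! ### Box averages along two directions. -/

section Box

open Finset

variable {G ι : Type*} [AddCommGroup G] [Fintype G]

/-- The average over a box of the product of four translates of `k` along the directions `A`
and `B`. -/
noncomputable def boxForm (J : Finset ι) (A B : ι → G) (k : G → ℂ) : ℝ :=
  𝔼 x : G, 𝔼 j₁ ∈ J, 𝔼 j₂ ∈ J, ‖𝔼 i ∈ J, k (x + A i + B j₁) * conj (k (x + A i + B j₂))‖ ^ 2

/-- Each weight misses one of the two box variables, so one Cauchy–Schwarz in `j` for fixed `(x, i)`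
drops `u`, and a second, after duplicating `j`, drops the remaining product of values of `v`. The
maps `A`, `B` need no structure here. -/
theorem box_cauchy_schwarz (J : Finset ι) (A B : ι → G) (u v : G → ι → ℂ) (k : G → ℂ)
    (hu : ∀ x i, ‖u x i‖ ≤ 1) (hv : ∀ x i, ‖v x i‖ ≤ 1) :
    ‖𝔼 x : G, 𝔼 i ∈ J, 𝔼 j ∈ J, u x i * v x j * k (x + A i + B j)‖ ^ 4 ≤ boxForm J A B k := by
  have h1 : ‖𝔼 x : G, 𝔼 i ∈ J, 𝔼 j ∈ J, u x i * v x j * k (x + A i + B j)‖ ^ 2 ≤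
      𝔼 x : G, 𝔼 i ∈ J, ‖𝔼 j ∈ J, v x j * k (x + A i + B j)‖ ^ 2 := by
    refine (norm_expect_sq_le _ _).trans (expect_le_expect fun x _ => ?_)
    simp only [mul_assoc, ← mul_expect]
    exact norm_expect_mul_sq_le _ _ _ fun i _ => hu x i
  have h2 : ((𝔼 x : G, 𝔼 i ∈ J, ‖𝔼 j ∈ J, v x j * k (x + A i + B j)‖ ^ 2 : ℝ) : ℂ) =
      𝔼 x : G, 𝔼 j₁ ∈ J, 𝔼 j₂ ∈ J, (v x j₁ * conj (v x j₂)) *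
        𝔼 i ∈ J, k (x + A i + B j₁) * conj (k (x + A i + B j₂)) := by
    simp only [ofReal_expect, norm_expect_sq_eq]
    refine expect_congr rfl fun x _ => ?_
    rw [expect_comm]
    refine expect_congr rfl fun j₁ _ => ?_
    rw [expect_comm]
    refine expect_congr rfl fun j₂ _ => ?_
    rw [mul_expect]
    refine expect_congr rfl fun i _ => ?_
    simp only [map_mul]; ring
  have h3 : (𝔼 x : G, 𝔼 i ∈ J, ‖𝔼 j ∈ J, v x j * k (x + A i + B j)‖ ^ 2 : ℝ) ^ 2 ≤
      boxForm J A B k := by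
    have h0 : 0 ≤ (𝔼 x : G, 𝔼 i ∈ J, ‖𝔼 j ∈ J, v x j * k (x + A i + B j)‖ ^ 2 : ℝ) :=
      expect_nonneg fun _ _ => expect_nonneg fun _ _ => by positivity
    rw [← Complex.norm_of_nonneg h0, h2]
    refine (norm_expect_sq_le _ _).trans (expect_le_expect fun x _ => ?_)
    refine (norm_expect_sq_le _ _).trans (expect_le_expect fun j₁ _ => ?_)
    refine norm_expect_mul_sq_le _ _ _ fun j₂ _ => ?_
    rw [norm_mul, RCLike.norm_conj]
    exact mul_le_one₀ (hv _ _) (norm_nonneg _) (hv _ _)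
  calc _ = (‖𝔼 x : G, 𝔼 i ∈ J, 𝔼 j ∈ J, u x i * v x j * k (x + A i + B j)‖ ^ 2) ^ 2 := by ring
    _ ≤ _ := (pow_le_pow_left₀ (by positivity) h1 2).trans h3

theorem boxForm_eq (J : Finset ι) (A B : ι → G) (k : G → ℂ) :
    ((boxForm J A B k : ℝ) : ℂ) = 𝔼 j₁ ∈ J, 𝔼 j₂ ∈ J, 𝔼 i₁ ∈ J, 𝔼 i₂ ∈ J, 𝔼 x : G,
      k (x + A i₁ + B j₁) * conj (k (x + A i₁ + B j₂)) *
        conj (k (x + A i₂ + B j₁) * conj (k (x + A i₂ + B j₂))) := by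
  unfold boxForm
  simp only [ofReal_expect, norm_expect_sq_eq]
  rw [expect_comm]
  refine expect_congr rfl fun j₁ _ => ?_
  rw [expect_comm]
  refine expect_congr rfl fun j₂ _ => ?_
  rw [expect_comm]
  refine expect_congr rfl fun i₁ _ => ?_
  rw [expect_comm]

end Box

/-! ### Correlations of products along pairs of boxes. -/

section BoxDual

open Finset

/-- The product of four complex numbers with the conjugation pattern of a box average. -/
def boxProd (a b c d : ℂ) : ℂ := a * conj b * conj (c * conj d)

theorem boxProd_mul (a b c d a' b' c' d' : ℂ) :
    boxProd (a * a') (b * b') (c * c') (d * d') = boxProd a b c d * boxProd a' b' c' d' := by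
  simp only [boxProd, map_mul]; ring

theorem conj_boxProd (a b c d : ℂ) :
    conj (boxProd a b c d) = boxProd (conj a) (conj b) (conj c) (conj d) := by
  simp only [boxProd, map_mul, Complex.conj_conj]

theorem norm_boxProd_le {a b c d : ℂ} (ha : ‖a‖ ≤ 1) (hb : ‖b‖ ≤ 1) (hc : ‖c‖ ≤ 1)
    (hd : ‖d‖ ≤ 1) : ‖boxProd a b c d‖ ≤ 1 := by
  simp only [boxProd, norm_mul, RCLike.norm_conj]
  exact mul_le_one₀ (mul_le_one₀ ha (norm_nonneg _) hb) (by positivity)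
    (mul_le_one₀ hc (norm_nonneg _) hd)

theorem boxProd_expect {ι : Type*} (J : Finset ι) (a b c d : ι → ℂ) :
    boxProd (𝔼 i ∈ J, a i) (𝔼 i ∈ J, b i) (𝔼 i ∈ J, c i) (𝔼 i ∈ J, d i) =
      𝔼 p ∈ (J ×ˢ J) ×ˢ (J ×ˢ J), boxProd (a p.1.1) (b p.1.2) (c p.2.1) (d p.2.2) := by
  simp only [boxProd, map_mul, Complex.conj_conj, conj_expect]
  rw [expect_mul_expect, expect_mul_expect, ← expect_product', ← expect_product',
    expect_mul_expect, ← expect_product']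

variable {G ι : Type*} [AddCommGroup G] [Fintype G]

theorem boxForm_eq_boxProd (J : Finset ι) (A B : ι → G) (k : G → ℂ) :
    ((boxForm J A B k : ℝ) : ℂ) = 𝔼 j₁ ∈ J, 𝔼 j₂ ∈ J, 𝔼 i₁ ∈ J, 𝔼 i₂ ∈ J, 𝔼 x : G,
      boxProd (k (x + A i₁ + B j₁)) (k (x + A i₁ + B j₂)) (k (x + A i₂ + B j₁))
        (k (x + A i₂ + B j₂)) := boxForm_eq J A B k

/-- The correlation of two products of functions, each invariant along one direction of its own
box, is controlled by the box average of one of them along the other directions. -/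
theorem pair_correlation_le (J : Finset ι) (A B A' B' : ι → G) (u v R L : G → ι → ℂ)
    (hu : ∀ x i, ‖u x i‖ ≤ 1) (hv : ∀ x i, ‖v x i‖ ≤ 1) (hR : ∀ x i, ‖R x i‖ ≤ 1) :
    ‖𝔼 i ∈ J, 𝔼 j ∈ J, 𝔼 x : G, 𝔼 i' ∈ J, 𝔼 j' ∈ J, u x i' * v x j' *
        (R (x + A' i' + B' j' - (A i + B j)) i * L (x + A' i' + B' j' - (A i + B j)) j)‖ ^ 8 ≤
      𝔼 j₁ ∈ J, 𝔼 j₂ ∈ J, 𝔼 i₁ ∈ J, 𝔼 i₂ ∈ J, 𝔼 x : G, ‖𝔼 j ∈ J,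
        boxProd (L (x + A' i₁ + B' j₁) j) (L (x + A' i₁ + B' j₂) j) (L (x + A' i₂ + B' j₁) j)
          (L (x + A' i₂ + B' j₂) j)‖ ^ 2 := by
  have h1 : ‖𝔼 i ∈ J, 𝔼 j ∈ J, 𝔼 x : G, 𝔼 i' ∈ J, 𝔼 j' ∈ J, u x i' * v x j' *
        (R (x + A' i' + B' j' - (A i + B j)) i * L (x + A' i' + B' j' - (A i + B j)) j)‖ ^ 4 ≤
      𝔼 i ∈ J, 𝔼 j ∈ J, boxForm J A' B' fun y => R (y - (A i + B j)) i * L (y - (A i + B j)) j := by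
    refine (pow_le_pow_left₀ (norm_nonneg _) (RCLike.norm_expect_le (K := ℂ)) 4).trans ?_
    refine (expect_pow_le _ _ (fun _ _ => norm_nonneg _) 4 (by norm_num)).trans ?_
    refine expect_le_expect fun i _ => ?_
    refine (pow_le_pow_left₀ (norm_nonneg _) (RCLike.norm_expect_le (K := ℂ)) 4).trans ?_
    refine (expect_pow_le _ _ (fun _ _ => norm_nonneg _) 4 (by norm_num)).trans ?_
    refine expect_le_expect fun j _ => ?_
    exact box_cauchy_schwarz J A' B' u v (fun y => R (y - (A i + B j)) i * L (y - (A i + B j)) j)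
      hu hv
  have h0 : 0 ≤ 𝔼 i ∈ J, 𝔼 j ∈ J,
      boxForm J A' B' fun y => R (y - (A i + B j)) i * L (y - (A i + B j)) j :=
    (by positivity : (0:ℝ) ≤ _ ^ 4).trans h1
  have h2 : ((𝔼 i ∈ J, 𝔼 j ∈ J,
      boxForm J A' B' fun y => R (y - (A i + B j)) i * L (y - (A i + B j)) j : ℝ) : ℂ) =
      𝔼 j₁ ∈ J, 𝔼 j₂ ∈ J, 𝔼 i₁ ∈ J, 𝔼 i₂ ∈ J, 𝔼 x : G,
        (𝔼 i ∈ J, boxProd (R (x + A' i₁ + B' j₁) i) (R (x + A' i₁ + B' j₂) i)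
          (R (x + A' i₂ + B' j₁) i) (R (x + A' i₂ + B' j₂) i)) *
        𝔼 j ∈ J, boxProd (L (x + A' i₁ + B' j₁) j) (L (x + A' i₁ + B' j₂) j)
          (L (x + A' i₂ + B' j₁) j) (L (x + A' i₂ + B' j₂) j) := by
    simp only [ofReal_expect, boxForm_eq_boxProd]
    -- Translating `x` by `A i + B j` removes that shift from every factor; then `R` involves only
    -- `i` and `L` only `j`, so the average over `(i, j)` factors.
    have hs : ∀ i j : ι, ∀ j₁ j₂ i₁ i₂ : ι, 𝔼 x : G,
        boxProd (R (x + A' i₁ + B' j₁ - (A i + B j)) i * L (x + A' i₁ + B' j₁ - (A i + B j)) j)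
          (R (x + A' i₁ + B' j₂ - (A i + B j)) i * L (x + A' i₁ + B' j₂ - (A i + B j)) j)
          (R (x + A' i₂ + B' j₁ - (A i + B j)) i * L (x + A' i₂ + B' j₁ - (A i + B j)) j)
          (R (x + A' i₂ + B' j₂ - (A i + B j)) i * L (x + A' i₂ + B' j₂ - (A i + B j)) j) =
        𝔼 x : G, boxProd (R (x + A' i₁ + B' j₁) i) (R (x + A' i₁ + B' j₂) i)
            (R (x + A' i₂ + B' j₁) i) (R (x + A' i₂ + B' j₂) i) *
          boxProd (L (x + A' i₁ + B' j₁) j) (L (x + A' i₁ + B' j₂) j)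
            (L (x + A' i₂ + B' j₁) j) (L (x + A' i₂ + B' j₂) j) := by
      intro i j j₁ j₂ i₁ i₂
      symm
      rw [← expect_sub_right (A i + B j)]
      refine expect_congr rfl fun x _ => ?_
      rw [← boxProd_mul]
      congr 1 <;> congr 2 <;> abel
    simp only [hs, expect_mul_expect]
    exact expect_rotate_five J univ _
  rw [show 8 = 4 * 2 by norm_num, pow_mul]
  refine (pow_le_pow_left₀ (by positivity) h1 2).trans ?_
  rw [← Complex.norm_of_nonneg h0, h2]
  refine (norm_expect_sq_le _ _).trans (expect_le_expect fun j₁ _ => ?_)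
  refine (norm_expect_sq_le _ _).trans (expect_le_expect fun j₂ _ => ?_)
  refine (norm_expect_sq_le _ _).trans (expect_le_expect fun i₁ _ => ?_)
  refine (norm_expect_sq_le _ _).trans (expect_le_expect fun i₂ _ => ?_)
  -- The `R`-factor is bounded by one and is dropped; only the average of `L` survives.
  refine norm_expect_mul_sq_le _ _ _ fun x _ => ?_
  exact norm_expect_le_of_le _ _ _ zero_le_one fun i _ =>
    norm_boxProd_le (hR _ _) (hR _ _) (hR _ _) (hR _ _)

/-- For `L` an average of translates of `F` along `A`, the bound of `pair_correlation_le` is a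
box average of averages along `A` of derivatives of `F`. -/
theorem expect_boxProd_dual_le (J : Finset ι) (A B A' B' : ι → G) (F : G → ℂ) (ρ L : G → ι → ℂ)
    (hρ : ∀ x i, ‖ρ x i‖ ≤ 1) (hL : ∀ y j, L y j = 𝔼 e ∈ J, ρ y e * F (y + A e + B j)) :
    𝔼 j₁ ∈ J, 𝔼 j₂ ∈ J, 𝔼 i₁ ∈ J, 𝔼 i₂ ∈ J, 𝔼 x : G, ‖𝔼 j ∈ J,
        boxProd (L (x + A' i₁ + B' j₁) j) (L (x + A' i₁ + B' j₂) j) (L (x + A' i₂ + B' j₁) j)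
          (L (x + A' i₂ + B' j₂) j)‖ ^ 2 ≤
      𝔼 j ∈ J, 𝔼 k ∈ J, boxForm J A' B' fun y =>
        𝔼 e ∈ J, F (y + A e + B j) * conj (F (y + A e + B k)) := by
  have key : ∀ y₁ y₂ y₃ y₄ : G,
      ‖𝔼 j ∈ J, boxProd (L y₁ j) (L y₂ j) (L y₃ j) (L y₄ j)‖ ^ 2 ≤
      (𝔼 j ∈ J, 𝔼 k ∈ J, boxProd
        (𝔼 e ∈ J, F (y₁ + A e + B j) * conj (F (y₁ + A e + B k)))
        (𝔼 e ∈ J, F (y₂ + A e + B j) * conj (F (y₂ + A e + B k)))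
        (𝔼 e ∈ J, F (y₃ + A e + B j) * conj (F (y₃ + A e + B k)))
        (𝔼 e ∈ J, F (y₄ + A e + B j) * conj (F (y₄ + A e + B k)))).re := by
    intro y₁ y₂ y₃ y₄
    -- A box product of four averages over `e` is one average over quadruples of `e`'s. The twists
    -- `ρ` depend on the quadruple but not on `j`, so Cauchy–Schwarz removes them at the price of
    -- duplicating `j` as `(j, k)`.
    simp only [hL, boxProd_expect, boxProd_mul]
    refine (norm_expect_expect_mul_sq_le ((J ×ˢ J) ×ˢ (J ×ˢ J)) J _ _ fun p _ => ?_).trans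
      (le_of_eq ?_)
    · exact norm_boxProd_le (hρ _ _) (hρ _ _) (hρ _ _) (hρ _ _)
    · congr 1
      refine expect_congr rfl fun j _ => expect_congr rfl fun k _ => expect_congr rfl fun p _ => ?_
      rw [conj_boxProd]
  have h2 : ((𝔼 j ∈ J, 𝔼 k ∈ J, boxForm J A' B' fun y =>
        𝔼 e ∈ J, F (y + A e + B j) * conj (F (y + A e + B k)) : ℝ) : ℂ) =
      𝔼 j₁ ∈ J, 𝔼 j₂ ∈ J, 𝔼 i₁ ∈ J, 𝔼 i₂ ∈ J, 𝔼 x : G, 𝔼 j ∈ J, 𝔼 k ∈ J, boxProd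
        (𝔼 e ∈ J, F (x + A' i₁ + B' j₁ + A e + B j) * conj (F (x + A' i₁ + B' j₁ + A e + B k)))
        (𝔼 e ∈ J, F (x + A' i₁ + B' j₂ + A e + B j) * conj (F (x + A' i₁ + B' j₂ + A e + B k)))
        (𝔼 e ∈ J, F (x + A' i₂ + B' j₁ + A e + B j) * conj (F (x + A' i₂ + B' j₁ + A e + B k)))
        (𝔼 e ∈ J, F (x + A' i₂ + B' j₂ + A e + B j) *
          conj (F (x + A' i₂ + B' j₂ + A e + B k))) := by
    simp only [ofReal_expect, boxForm_eq_boxProd]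
    exact expect_rotate_five J univ _
  rw [← Complex.ofReal_re (𝔼 j ∈ J, 𝔼 k ∈ J, boxForm J A' B' _), h2, re_expect]
  refine expect_le_expect fun j₁ _ => ?_
  rw [re_expect]
  refine expect_le_expect fun j₂ _ => ?_
  rw [re_expect]
  refine expect_le_expect fun i₁ _ => ?_
  rw [re_expect]
  refine expect_le_expect fun i₂ _ => ?_
  rw [re_expect]
  exact expect_le_expect fun x _ => key _ _ _ _

end BoxDual

/-! ### Uniformity norms on a finite abelian group. -/

section GroupNorm

open Finset

variable {G : Type*} [AddCommGroup G]

/-- The multiplicative derivative on an abelian group. -/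
def gDiff (h : G) (f : G → ℂ) : G → ℂ := fun x => f (x + h) * conj (f x)

theorem gDiff_comm (h k : G) (f : G → ℂ) : gDiff h (gDiff k f) = gDiff k (gDiff h f) := by
  funext x
  simp only [gDiff, map_mul, Complex.conj_conj, add_right_comm x k h]
  ring

theorem norm_gDiff_le {f : G → ℂ} (hf : ∀ x, ‖f x‖ ≤ 1) (h x : G) : ‖gDiff h f x‖ ≤ 1 := by
  simp only [gDiff, norm_mul, RCLike.norm_conj]
  exact mul_le_one₀ (hf _) (norm_nonneg _) (hf _)

variable [Fintype G]

/-- The normalized `2^(s+1)`-th power of the `U^(s+1)`-norm on a finite abelian group. -/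
noncomputable def gU : ℕ → (G → ℂ) → ℝ
  | 0, f => ‖𝔼 x, f x‖ ^ 2
  | s + 1, f => 𝔼 h, gU s (gDiff h f)

theorem gU_nonneg (s : ℕ) (f : G → ℂ) : 0 ≤ gU s f := by
  induction s generalizing f with
  | zero => unfold gU; positivity
  | succ s ih => exact expect_nonneg fun _ _ => ih _

theorem gU_le_one (s : ℕ) {f : G → ℂ} (hf : ∀ x, ‖f x‖ ≤ 1) : gU s f ≤ 1 := by
  induction s generalizing f with
  | zero =>
    unfold gU
    exact pow_le_one₀ (norm_nonneg _) (norm_expect_le_of_le _ _ _ zero_le_one fun x _ => hf x)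
  | succ s ih => exact expect_le_of_le _ _ _ zero_le_one fun h _ => ih (norm_gDiff_le hf h)

theorem gU_translate (s : ℕ) (f : G → ℂ) (t : G) : gU s (fun x => f (x + t)) = gU s f := by
  induction s generalizing f with
  | zero => unfold gU; rw [expect_add_right]
  | succ s ih =>
    unfold gU
    refine expect_congr rfl fun h _ => ?_
    rw [← ih (gDiff h f)]
    congr 1
    funext x
    simp only [gDiff, add_right_comm]

theorem norm_expect_sq_eq_gDiff (g : G → ℂ) :
    ‖𝔼 x, g x‖ ^ 2 = 𝔼 h, (𝔼 x, gDiff h g x).re := by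
  rw [← re_expect, ← Complex.ofReal_re (‖𝔼 x, g x‖ ^ 2), norm_expect_sq_eq]
  congr 1
  rw [expect_comm]
  symm
  rw [expect_comm]
  refine expect_congr rfl fun x _ => ?_
  rw [← expect_add_right x (fun y => g y * conj (g x))]
  refine expect_congr rfl fun h _ => ?_
  rw [gDiff, add_comm]

/-- Correlations of translates of a bounded function satisfy van der Corput's inequality. -/
theorem correlation_expect_sq_le {ι : Type*} (S : Finset ι) (t : ι → G) {H : G → ℂ}
    (hH : ∀ x, ‖H x‖ ≤ 1) :
    (𝔼 σ ∈ S, (𝔼 x, gDiff (t σ) H x).re) ^ 2 ≤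
      𝔼 σ ∈ S, 𝔼 τ ∈ S, (𝔼 x, gDiff (t σ - t τ) H x).re := by
  have h1 : 𝔼 σ ∈ S, (𝔼 x, gDiff (t σ) H x).re =
      (𝔼 x, conj (H x) * 𝔼 σ ∈ S, H (x + t σ)).re := by
    rw [← re_expect, expect_comm]
    congr 1
    refine expect_congr rfl fun x _ => ?_
    rw [mul_expect]
    exact expect_congr rfl fun σ _ => by rw [gDiff, mul_comm]
  have h2 : ((𝔼 x, ‖𝔼 σ ∈ S, H (x + t σ)‖ ^ 2 : ℝ) : ℂ) =
      𝔼 σ ∈ S, 𝔼 τ ∈ S, 𝔼 x, gDiff (t σ - t τ) H x := by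
    simp only [ofReal_expect, norm_expect_sq_eq]
    rw [expect_comm]
    refine expect_congr rfl fun σ _ => ?_
    rw [expect_comm]
    refine expect_congr rfl fun τ _ => ?_
    rw [← expect_add_right (t τ) (gDiff (t σ - t τ) H)]
    refine expect_congr rfl fun x _ => ?_
    rw [gDiff]
    congr 2
    abel
  rw [h1]
  have h3 : ∀ σ ∈ S, 𝔼 τ ∈ S, (𝔼 x, gDiff (t σ - t τ) H x).re =
      (𝔼 τ ∈ S, 𝔼 x, gDiff (t σ - t τ) H x).re := fun σ _ => by rw [re_expect]
  rw [expect_congr rfl h3, ← re_expect, ← h2, Complex.ofReal_re]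
  refine le_trans ?_ (norm_expect_mul_sq_le univ (fun x => conj (H x)) _ fun x _ => by
    rw [RCLike.norm_conj]; exact hH x)
  exact sq_le_sq.2 ((Complex.abs_re_le_norm _).trans_eq (abs_of_nonneg (norm_nonneg _)).symm)

/-- Norms of derivatives satisfy van der Corput's inequality as a function of the shift. -/
theorem gU_gDiff_expect_sq_le {ι : Type*} (k : ℕ) (S : Finset ι) (t : ι → G) {F : G → ℂ}
    (hF : ∀ x, ‖F x‖ ≤ 1) :
    (𝔼 σ ∈ S, gU k (gDiff (t σ) F)) ^ 2 ≤
      𝔼 σ ∈ S, 𝔼 τ ∈ S, gU k (gDiff (t σ - t τ) F) := by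
  have hsq : ∀ f : G → ℝ, (𝔼 h, f h) ^ 2 ≤ 𝔼 h, f h ^ 2 := fun f => by
    have := expect_mul_sq_le_sq_mul_sq univ f (fun _ : G => (1 : ℝ))
    simpa [Fintype.expect_const] using this
  have hcomm : ∀ (f : G → ι → ι → ℝ), 𝔼 h, 𝔼 σ ∈ S, 𝔼 τ ∈ S, f h σ τ =
      𝔼 σ ∈ S, 𝔼 τ ∈ S, 𝔼 h, f h σ τ := fun f => by
    rw [expect_comm]; exact expect_congr rfl fun σ _ => by rw [expect_comm]
  induction k generalizing F with
  | zero =>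
    -- As derivatives commute, the norm of `gDiff s F` is an average over `h` of autocorrelations of
    -- `gDiff h F` at `s`, and each of these obeys van der Corput.
    have h0 : ∀ s, gU 0 (gDiff s F) = 𝔼 h, (𝔼 x, gDiff s (gDiff h F) x).re := fun s => by
      unfold gU; rw [norm_expect_sq_eq_gDiff]; simp only [gDiff_comm]
    simp only [h0]
    rw [expect_comm, ← hcomm]
    refine (hsq _).trans (expect_le_expect fun h _ => ?_)
    exact correlation_expect_sq_le S t (norm_gDiff_le hF h)
  | succ k ih =>
    have h0 : ∀ s, gU (k + 1) (gDiff s F) = 𝔼 h, gU k (gDiff s (gDiff h F)) := fun s => by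
      rw [gU]; simp only [gDiff_comm]
    simp only [h0]
    rw [expect_comm, ← hcomm]
    refine (hsq _).trans (expect_le_expect fun h _ => ?_)
    exact ih (norm_gDiff_le hF h)

end GroupNorm

/-! ### Directions with bounded multiplicity, and concatenation. -/

section Multiplicity

open Finset

variable {G : Type*} [AddCommGroup G] [Fintype G] [DecidableEq G] {ι : Type*}

theorem sum_comp_le_of_fiber_le (P : Finset ι) (τ : ι → G) (μ : ℕ)
    (hμ : ∀ s, #{p ∈ P | τ p = s} ≤ μ) (φ : G → ℝ) (hφ : ∀ s, 0 ≤ φ s) (t : G) :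
    ∑ p ∈ P, φ (τ p + t) ≤ μ * (Fintype.card G * 𝔼 s, φ s) := by
  rw [Fintype.card_mul_expect, ← Fintype.sum_equiv (Equiv.addRight t) (fun s => φ (s + t)) φ
    (fun _ => rfl), mul_sum, ← sum_fiberwise P τ]
  refine sum_le_sum fun s _ => ?_
  have : ∑ p ∈ P with τ p = s, φ (τ p + t) = ∑ p ∈ P with τ p = s, φ (s + t) :=
    sum_congr rfl fun p hp => by rw [(mem_filter.1 hp).2]
  rw [this, sum_const, nsmul_eq_mul]
  exact mul_le_mul_of_nonneg_right (by exact_mod_cast hμ s) (hφ _)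

/-- Expanding the square gives autocorrelations of `Q` at the differences `τ p - τ p'`; for each
fixed `p'` a given difference occurs at most `μ` times, so the sum over `p` may be extended to all
shifts. -/
theorem expect_norm_sum_translates_sq_le (P : Finset ι) (τ : ι → G) (μ : ℕ)
    (hμ : ∀ s, #{p ∈ P | τ p = s} ≤ μ) (Q : G → ℂ) :
    𝔼 x, ‖∑ p ∈ P, Q (x + τ p)‖ ^ 2 ≤
      #P * (μ * (Fintype.card G * 𝔼 s, ‖𝔼 x, gDiff s Q x‖)) := by
  have h1 : ((𝔼 x, ‖∑ p ∈ P, Q (x + τ p)‖ ^ 2 : ℝ) : ℂ) =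
      ∑ p' ∈ P, ∑ p ∈ P, 𝔼 x, gDiff (τ p + -τ p') Q x := by
    rw [ofReal_expect]
    have : ∀ x, ((‖∑ p ∈ P, Q (x + τ p)‖ ^ 2 : ℝ) : ℂ) =
        ∑ p' ∈ P, ∑ p ∈ P, Q (x + τ p) * conj (Q (x + τ p')) := fun x => by
      rw [← Complex.normSq_eq_norm_sq, ← Complex.mul_conj, map_sum, sum_mul_sum, sum_comm]
    simp only [this]
    rw [expect_sum_comm]
    refine sum_congr rfl fun p' _ => ?_
    rw [expect_sum_comm]
    refine sum_congr rfl fun p _ => ?_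
    rw [← expect_add_right (τ p') (gDiff (τ p + -τ p') Q)]
    refine expect_congr rfl fun x _ => ?_
    rw [gDiff]
    congr 2
    abel
  have h0 : 0 ≤ 𝔼 x, ‖∑ p ∈ P, Q (x + τ p)‖ ^ 2 := expect_nonneg fun _ _ => by positivity
  rw [← Complex.norm_of_nonneg h0, h1]
  refine (norm_sum_le _ _).trans ?_
  rw [← nsmul_eq_mul]
  refine sum_le_card_nsmul _ _ _ fun p' _ => (norm_sum_le _ _).trans ?_
  exact sum_comp_le_of_fiber_le P τ μ hμ (fun s => ‖𝔼 x, gDiff s Q x‖)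
    (fun _ => norm_nonneg _) _

/-- Concatenation: if `w` satisfies van der Corput's inequality and most pairs of directions are
transversal, then the average of `w` over the directions is controlled by its global average. -/
theorem concatenation {H : ℕ} (A : Finset ι) (β : ι → ℤ → G) (w : G → ℝ)
    (hw0 : ∀ s, 0 ≤ w s) (hw1 : ∀ s, w s ≤ 1)
    (hw : ∀ (S : Finset (ι × ℤ × ℤ)) (t : ι × ℤ × ℤ → G),
      (𝔼 σ ∈ S, w (t σ)) ^ 2 ≤ 𝔼 σ ∈ S, 𝔼 τ ∈ S, w (t σ - t τ))
    (good : ι → ι → Prop) [∀ a a', Decidable (good a a')] (b μ : ℕ)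
    (hb : #{p ∈ A ×ˢ A | ¬ good p.1 p.2} ≤ b)
    (hμ : ∀ a ∈ A, ∀ a' ∈ A, good a a' → ∀ s,
      #{p ∈ Ico (0 : ℤ) H ×ˢ Ico (0 : ℤ) H | β a p.1 - β a' p.2 = s} ≤ μ) :
    (∑ a ∈ A, 𝔼 j ∈ Ico (0 : ℤ) H, 𝔼 k ∈ Ico (0 : ℤ) H, w (β a j - β a k)) ^ 2 ≤
      b + (#A : ℝ) ^ 2 * (μ * (Fintype.card G / (H : ℝ) ^ 2) * 𝔼 s, w s) := by
  set J := Ico (0 : ℤ) H with hJ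
  have hE0 : 0 ≤ 𝔼 s, w s := expect_nonneg fun s _ => hw0 s
  have hJc : (#J : ℝ) = H := by simp [hJ]
  rcases A.eq_empty_or_nonempty with rfl | hA
  · simp
  -- Van der Corput is applied to the whole family of differences `β a j - β a k` at once, so that
  -- two independent directions `a`, `a'` appear together in one argument.
  have key := hw (A ×ˢ (J ×ˢ J)) (fun σ => β σ.1 σ.2.1 - β σ.1 σ.2.2)
  simp only [expect_product] at key
  have hsum : ∀ f : ι → ℝ, ∑ a ∈ A, f a = #A * 𝔼 a ∈ A, f a := fun f => by
    rw [card_mul_expect]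
  have hpair : ∀ a ∈ A, ∀ a' ∈ A, 𝔼 j ∈ J, 𝔼 k ∈ J, 𝔼 j' ∈ J, 𝔼 k' ∈ J,
      w (β a j - β a k - (β a' j' - β a' k')) ≤
      (if ¬ good a a' then 1 else 0) + μ * (Fintype.card G / (H : ℝ) ^ 2) * 𝔼 s, w s := by
    intro a ha a' ha'
    split_ifs with hg
    -- With `k`, `k'` frozen, `β a j - β a' j'` hits each point at most `μ` times, so averaging over
    -- the `H²` pairs `(j, j')` costs `μ |G| / H²` against the global average.
    · have : 𝔼 j ∈ J, 𝔼 k ∈ J, 𝔼 j' ∈ J, 𝔼 k' ∈ J, w (β a j - β a k - (β a' j' - β a' k')) =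
          𝔼 k ∈ J, 𝔼 k' ∈ J, 𝔼 j ∈ J, 𝔼 j' ∈ J, w (β a j - β a k - (β a' j' - β a' k')) := by
        rw [expect_comm]
        refine expect_congr rfl fun k _ => ?_
        symm
        rw [expect_comm]
        refine expect_congr rfl fun j _ => ?_
        rw [expect_comm]
      rw [this, zero_add]
      refine expect_le_of_le _ _ _ (by positivity) fun k _ => ?_
      refine expect_le_of_le _ _ _ (by positivity) fun k' _ => ?_
      have h1 := sum_comp_le_of_fiber_le (J ×ˢ J) (fun p => β a p.1 - β a' p.2) μ
        (hμ a ha a' ha' hg) w hw0 (β a' k' - β a k)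
      rw [← expect_product', expect_eq_sum_div_card, card_product, Nat.cast_mul, hJc, ← sq]
      have h2 : ∑ p ∈ J ×ˢ J, w (β a p.1 - β a k - (β a' p.2 - β a' k')) =
          ∑ p ∈ J ×ˢ J, w (β a p.1 - β a' p.2 + (β a' k' - β a k)) :=
        sum_congr rfl fun p _ => by congr 1; abel
      rw [h2]
      calc _ ≤ μ * (Fintype.card G * 𝔼 s, w s) / (H : ℝ) ^ 2 := by gcongr
        _ = _ := by ring
    · have : (0 : ℝ) ≤ μ * (Fintype.card G / (H : ℝ) ^ 2) * 𝔼 s, w s := by positivity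
      refine le_trans ?_ (le_add_of_nonneg_right this)
      refine expect_le_of_le _ _ _ zero_le_one fun j _ => ?_
      refine expect_le_of_le _ _ _ zero_le_one fun k _ => ?_
      refine expect_le_of_le _ _ _ zero_le_one fun j' _ => ?_
      exact expect_le_of_le _ _ _ zero_le_one fun k' _ => hw1 _
  rw [hsum, mul_pow]
  calc _ ≤ (#A : ℝ) ^ 2 * 𝔼 a ∈ A, 𝔼 a' ∈ A, ((if ¬ good a a' then 1 else 0) +
        μ * (Fintype.card G / (H : ℝ) ^ 2) * 𝔼 s, w s) := by
        refine mul_le_mul_of_nonneg_left (key.trans ?_) (by positivity)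
        refine expect_le_expect fun a ha => ?_
        calc _ = 𝔼 a' ∈ A, 𝔼 j ∈ J, 𝔼 k ∈ J, 𝔼 j' ∈ J, 𝔼 k' ∈ J,
              w (β a j - β a k - (β a' j' - β a' k')) := by
              symm
              rw [expect_comm]
              refine expect_congr rfl fun j _ => ?_
              rw [expect_comm]
          _ ≤ _ := expect_le_expect fun a' ha' => hpair a ha a' ha'
    _ ≤ _ := by
        simp only [expect_add_distrib, expect_const hA, mul_add]
        refine add_le_add_left ?_ _
        rw [sq, mul_assoc, card_mul_expect, mul_sum]
        simp only [card_mul_expect]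
        rw [← sum_product', ← sum_filter_add_sum_filter_not (A ×ˢ A) (fun p => ¬ good p.1 p.2)]
        have e1 : ∑ p ∈ A ×ˢ A with ¬ good p.1 p.2, (if ¬ good p.1 p.2 then (1 : ℝ) else 0) =
            #{p ∈ A ×ˢ A | ¬ good p.1 p.2} := by
          rw [sum_congr rfl fun p hp => if_pos (mem_filter.1 hp).2]; simp
        have e2 : ∑ p ∈ A ×ˢ A with ¬ ¬ good p.1 p.2, (if ¬ good p.1 p.2 then (1 : ℝ) else 0) = 0 :=
          sum_eq_zero fun p hp => if_neg (mem_filter.1 hp).2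
        rw [e1, e2, add_zero]
        exact_mod_cast hb

end Multiplicity

/-! ### From box averages of smoothed functions to the `U³`-norm. -/

section BoxOfAverage

open Finset

variable {G : Type*} [AddCommGroup G] [Fintype G] [DecidableEq G]

/-- The box average of an average of `f` along a transversal direction is controlled by a genuine
uniformity norm of `f`. -/
theorem boxForm_average_le {H : ℕ} (hH : 0 < H) (A A' B' : ℤ →+ G) (μ : ℕ)
    (hμ₁ : ∀ s, #{p ∈ Ico (0 : ℤ) H ×ˢ Ico (0 : ℤ) H | A' p.1 + A p.2 = s} ≤ μ)
    (hμ₂ : ∀ s, #{p ∈ Ico (0 : ℤ) H ×ˢ Ioo (-H : ℤ) H | B' p.1 + A p.2 = s} ≤ μ) (f : G → ℂ) :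
    boxForm (Ico (0 : ℤ) H) A' B' (fun y => 𝔼 e ∈ Ico (0 : ℤ) H, f (y + A e)) ≤
      2 * μ ^ 2 * (Fintype.card G / (H : ℝ) ^ 2) ^ 2 *
        𝔼 m, 𝔼 s, ‖𝔼 x, gDiff s (gDiff m f) x‖ := by
  set J := Ico (0 : ℤ) H with hJ
  set D := Ioo (-H : ℤ) H with hD
  set Φ : G → ℝ := fun m => 𝔼 s, ‖𝔼 x, gDiff s (gDiff m f) x‖ with hΦ
  have hΦ0 : ∀ m, 0 ≤ Φ m := fun m => expect_nonneg fun _ _ => norm_nonneg _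
  have hHr : (0 : ℝ) < H := by exact_mod_cast hH
  have hJc : (#J : ℝ) = H := by simp [hJ]
  have hDc : (#D : ℝ) ≤ 2 * H := by
    have : #D ≤ 2 * H := by rw [hD, Int.card_Ioo]; omega
    exact_mod_cast this
  set n : ℝ := (Fintype.card G : ℝ) with hn
  have hn0 : 0 ≤ n := by positivity
  -- the four-fold average over `i, e₁, e₂` reorganised by the difference `d = e₂ - e₁`
  have hexp : ∀ (x : G) (j₁ j₂ : ℤ),
      𝔼 i ∈ J, (𝔼 e ∈ J, f (x + A' i + B' j₁ + A e)) *
        conj (𝔼 e ∈ J, f (x + A' i + B' j₂ + A e)) =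
      (∑ d ∈ D, ∑ p ∈ (J ×ˢ J) with p.2 + d ∈ J,
        f (x + (A' p.1 + A p.2) + B' j₁) * conj (f (x + (A' p.1 + A p.2) + (B' j₂ + A d)))) /
        (H : ℂ) ^ 3 := by
    intro x j₁ j₂
    have hJc' : (#J : ℂ) = H := by exact_mod_cast hJc
    have e1 : ∀ p : ℤ × ℤ, p ∈ J ×ˢ J → ∑ e₂ ∈ J, f (x + A' p.1 + B' j₁ + A p.2) *
        conj (f (x + A' p.1 + B' j₂ + A e₂)) = ∑ d ∈ D, if p.2 + d ∈ J then
          f (x + (A' p.1 + A p.2) + B' j₁) * conj (f (x + (A' p.1 + A p.2) + (B' j₂ + A d)))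
          else 0 := by
      intro p hp
      rw [← sum_filter]
      symm
      refine sum_nbij' (fun d => p.2 + d) (fun e => e - p.2) ?_ ?_ ?_ ?_ ?_
      · intro d hd; exact (mem_filter.1 hd).2
      · intro e he
        have hp2 := (mem_product.1 hp).2
        simp only [hJ, hD, mem_Ico, mem_filter, mem_Ioo] at he hp2 ⊢
        omega
      · intro d _; ring
      · intro e _; ring
      · intro d _
        rw [map_add]
        congr 2
        · abel
        · congr 1; abel
    simp only [sum_filter]
    rw [sum_comm, ← sum_congr rfl e1, sum_product]
    simp only [conj_expect, expect_mul_expect]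
    simp only [expect_eq_sum_div_card, hJc', ← sum_div, div_div]
    congr 1
    ring
  -- For fixed `d` the sum runs over translates, by `A' i + A e`, of one product which up to
  -- conjugation and translation is the derivative of `f` along `B' j₂ + A d - B' j₁`. This spends
  -- the first multiplicity hypothesis.
  have hQ : ∀ (j₁ j₂ d : ℤ), 𝔼 x : G, ‖∑ p ∈ (J ×ˢ J) with p.2 + d ∈ J,
        f (x + (A' p.1 + A p.2) + B' j₁) * conj (f (x + (A' p.1 + A p.2) + (B' j₂ + A d)))‖ ^ 2 ≤
      (H : ℝ) ^ 2 * (μ * (n * Φ (B' j₂ + A d - B' j₁))) := by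
    intro j₁ j₂ d
    have hfib : ∀ s, #{p ∈ (J ×ˢ J).filter (fun p => p.2 + d ∈ J) | A' p.1 + A p.2 = s} ≤ μ :=
      fun s => (card_le_card (filter_subset_filter _ (filter_subset _ _))).trans (hμ₁ s)
    have h1 := expect_norm_sum_translates_sq_le ((J ×ˢ J).filter (fun p => p.2 + d ∈ J))
      (fun p => A' p.1 + A p.2) μ hfib
      (fun z => f (z + B' j₁) * conj (f (z + (B' j₂ + A d))))
    have h2 : 𝔼 s, ‖𝔼 x, gDiff s (fun z => f (z + B' j₁) * conj (f (z + (B' j₂ + A d)))) x‖ =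
        Φ (B' j₂ + A d - B' j₁) := by
      rw [hΦ]
      refine expect_congr rfl fun s _ => ?_
      rw [← RCLike.norm_conj (𝔼 x, gDiff s (gDiff _ f) x), conj_expect]
      rw [← expect_add_right (B' j₁) (fun x => conj (gDiff s (gDiff (B' j₂ + A d - B' j₁) f) x))]
      congr 2
      funext x
      have e1 : x + s + (B' j₂ + A d) = x + B' j₁ + s + (B' j₂ + A d - B' j₁) := by abel
      have e2 : x + (B' j₂ + A d) = x + B' j₁ + (B' j₂ + A d - B' j₁) := by abel
      have e3 : x + s + B' j₁ = x + B' j₁ + s := by abel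
      simp only [gDiff, map_mul, Complex.conj_conj, e1, e2, e3]
      ring
    rw [h2] at h1
    refine h1.trans (mul_le_mul_of_nonneg_right ?_ (by have := hΦ0 (B' j₂ + A d - B' j₁); positivity))
    have : (#((J ×ˢ J).filter (fun p => p.2 + d ∈ J)) : ℝ) ≤ #(J ×ˢ J) := by
      exact_mod_cast card_filter_le _ _
    rwa [card_product, Nat.cast_mul, hJc, ← sq] at this
  -- Cauchy–Schwarz over the fewer than `2H` differences `d` is the source of the factor 2.
  have hin : ∀ j₁ j₂ : ℤ, 𝔼 x : G, ‖𝔼 i ∈ J, (𝔼 e ∈ J, f (x + A' i + B' j₁ + A e)) *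
        conj (𝔼 e ∈ J, f (x + A' i + B' j₂ + A e))‖ ^ 2 ≤
      2 * μ * n / (H : ℝ) ^ 3 * ∑ d ∈ D, Φ (B' j₂ + A d - B' j₁) := by
    intro j₁ j₂
    simp only [hexp, norm_div, div_pow, norm_pow, Complex.norm_natCast]
    rw [← expect_div, div_le_iff₀ (by positivity)]
    calc _ ≤ 𝔼 x : G, (#D : ℝ) * ∑ d ∈ D, ‖∑ p ∈ (J ×ˢ J) with p.2 + d ∈ J,
        f (x + (A' p.1 + A p.2) + B' j₁) *
          conj (f (x + (A' p.1 + A p.2) + (B' j₂ + A d)))‖ ^ 2 := by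
          refine expect_le_expect fun x _ => ?_
          refine (pow_le_pow_left₀ (norm_nonneg _) (norm_sum_le _ _) 2).trans ?_
          exact sq_sum_le_card_mul_sum_sq
      _ ≤ (2 * H) * ∑ d ∈ D, (H : ℝ) ^ 2 * (μ * (n * Φ (B' j₂ + A d - B' j₁))) := by
          rw [← mul_expect, expect_sum_comm]
          exact mul_le_mul hDc (sum_le_sum fun d _ => hQ j₁ j₂ d)
            (sum_nonneg fun _ _ => expect_nonneg fun _ _ => by positivity) (by positivity)
      _ = _ := by
          simp only [← mul_sum]
          field_simp
  -- The second multiplicity hypothesis spreads the direction `B' j₂ + A d` of the derivative over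
  -- the group.
  have hout : ∀ j₁ : ℤ, 𝔼 j₂ ∈ J, ∑ d ∈ D, Φ (B' j₂ + A d - B' j₁) ≤
      μ * (n * 𝔼 m, Φ m) / H := by
    intro j₁
    have := sum_comp_le_of_fiber_le (J ×ˢ D) (fun p => B' p.1 + A p.2) μ hμ₂ Φ hΦ0 (-B' j₁)
    rw [expect_eq_sum_div_card, hJc, ← sum_product']
    simp only [sub_eq_add_neg]
    gcongr
  have hE0 : 0 ≤ 𝔼 m, Φ m := expect_nonneg fun m _ => hΦ0 m
  unfold boxForm
  rw [expect_comm]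
  refine expect_le_of_le _ _ _ (by positivity) fun j₁ _ => ?_
  rw [expect_comm]
  calc _ ≤ 𝔼 j₂ ∈ J, 2 * μ * n / (H : ℝ) ^ 3 * ∑ d ∈ D, Φ (B' j₂ + A d - B' j₁) :=
        expect_le_expect fun j₂ _ => hin j₁ j₂
    _ ≤ 2 * μ * n / (H : ℝ) ^ 3 * (μ * (n * 𝔼 m, Φ m) / H) := by
        rw [← mul_expect]
        exact mul_le_mul_of_nonneg_left (hout j₁) (by positivity)
    _ = _ := by
        simp only [hΦ]
        field_simp

/-- Squaring turns the moduli `‖𝔼 x, gDiff s (gDiff m f) x‖` into the squared moduli that make up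
`gU 2 f`, the eighth power of the `U³`-norm. -/
theorem boxForm_average_sq_le {H : ℕ} (hH : 0 < H) (A A' B' : ℤ →+ G) (μ : ℕ)
    (hμ₁ : ∀ s, #{p ∈ Ico (0 : ℤ) H ×ˢ Ico (0 : ℤ) H | A' p.1 + A p.2 = s} ≤ μ)
    (hμ₂ : ∀ s, #{p ∈ Ico (0 : ℤ) H ×ˢ Ioo (-H : ℤ) H | B' p.1 + A p.2 = s} ≤ μ) (f : G → ℂ) :
    boxForm (Ico (0 : ℤ) H) A' B' (fun y => 𝔼 e ∈ Ico (0 : ℤ) H, f (y + A e)) ^ 2 ≤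
      (2 * μ ^ 2 * (Fintype.card G / (H : ℝ) ^ 2) ^ 2) ^ 2 * gU 2 f := by
  have hsq : ∀ f : G → ℝ, (𝔼 h, f h) ^ 2 ≤ 𝔼 h, f h ^ 2 := fun f => by
    have := expect_mul_sq_le_sq_mul_sq univ f (fun _ : G => (1 : ℝ))
    simpa [Fintype.expect_const] using this
  have h0 : 0 ≤ boxForm (Ico (0 : ℤ) H) A' B' (fun y => 𝔼 e ∈ Ico (0 : ℤ) H, f (y + A e)) :=
    expect_nonneg fun _ _ => expect_nonneg fun _ _ => expect_nonneg fun _ _ => by positivity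
  refine (pow_le_pow_left₀ h0 (boxForm_average_le hH A A' B' μ hμ₁ hμ₂ f) 2).trans ?_
  rw [mul_pow]
  refine mul_le_mul_of_nonneg_left ?_ (by positivity)
  exact (hsq _).trans (expect_le_expect fun m _ => hsq _)

end BoxOfAverage

/-! ### Counting solutions of linear equations modulo `n`, and pairs with large gcd. -/

section Arithmetic

open Finset

/-- The homomorphism `i ↦ 2 a i` into `ℤ/nℤ`. -/
def dilate (n : ℕ) (a : ℤ) : ℤ →+ ZMod n :=
  (Int.castAddHom (ZMod n)).comp (AddMonoidHom.mulLeft (2 * a))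

theorem dilate_apply (n : ℕ) (a i : ℤ) : dilate n a i = ((2 * a * i : ℤ) : ZMod n) := rfl

theorem card_dilate_solutions_le {n H R K : ℕ} (hH : 0 < H) (hK : 0 < K) (hn : 8 * R * H ≤ n)
    {a b : ℤ} (ha : |a| ≤ R) (hb : |b| ≤ R) (hb' : (H : ℤ) ≤ |b|) (hg : Int.gcd a b ≤ K)
    (S : Finset (ℤ × ℤ)) (hS : ∀ p ∈ S, ∀ p' ∈ S, |p.1 - p'.1| < 2 * H ∧ |p.2 - p'.2| < 2 * H)
    (s : ZMod n) : #{p ∈ S | dilate n a p.1 + dilate n b p.2 = s} ≤ 4 * K := by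
  set T := {p ∈ S | dilate n a p.1 + dilate n b p.2 = s} with hT
  rcases T.eq_empty_or_nonempty with h | ⟨p₀, hp₀⟩
  · simp [h]
  have hb0 : b ≠ 0 := by
    rintro rfl
    simp only [abs_zero] at hb'
    omega
  have hR0 : 0 < R := by
    have : 0 < |b| := abs_pos.2 hb0
    omega
  set g : ℤ := (Int.gcd a b : ℤ) with hgdef
  have hg0 : 0 < g := by
    rw [hgdef]; exact_mod_cast Int.gcd_pos_of_ne_zero_right a hb0
  obtain ⟨a', ha'⟩ : g ∣ a := Int.gcd_dvd_left a b
  obtain ⟨b', hb''⟩ : g ∣ b := Int.gcd_dvd_right a b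
  have hcop : IsCoprime b' a' := by
    have h1 : IsCoprime a' b' := by
      rw [Int.isCoprime_iff_gcd_eq_one]
      have h2 : g * (Int.gcd a' b' : ℤ) = g := by
        have h3 : Int.gcd (g * a') (g * b') = g.natAbs * Int.gcd a' b' := Int.gcd_mul_left _ _ _
        rw [← ha', ← hb''] at h3
        have h4 : (Int.gcd a b : ℤ) = (g.natAbs : ℤ) * Int.gcd a' b' := by exact_mod_cast h3
        rw [Int.natCast_natAbs, abs_of_pos hg0] at h4
        exact h4.symm
      have : (Int.gcd a' b' : ℤ) = 1 := by
        have := mul_left_cancel₀ hg0.ne' (h2.trans (mul_one g).symm)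
        exact this
      exact_mod_cast this
    exact h1.symm
  have hb'0 : b' ≠ 0 := by rintro rfl; simp at hb''; exact hb0 hb''
  -- an exact equation in the integers
  have heq : ∀ p ∈ T, a * (p.1 - p₀.1) + b * (p.2 - p₀.2) = 0 := by
    intro p hp
    have h1 := (mem_filter.1 hp).2
    have h2 := (mem_filter.1 hp₀).2
    have h3 : ((2 * (a * (p.1 - p₀.1) + b * (p.2 - p₀.2)) : ℤ) : ZMod n) = 0 := by
      simp only [dilate_apply] at h1 h2
      have := sub_eq_zero.2 (h1.trans h2.symm)
      push_cast at this ⊢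
      linear_combination this
    rw [ZMod.intCast_zmod_eq_zero_iff_dvd] at h3
    obtain ⟨hd1, hd2⟩ := hS p (mem_filter.1 hp).1 p₀ (mem_filter.1 hp₀).1
    -- Each product is at most `R (2H - 1)`, so the doubled sum is at most `4R (2H - 1) < 8RH ≤ n`.
    have hbound : |2 * (a * (p.1 - p₀.1) + b * (p.2 - p₀.2))| < n := by
      have e1 : |a * (p.1 - p₀.1)| ≤ R * (2 * H - 1) := by
        rw [abs_mul]; exact mul_le_mul ha (by omega) (abs_nonneg _) (by positivity)
      have e2 : |b * (p.2 - p₀.2)| ≤ R * (2 * H - 1) := by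
        rw [abs_mul]; exact mul_le_mul hb (by omega) (abs_nonneg _) (by positivity)
      have e3 := abs_add_le (a * (p.1 - p₀.1)) (b * (p.2 - p₀.2))
      have e4 : (8 * R * H : ℤ) ≤ n := by exact_mod_cast hn
      have e5 : (0 : ℤ) < R := by exact_mod_cast hR0
      rw [abs_mul, abs_two]
      nlinarith
    have := Int.eq_zero_of_abs_lt_dvd h3 hbound
    omega
  have heq' : ∀ p ∈ T, ∃ k : ℤ, p.1 - p₀.1 = b' * k := by
    intro p hp
    have h1 := heq p hp
    rw [ha', hb''] at h1
    have h2 : a' * (p.1 - p₀.1) + b' * (p.2 - p₀.2) = 0 := by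
      have : g * (a' * (p.1 - p₀.1) + b' * (p.2 - p₀.2)) = 0 := by linear_combination h1
      exact (mul_eq_zero.1 this).resolve_left hg0.ne'
    have h3 : b' ∣ a' * (p.1 - p₀.1) := ⟨-(p.2 - p₀.2), by linear_combination h2⟩
    exact hcop.dvd_of_dvd_mul_left h3
  choose! k hk using heq'
  have hmaps : ∀ p ∈ T, k p ∈ Ioo (-(2 * K) : ℤ) (2 * K) := by
    intro p hp
    have h1 := (hS p (mem_filter.1 hp).1 p₀ (mem_filter.1 hp₀).1).1
    rw [hk p hp, abs_mul] at h1
    have h2 : (H : ℤ) ≤ g * |b'| := by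
      rw [hb'', abs_mul, abs_of_pos hg0] at hb'; exact hb'
    have h3 : g ≤ K := by rw [hgdef]; exact_mod_cast hg
    have h4 : 0 < |b'| := abs_pos.2 hb'0
    -- From `H ≤ g |b'| ≤ K |b'|`, a value `|k| ≥ 2K` would force `|b' k| ≥ 2H`.
    have h5 : |k p| < 2 * K := by
      by_contra hcon
      push Not at hcon
      have h6 : |b'| * (2 * K) ≤ |b'| * |k p| := mul_le_mul_of_nonneg_left hcon h4.le
      have h7 : g * |b'| ≤ K * |b'| := mul_le_mul_of_nonneg_right h3 h4.le
      nlinarith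
    rw [mem_Ioo]
    exact abs_lt.1 h5
  have hinj : Set.InjOn k T := by
    intro p hp p' hp' hpp
    have h1 := hk p hp
    have h2 := hk p' hp'
    rw [hpp] at h1
    have h3 : p.1 = p'.1 := by omega
    have h4 := heq p hp
    have h5 := heq p' hp'
    rw [h3] at h4
    have h6 : b * (p.2 - p'.2) = 0 := by linear_combination h4 - h5
    have h7 := (mul_eq_zero.1 h6).resolve_left hb0
    exact Prod.ext h3 (by omega)
  calc #T ≤ #(Ioo (-(2 * K) : ℤ) (2 * K)) := card_le_card_of_injOn k hmaps hinj
    _ ≤ 4 * K := by rw [Int.card_Ioo]; omega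

theorem card_multiples_le (R d : ℕ) (hd : 0 < d) :
    #{x ∈ Icc (-R : ℤ) R | x ≠ 0 ∧ (d : ℤ) ∣ x} ≤ 2 * (R / d) := by
  have hsub : {x ∈ Icc (-R : ℤ) R | x ≠ 0 ∧ (d : ℤ) ∣ x} ⊆
      ((Icc (-(R / d : ℕ) : ℤ) (R / d : ℕ)).erase 0).image (fun k => (d : ℤ) * k) := by
    intro x hx
    simp only [mem_filter, mem_Icc] at hx
    obtain ⟨⟨h1, h2⟩, h3, k, rfl⟩ := hx
    have hd' : (0 : ℤ) < d := by exact_mod_cast hd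
    refine mem_image.2 ⟨k, mem_erase.2 ⟨?_, ?_⟩, rfl⟩
    · rintro rfl; simp at h3
    · rw [mem_Icc]
      push_cast
      constructor
      · have : -k ≤ R / d := Int.le_ediv_of_mul_le hd' (by nlinarith)
        omega
      · exact Int.le_ediv_of_mul_le hd' (by nlinarith)
  refine (card_le_card hsub).trans (card_image_le.trans ?_)
  rw [card_erase_of_mem (mem_Icc.2 ⟨Int.neg_nonpos_of_nonneg (Int.natCast_nonneg _), Int.natCast_nonneg _⟩), Int.card_Icc]
  omega

/-- Few pairs of integers have a large common divisor. -/
theorem card_large_gcd_le (R K : ℕ) (hK : 0 < K) :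
    (#{p ∈ Icc (-R : ℤ) R ×ˢ Icc (-R : ℤ) R | (p.1 ≠ 0 ∧ p.2 ≠ 0) ∧ K < Int.gcd p.1 p.2} : ℝ) ≤
      4 * (R : ℝ) ^ 2 / K := by
  set I := Icc (-R : ℤ) R with hI
  -- The pairs are sorted by the exact value `d > K` of the gcd; both entries are then nonzero
  -- multiples of `d`, which leaves at most `(2R / d)²` pairs, and the tail of `∑ 1 / d²` beyond `K`
  -- is at most `1 / K`.
  have hsub : {p ∈ I ×ˢ I | (p.1 ≠ 0 ∧ p.2 ≠ 0) ∧ K < Int.gcd p.1 p.2} ⊆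
      (Ioc K (max K R)).biUnion fun d =>
        {x ∈ I | x ≠ 0 ∧ (d : ℤ) ∣ x} ×ˢ {x ∈ I | x ≠ 0 ∧ (d : ℤ) ∣ x} := by
    rintro ⟨x, y⟩ hp
    simp only [mem_filter, mem_product] at hp
    obtain ⟨⟨hx, hy⟩, ⟨hx0, hy0⟩, hg⟩ := hp
    refine mem_biUnion.2 ⟨Int.gcd x y, mem_Ioc.2 ⟨hg, le_max_of_le_right ?_⟩, ?_⟩
    · have h1 := Int.le_of_dvd (abs_pos.2 hx0) ((dvd_abs _ _).2 (Int.gcd_dvd_left x y))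
      have h2 : |x| ≤ R := abs_le.2 (by simpa [hI] using hx)
      omega
    · simp only [mem_product, mem_filter]
      exact ⟨⟨hx, hx0, Int.gcd_dvd_left x y⟩, hy, hy0, Int.gcd_dvd_right x y⟩
  have h1 : (#{p ∈ I ×ˢ I | (p.1 ≠ 0 ∧ p.2 ≠ 0) ∧ K < Int.gcd p.1 p.2} : ℝ) ≤
      ∑ d ∈ Ioc K (max K R), 4 * (R : ℝ) ^ 2 * ((d : ℝ) ^ 2)⁻¹ := by
    refine (Nat.cast_le.2 ((card_le_card hsub).trans card_biUnion_le)).trans ?_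
    push_cast
    refine sum_le_sum fun d hd => ?_
    have hd0 : 0 < d := hK.trans (mem_Ioc.1 hd).1
    rw [card_product]
    have h2 : (#{x ∈ I | x ≠ 0 ∧ (d : ℤ) ∣ x} : ℝ) ≤ 2 * (R / d) := by
      have h3 : (#{x ∈ I | x ≠ 0 ∧ (d : ℤ) ∣ x} : ℝ) ≤ 2 * ((R / d : ℕ) : ℝ) := by
        exact_mod_cast card_multiples_le R d hd0
      exact h3.trans (mul_le_mul_of_nonneg_left Nat.cast_div_le (by norm_num))
    push_cast
    calc _ ≤ (2 * ((R : ℝ) / d)) * (2 * ((R : ℝ) / d)) := by gcongr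
      _ = _ := by field_simp; ring
  refine h1.trans ?_
  rw [← mul_sum, div_eq_mul_inv]
  refine mul_le_mul_of_nonneg_left ?_ (by positivity)
  refine (sum_Ioc_inv_sq_le_sub hK.ne' (le_max_left K R)).trans ?_
  have : (0 : ℝ) ≤ ((max K R : ℕ) : ℝ)⁻¹ := by positivity
  linarith

end Arithmetic

/-! ### Dual functions of two-dimensional correlations. -/

section DualFunctions

open Finset

variable {G ι : Type*} [AddCommGroup G]

/-- The average of `F` along the direction `A`, twisted by `r`. -/
noncomputable def twistedAverage (J : Finset ι) (A B : ι → G) (F : G → ℂ) (r : G → ι → ℂ) (x : G)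
    (j : ι) : ℂ := 𝔼 i ∈ J, conj (r x i) * conj (F (x + A i + B j))

/-- The function dual to `F` with respect to the pair of directions `A` and `B`. -/
noncomputable def dualFunction (J : Finset ι) (A B : ι → G) (F : G → ℂ) (r : G → ι → ℂ) (x : G) :
    ℂ := 𝔼 i ∈ J, 𝔼 j ∈ J, r (x - (A i + B j)) i * twistedAverage J A B F r (x - (A i + B j)) j

theorem norm_twistedAverage_le (J : Finset ι) (A B : ι → G) {F : G → ℂ} {r : G → ι → ℂ}
    (hF : ∀ x, ‖F x‖ ≤ 1) (hr : ∀ x i, ‖r x i‖ ≤ 1) (x : G) (j : ι) :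
    ‖twistedAverage J A B F r x j‖ ≤ 1 := by
  refine norm_expect_le_of_le _ _ _ zero_le_one fun i _ => ?_
  rw [norm_mul, RCLike.norm_conj, RCLike.norm_conj]
  exact mul_le_one₀ (hr _ _) (norm_nonneg _) (hF _)

theorem norm_dualFunction_le (J : Finset ι) (A B : ι → G) {F : G → ℂ} {r : G → ι → ℂ}
    (hF : ∀ x, ‖F x‖ ≤ 1) (hr : ∀ x i, ‖r x i‖ ≤ 1) (x : G) :
    ‖dualFunction J A B F r x‖ ≤ 1 := by
  refine norm_expect_le_of_le _ _ _ zero_le_one fun i _ => ?_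
  refine norm_expect_le_of_le _ _ _ zero_le_one fun j _ => ?_
  rw [norm_mul]
  exact mul_le_one₀ (hr _ _) (norm_nonneg _) (norm_twistedAverage_le J A B hF hr _ _)

variable [Fintype G]

/-- Cauchy–Schwarz in `(x, j)` drops `l`; expanding the resulting square and recentring one copy of
`F` at `x` exhibits it as an inner product of `F` with its dual function. -/
theorem box_correlation_sq_le (J : Finset ι) (A B : ι → G) {F : G → ℂ} {l r : G → ι → ℂ}
    (hl : ∀ x i, ‖l x i‖ ≤ 1) :
    ‖𝔼 x, 𝔼 i ∈ J, 𝔼 j ∈ J, F (x + A i + B j) * l x j * r x i‖ ^ 2 ≤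
      (𝔼 x, F x * dualFunction J A B F r x).re := by
  have h1 : 𝔼 x, 𝔼 i ∈ J, 𝔼 j ∈ J, F (x + A i + B j) * l x j * r x i =
      𝔼 x, 𝔼 j ∈ J, l x j * 𝔼 i ∈ J, F (x + A i + B j) * r x i := by
    refine expect_congr rfl fun x _ => ?_
    rw [expect_comm]
    refine expect_congr rfl fun j _ => ?_
    rw [mul_expect]
    exact expect_congr rfl fun i _ => by ring
  have h2 : 𝔼 x, F x * dualFunction J A B F r x =
      ((𝔼 x, 𝔼 j ∈ J, ‖𝔼 i ∈ J, F (x + A i + B j) * r x i‖ ^ 2 : ℝ) : ℂ) := by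
    simp only [ofReal_expect, dualFunction, mul_expect]
    have h3 : ∀ x j, ((‖𝔼 i ∈ J, F (x + A i + B j) * r x i‖ ^ 2 : ℝ) : ℂ) =
        𝔼 i ∈ J, F (x + A i + B j) * (r x i * twistedAverage J A B F r x j) := by
      intro x j
      rw [norm_expect_sq_eq]
      refine expect_congr rfl fun i _ => ?_
      rw [twistedAverage, mul_expect, mul_expect]
      refine expect_congr rfl fun k _ => ?_
      simp only [map_mul]
      ring
    simp only [h3]
    rw [expect_comm]
    symm
    have h4 : ∀ x, 𝔼 j ∈ J, 𝔼 i ∈ J, F (x + A i + B j) * (r x i * twistedAverage J A B F r x j) =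
        𝔼 i ∈ J, 𝔼 j ∈ J, F (x + A i + B j) * (r x i * twistedAverage J A B F r x j) :=
      fun x => expect_comm _ _ _
    simp only [h4]
    rw [expect_comm]
    refine expect_congr rfl fun i _ => ?_
    rw [expect_comm]
    symm
    rw [expect_comm]
    refine expect_congr rfl fun j _ => ?_
    rw [← expect_add_right (A i + B j)]
    refine expect_congr rfl fun x _ => ?_
    rw [add_sub_cancel_right, add_assoc]
  rw [h1, h2, Complex.ofReal_re]
  refine (norm_expect_sq_le _ _).trans (expect_le_expect fun x _ => ?_)
  exact norm_expect_mul_sq_le _ _ _ fun j _ => hl x j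

/-- All the directions test the same function `F`, so Cauchy–Schwarz in `x` eliminates `F` and
leaves the correlations of pairs of dual functions. -/
theorem sum_box_correlation_sq_le {κ : Type*} (S : Finset κ) (J : Finset ι) (A B : κ → ι → G)
    {F : G → ℂ} {l r : κ → G → ι → ℂ} (hF : ∀ x, ‖F x‖ ≤ 1) (hl : ∀ a x i, ‖l a x i‖ ≤ 1) :
    (∑ a ∈ S, ‖𝔼 x, 𝔼 i ∈ J, 𝔼 j ∈ J, F (x + A a i + B a j) * l a x j * r a x i‖ ^ 2) ^ 2 ≤
      ∑ a ∈ S, ∑ a' ∈ S, ‖𝔼 x, dualFunction J (A a) (B a) F (r a) x *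
        conj (dualFunction J (A a') (B a') F (r a') x)‖ := by
  have h1 : ∑ a ∈ S, ‖𝔼 x, 𝔼 i ∈ J, 𝔼 j ∈ J, F (x + A a i + B a j) * l a x j * r a x i‖ ^ 2 ≤
      ‖𝔼 x, F x * ∑ a ∈ S, dualFunction J (A a) (B a) F (r a) x‖ := by
    refine (sum_le_sum fun a _ => box_correlation_sq_le J (A a) (B a) (hl a)).trans ?_
    rw [← Complex.re_sum]
    refine (Complex.re_le_norm _).trans_eq ?_
    rw [← expect_sum_comm]
    simp only [mul_sum]
  have h2 : ((𝔼 x, ‖∑ a ∈ S, dualFunction J (A a) (B a) F (r a) x‖ ^ 2 : ℝ) : ℂ) =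
      ∑ a ∈ S, ∑ a' ∈ S, 𝔼 x, dualFunction J (A a) (B a) F (r a) x *
        conj (dualFunction J (A a') (B a') F (r a') x) := by
    rw [ofReal_expect]
    simp only [← Complex.normSq_eq_norm_sq, ← Complex.mul_conj, map_sum, sum_mul_sum]
    rw [expect_sum_comm]
    exact sum_congr rfl fun a _ => by rw [expect_sum_comm]
  have h0 : 0 ≤ 𝔼 x, ‖∑ a ∈ S, dualFunction J (A a) (B a) F (r a) x‖ ^ 2 :=
    expect_nonneg fun _ _ => by positivity
  refine (pow_le_pow_left₀ (sum_nonneg fun _ _ => by positivity) h1 2).trans ?_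
  refine (norm_expect_mul_sq_le _ _ _ fun x _ => hF x).trans ?_
  rw [← Complex.norm_of_nonneg h0, h2]
  exact (norm_sum_le _ _).trans (sum_le_sum fun a _ => norm_sum_le _ _)

/-- The unknown weights `r`, `r'` are eliminated: those of the primed box by the box inequality,
those of the other box by the two Cauchy–Schwarz steps behind `pair_correlation_le` and
`expect_boxProd_dual_le`. What is left involves derivatives of `F` along `B`, averaged along `A`. -/
theorem dualFunction_correlation_le (J : Finset ι) (A B A' B' : ι → G) {F : G → ℂ}
    {r r' : G → ι → ℂ} (hF : ∀ x, ‖F x‖ ≤ 1) (hr : ∀ x i, ‖r x i‖ ≤ 1)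
    (hr' : ∀ x i, ‖r' x i‖ ≤ 1) :
    ‖𝔼 x, dualFunction J A B F r x * conj (dualFunction J A' B' F r' x)‖ ^ 8 ≤
      𝔼 j ∈ J, 𝔼 k ∈ J, boxForm J A' B' fun y =>
        𝔼 e ∈ J, gDiff (B k - B j) F (y + A e + B j) := by
  have h1 : 𝔼 x, dualFunction J A B F r x * conj (dualFunction J A' B' F r' x) =
      𝔼 i ∈ J, 𝔼 j ∈ J, 𝔼 x : G, 𝔼 i' ∈ J, 𝔼 j' ∈ J, conj (r' x i') *
        conj (twistedAverage J A' B' F r' x j') *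
        (r (x + A' i' + B' j' - (A i + B j)) i *
          twistedAverage J A B F r (x + A' i' + B' j' - (A i + B j)) j) := by
    -- Only the second dual function is recentred, by the translation `A' i' + B' j'`; the first is
    -- then evaluated at the far corner of the primed box.
    have h2 : 𝔼 i ∈ J, 𝔼 j ∈ J, 𝔼 x : G, 𝔼 i' ∈ J, 𝔼 j' ∈ J, conj (r' x i') *
        conj (twistedAverage J A' B' F r' x j') *
        (r (x + A' i' + B' j' - (A i + B j)) i *
          twistedAverage J A B F r (x + A' i' + B' j' - (A i + B j)) j) =
        𝔼 x : G, 𝔼 i' ∈ J, 𝔼 j' ∈ J, conj (r' x i') *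
        conj (twistedAverage J A' B' F r' x j') * dualFunction J A B F r (x + A' i' + B' j') := by
      refine (expect_rotate _ _ _ _).trans (expect_congr rfl fun x _ => ?_)
      refine (expect_rotate _ _ _ _).trans (expect_congr rfl fun i' _ => ?_)
      refine (expect_rotate _ _ _ _).trans (expect_congr rfl fun j' _ => ?_)
      simp only [dualFunction, mul_expect]
    rw [h2, expect_comm]
    simp only [dualFunction, conj_expect, mul_expect]
    rw [expect_comm]
    refine expect_congr rfl fun i' _ => ?_
    rw [expect_comm]
    symm
    rw [expect_comm]
    refine expect_congr rfl fun j' _ => ?_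
    symm
    rw [← expect_add_right (A' i' + B' j')]
    refine expect_congr rfl fun x _ => ?_
    rw [add_sub_cancel_right]
    simp only [← mul_expect, map_mul, add_assoc]
    ring
  rw [h1]
  refine (pair_correlation_le J A B A' B' (fun x i' => conj (r' x i'))
    (fun x j' => conj (twistedAverage J A' B' F r' x j')) r (twistedAverage J A B F r)
    (fun x i => by rw [RCLike.norm_conj]; exact hr' x i)
    (fun x j => by rw [RCLike.norm_conj]; exact norm_twistedAverage_le J A' B' hF hr' x j)
    hr).trans ?_
  refine (expect_boxProd_dual_le J A B A' B' (fun x => conj (F x)) (fun x i => conj (r x i)) _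
    (fun x i => by rw [RCLike.norm_conj]; exact hr x i) fun y j => rfl).trans_eq ?_
  refine expect_congr rfl fun j _ => expect_congr rfl fun k _ => ?_
  congr 1
  funext y
  refine expect_congr rfl fun e _ => ?_
  rw [gDiff, Complex.conj_conj, mul_comm]
  congr 2
  abel

end DualFunctions

/-! ### Pair correlations of dual functions for dilated directions. -/

section TwoDimensional

open Finset

theorem gU_succ_eq {G : Type*} [AddCommGroup G] [Fintype G] (s : ℕ) (f : G → ℂ) :
    gU (s + 1) f = 𝔼 h, gU s (gDiff h f) := rfl

/-- Here `a` must be transversal to both `a'` and `b'`, whence the two gcd conditions. The constant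
is `2 μ² (n / H²)²` with `μ = 4K`, and the exponent is `8 · 2` from the box inequality and the
passage to squared moduli. -/
theorem dualFunction_correlation_pow_le {n H K : ℕ} [NeZero n] (hH : 0 < H) {a a' b b' : ℤ}
    {M : ℕ} (hK : 0 < K) (hn : 8 * M * H ≤ n) (ha : |a| ≤ M) (ha' : |a'| ≤ M)
    (hb' : |b'| ≤ M) (haH : (H : ℤ) ≤ |a|) (hg₁ : Int.gcd a' a ≤ K) (hg₂ : Int.gcd b' a ≤ K)
    {F : ZMod n → ℂ} {r r' : ZMod n → ℤ → ℂ} (hF : ∀ x, ‖F x‖ ≤ 1) (hr : ∀ x i, ‖r x i‖ ≤ 1)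
    (hr' : ∀ x i, ‖r' x i‖ ≤ 1) :
    ‖𝔼 x, dualFunction (Ico (0 : ℤ) H) (dilate n a) (dilate n b) F r x *
      conj (dualFunction (Ico (0 : ℤ) H) (dilate n a') (dilate n b') F r' x)‖ ^ 16 ≤
      (32 * (K : ℝ) ^ 2 * (n / (H : ℝ) ^ 2) ^ 2) ^ 2 * 𝔼 j ∈ Ico (0 : ℤ) H, 𝔼 k ∈ Ico (0 : ℤ) H,
        gU 2 (gDiff (dilate n b k - dilate n b j) F) := by
  set J := Ico (0 : ℤ) H with hJ
  have h1 := dualFunction_correlation_le J (dilate n a) (dilate n b) (dilate n a') (dilate n b')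
    hF hr hr'
  have hbox : ∀ k : ZMod n → ℂ, 0 ≤ boxForm J (dilate n a') (dilate n b') k := fun k =>
    expect_nonneg fun _ _ => expect_nonneg fun _ _ => expect_nonneg fun _ _ => by positivity
  have hJJ : ∀ p ∈ J ×ˢ J, ∀ p' ∈ J ×ˢ J, |p.1 - p'.1| < 2 * H ∧ |p.2 - p'.2| < 2 * H := by
    intro p hp p' hp'
    simp only [hJ, mem_product, mem_Ico] at hp hp'
    simp only [abs_lt]
    omega
  have hJD : ∀ p ∈ J ×ˢ Ioo (-H : ℤ) H, ∀ p' ∈ J ×ˢ Ioo (-H : ℤ) H,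
      |p.1 - p'.1| < 2 * H ∧ |p.2 - p'.2| < 2 * H := by
    intro p hp p' hp'
    simp only [hJ, mem_product, mem_Ico, mem_Ioo] at hp hp'
    simp only [abs_lt]
    omega
  calc _ = (‖𝔼 x, dualFunction J (dilate n a) (dilate n b) F r x *
      conj (dualFunction J (dilate n a') (dilate n b') F r' x)‖ ^ 8) ^ 2 := by ring
    _ ≤ _ := pow_le_pow_left₀ (by positivity) h1 2
    _ ≤ 𝔼 j ∈ J, 𝔼 k ∈ J, boxForm J (dilate n a') (dilate n b') (fun y =>
        𝔼 e ∈ J, gDiff (dilate n b k - dilate n b j) F (y + dilate n a e + dilate n b j)) ^ 2 := by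
        refine (expect_pow_le _ _ (fun j _ => expect_nonneg fun k _ => hbox _) 2 two_ne_zero).trans
          (expect_le_expect fun j _ => ?_)
        exact expect_pow_le _ _ (fun k _ => hbox _) 2 two_ne_zero
    _ ≤ _ := by
        rw [mul_expect]
        refine expect_le_expect fun j _ => ?_
        rw [mul_expect]
        refine expect_le_expect fun k _ => ?_
        have h2 := boxForm_average_sq_le hH (dilate n a) (dilate n a') (dilate n b') (4 * K)
          (card_dilate_solutions_le hH hK hn ha' ha haH hg₁ _ hJJ)
          (card_dilate_solutions_le hH hK hn hb' ha haH hg₂ _ hJD)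
          (fun z => gDiff (dilate n b k - dilate n b j) F (z + dilate n b j))
        rw [gU_translate, ZMod.card] at h2
        refine h2.trans_eq ?_
        push_cast
        ring

end TwoDimensional

/-! ### Gaining one degree by averaging over directions. -/

section Concatenation

open Finset

theorem card_le_two_mul_of_abs_le {R : ℕ} (A : Finset ℤ) (hA : ∀ a ∈ A, a ≠ 0 ∧ |a| ≤ R) :
    (#A : ℝ) ≤ 2 * R := by
  have h : A ⊆ (Icc (-R : ℤ) R).erase 0 := fun a ha =>
    mem_erase.2 ⟨(hA a ha).1, mem_Icc.2 (abs_le.1 (hA a ha).2)⟩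
  have h1 := card_le_card h
  rw [card_erase_of_mem (mem_Icc.2 ⟨by omega, by omega⟩), Int.card_Icc] at h1
  have h2 : #A ≤ 2 * R := by omega
  exact_mod_cast h2

theorem sum_pow_le_of_card_le {ι : Type*} (A : Finset ι) (f : ι → ℝ) (hf : ∀ a ∈ A, 0 ≤ f a)
    {m : ℝ} (hA : (#A : ℝ) ≤ m) (k : ℕ) :
    (∑ a ∈ A, f a) ^ (k + 1) ≤ m ^ k * ∑ a ∈ A, f a ^ (k + 1) := by
  rcases A.eq_empty_or_nonempty with rfl | hne
  · simp
  have hc : (0 : ℝ) < #A := by exact_mod_cast hne.card_pos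
  have h := pow_sum_div_card_le_sum_pow hf k
  rw [div_le_iff₀ (by positivity), mul_comm] at h
  refine h.trans (mul_le_mul_of_nonneg_right (pow_le_pow_left₀ hc.le hA k) ?_)
  exact sum_nonneg fun a ha => pow_nonneg (hf a ha) _

/-- If the derivatives of `F` along most dilated directions have a large norm, then so has `F`. -/
theorem gU_succ_lower {n H R : ℕ} [NeZero n] (hH : 0 < H) (hn : 8 * R * H ≤ n) (k : ℕ)
    {F : ZMod n → ℂ} (hF : ∀ x, ‖F x‖ ≤ 1) (B : Finset ℤ)
    (hB : ∀ b ∈ B, (H : ℤ) ≤ |b| ∧ |b| ≤ R) {κ : ℝ} (hκ : 0 ≤ κ) (hR : 0 < R)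
    (h : κ * (2 * R) ≤ ∑ b ∈ B, 𝔼 i ∈ Ico (0 : ℤ) H, 𝔼 j ∈ Ico (0 : ℤ) H,
      gU k (gDiff (dilate n b i - dilate n b j) F)) :
    κ ^ 4 ≤ 24 * (n / (H : ℝ) ^ 2) * gU (k + 1) F := by
  have hE0 := gU_nonneg (k + 1) F
  have hQ0 : (0 : ℝ) ≤ n / (H : ℝ) ^ 2 := by positivity
  rcases hκ.eq_or_lt with rfl | hκ
  · rw [zero_pow (by norm_num)]; positivity
  have hR' : (0 : ℝ) < R := by exact_mod_cast hR
  have hcard : (#B : ℝ) ≤ 2 * R := card_le_two_mul_of_abs_le B fun b hb =>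
    ⟨fun h0 => by have := (hB b hb).1; rw [h0, abs_zero] at this; omega, (hB b hb).2⟩
  have hκ1 : κ ≤ 1 := by
    have : ∑ b ∈ B, 𝔼 i ∈ Ico (0 : ℤ) H, 𝔼 j ∈ Ico (0 : ℤ) H,
        gU k (gDiff (dilate n b i - dilate n b j) F) ≤ #B := by
      rw [card_eq_sum_ones, Nat.cast_sum]
      refine sum_le_sum fun b _ => ?_
      rw [Nat.cast_one]
      refine expect_le_of_le _ _ _ zero_le_one fun i _ => ?_
      exact expect_le_of_le _ _ _ zero_le_one fun j _ => gU_le_one k (norm_gDiff_le hF _)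
    have h2 : κ * (2 * R) ≤ 1 * (2 * R) := by linarith
    exact le_of_mul_le_mul_right h2 (by positivity)
  -- With `K ≥ 2 / κ²` the pairs of gcd larger than `K` form a proportion at most `1 / K ≤ κ² / 2`
  -- of `(2R)²`, and the remaining half of `κ²` is carried by transversal pairs.
  obtain ⟨K, hK1, hK2⟩ : ∃ K : ℕ, 2 / κ ^ 2 ≤ K ∧ (K : ℝ) ≤ 3 / κ ^ 2 := by
    refine ⟨⌈2 / κ ^ 2⌉₊, Nat.le_ceil _, (Nat.ceil_lt_add_one (by positivity)).le.trans ?_⟩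
    have : 1 ≤ 1 / κ ^ 2 := by
      rw [le_div_iff₀ (by positivity), one_mul]; exact pow_le_one₀ hκ.le hκ1
    calc 2 / κ ^ 2 + 1 ≤ 2 / κ ^ 2 + 1 / κ ^ 2 := by linarith
      _ = _ := by ring
  have hKr : (0 : ℝ) < K := lt_of_lt_of_le (by positivity) hK1
  have hK : 0 < K := by exact_mod_cast hKr
  have hbad : (#{p ∈ B ×ˢ B | ¬ Int.gcd p.1 p.2 ≤ K} : ℝ) ≤ 4 * (R : ℝ) ^ 2 / K := by
    refine le_trans (Nat.cast_le.2 (card_le_card ?_)) (card_large_gcd_le R K hK)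
    intro p hp
    simp only [mem_filter, mem_product] at hp ⊢
    have h1 := hB _ hp.1.1
    have h2 := hB _ hp.1.2
    refine ⟨⟨mem_Icc.2 (abs_le.1 h1.2), mem_Icc.2 (abs_le.1 h2.2)⟩, ⟨?_, ?_⟩, by omega⟩
    · intro h0; have := h1.1; rw [h0, abs_zero] at this; omega
    · intro h0; have := h2.1; rw [h0, abs_zero] at this; omega
  have hJJ : ∀ p ∈ Ico (0 : ℤ) H ×ˢ Ico (0 : ℤ) H, ∀ p' ∈ Ico (0 : ℤ) H ×ˢ Ico (0 : ℤ) H,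
      |p.1 - p'.1| < 2 * H ∧ |p.2 - p'.2| < 2 * H := by
    intro p hp p' hp'
    simp only [mem_product, mem_Ico] at hp hp'
    simp only [abs_lt]
    omega
  have key := concatenation (H := H) B (fun b => dilate n b) (fun s => gU k (gDiff s F))
    (fun s => gU_nonneg _ _) (fun s => gU_le_one _ (norm_gDiff_le hF s))
    (fun S t => gU_gDiff_expect_sq_le k S t hF) (fun b b' => Int.gcd b b' ≤ K) _ (4 * K) le_rfl
    (by
      intro b hb b' hb' hg s
      -- Concatenation involves differences of the two progressions, the counting lemma sums; the
      -- sign is absorbed into `b'`.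
      have hneg : ∀ i, dilate n (-b') i = - dilate n b' i := fun i => by
        simp only [dilate_apply]; push_cast; ring
      have := card_dilate_solutions_le (n := n) (a := b) (b := -b') hH hK hn (hB b hb).2
        (by rw [abs_neg]; exact (hB b' hb').2) (by rw [abs_neg]; exact (hB b' hb').1)
        (by rwa [Int.gcd_neg]) _ hJJ s
      simpa only [hneg, ← sub_eq_add_neg] using this)
  rw [ZMod.card, ← gU_succ_eq] at key
  have h1 : (κ * (2 * R)) ^ 2 ≤ 4 * (R : ℝ) ^ 2 / K +
      (2 * R) ^ 2 * ((4 * K : ℕ) * (n / (H : ℝ) ^ 2) * gU (k + 1) F) := by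
    refine (pow_le_pow_left₀ (by positivity) h 2).trans (key.trans (add_le_add hbad ?_))
    gcongr
  have h2 : κ ^ 2 ≤ 1 / K + 4 * K * (n / (H : ℝ) ^ 2) * gU (k + 1) F := by
    have e1 : (κ * (2 * R)) ^ 2 = (4 * (R : ℝ) ^ 2) * κ ^ 2 := by ring
    have e2 : 4 * (R : ℝ) ^ 2 / K + (2 * R) ^ 2 * ((4 * K : ℕ) * (n / (H : ℝ) ^ 2) * gU (k + 1) F) =
        (4 * (R : ℝ) ^ 2) * (1 / K + 4 * K * (n / (H : ℝ) ^ 2) * gU (k + 1) F) := by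
      push_cast; ring
    rw [e1, e2] at h1
    exact le_of_mul_le_mul_left h1 (by positivity)
  have h3 : 1 / (K : ℝ) ≤ κ ^ 2 / 2 := by
    rw [div_le_iff₀ hKr]
    rw [div_le_iff₀ (by positivity)] at hK1
    linarith
  have h4 : 4 * K * (n / (H : ℝ) ^ 2) * gU (k + 1) F ≤
      4 * (3 / κ ^ 2) * (n / (H : ℝ) ^ 2) * gU (k + 1) F := by gcongr
  have h5 : κ ^ 2 / 2 ≤ 4 * (3 / κ ^ 2) * (n / (H : ℝ) ^ 2) * gU (k + 1) F := by linarith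
  have h6 : κ ^ 2 * (κ ^ 2 / 2) ≤ κ ^ 2 * (4 * (3 / κ ^ 2) * (n / (H : ℝ) ^ 2) * gU (k + 1) F) :=
    mul_le_mul_of_nonneg_left h5 (by positivity)
  have e3 : κ ^ 2 * (4 * (3 / κ ^ 2) * (n / (H : ℝ) ^ 2) * gU (k + 1) F) =
      12 * (n / (H : ℝ) ^ 2) * gU (k + 1) F := by
    field_simp
    ring
  rw [e3] at h6
  linarith [h6, (by ring : κ ^ 2 * (κ ^ 2 / 2) = κ ^ 4 / 2)]

end Concatenation

/-! ### Control of two- and three-dimensional box correlations. -/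

section BoxControl

open Finset

/-- Bookkeeping for `two_dimensional_control`: `(ε⁴/2)^16` is divided by `(32 K² Q²)²`, and `K ≤ 5 /
ε⁴` costs a further `ε^16`, which gives `ε^80 / Q⁴`. -/
theorem lower_bound_of_pow_le {ε Q K m S W : ℝ} (hε : 0 < ε) (hQ : 0 < Q) (hK : 0 < K)
    (hK' : K ≤ 5 / ε ^ 4) (hm : 0 < m) (h₁ : ε ^ 4 / 2 * m ^ 2 ≤ S)
    (h₂ : S ^ 16 ≤ (m ^ 2) ^ 15 * (m * ((32 * K ^ 2 * Q ^ 2) ^ 2 * W))) (hW : 0 ≤ W) :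
    1 / (65536 * 640000) * ε ^ 80 / Q ^ 4 * m ≤ W := by
  have h3 : m ^ 31 * ((ε ^ 4 / 2) ^ 16 * m) ≤ m ^ 31 * ((32 * K ^ 2 * Q ^ 2) ^ 2 * W) := by
    calc _ = (ε ^ 4 / 2 * m ^ 2) ^ 16 := by ring
      _ ≤ S ^ 16 := pow_le_pow_left₀ (by positivity) h₁ 16
      _ ≤ _ := h₂
      _ = _ := by ring
  have h4 := le_of_mul_le_mul_left h3 (by positivity)
  have hC : 32 * K ^ 2 * Q ^ 2 ≤ 800 * Q ^ 2 / ε ^ 8 := by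
    calc _ ≤ 32 * (5 / ε ^ 4) ^ 2 * Q ^ 2 := by gcongr
      _ = _ := by rw [div_pow, ← pow_mul]; ring
  have h5 : (32 * K ^ 2 * Q ^ 2) ^ 2 * W ≤ (800 * Q ^ 2 / ε ^ 8) ^ 2 * W := by gcongr
  refine le_of_mul_le_mul_left ((le_of_eq ?_).trans (h4.trans h5))
    (by positivity : 0 < (800 * Q ^ 2 / ε ^ 8) ^ 2)
  field_simp
  ring

/-- Averages over many pairs of directions `(a, c - a)` of two-dimensional box correlations of `F`
are controlled by the `U⁴`-norm of `F`. -/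
theorem two_dimensional_control : ∃ κ : ℝ, 0 < κ ∧ κ ≤ 1 ∧ ∀ (n H M : ℕ) [NeZero n], 0 < H → H ≤ M →
    8 * M * H ≤ n → ∀ (c : ℤ) (A : Finset ℤ),
    (∀ a ∈ A, ((H : ℤ) ≤ |a| ∧ |a| ≤ M) ∧ ((H : ℤ) ≤ |c - a| ∧ |c - a| ≤ M)) →
    ∀ (F : ZMod n → ℂ) (l r : ℤ → ZMod n → ℤ → ℂ), (∀ x, ‖F x‖ ≤ 1) → (∀ a x i, ‖l a x i‖ ≤ 1) →
    (∀ a x i, ‖r a x i‖ ≤ 1) → ∀ ε : ℝ, 0 ≤ ε →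
    ε * (2 * M) ≤ ∑ a ∈ A, ‖𝔼 x, 𝔼 i ∈ Ico (0 : ℤ) H, 𝔼 j ∈ Ico (0 : ℤ) H,
      F (x + dilate n a i + dilate n (c - a) j) * l a x j * r a x i‖ →
    κ * ε ^ 320 ≤ (n / (H : ℝ) ^ 2) ^ 17 * gU 3 F := by
  refine ⟨(1 / (65536 * 640000)) ^ 4 / 24, by positivity, by norm_num, ?_⟩
  intro n H M _ hH hHM hn c A hA F l r hF hl hr ε hε hsum
  set J := Ico (0 : ℤ) H with hJ
  set Q : ℝ := n / (H : ℝ) ^ 2 with hQ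
  set T : ℤ → ℂ := fun a => 𝔼 x, 𝔼 i ∈ J, 𝔼 j ∈ J,
      F (x + dilate n a i + dilate n (c - a) j) * l a x j * r a x i with hT
  have hE0 := gU_nonneg 3 F
  have hM : 0 < M := hH.trans_le hHM
  have hM' : (0 : ℝ) < M := by exact_mod_cast hM
  have hH' : (0 : ℝ) < H := by exact_mod_cast hH
  have hn' : (0 : ℝ) < n := by
    exact_mod_cast Nat.pos_of_ne_zero (NeZero.ne n)
  have hQ0 : 0 < Q := by positivity
  rcases hε.eq_or_lt with rfl | hε
  · rw [zero_pow (by norm_num), mul_zero]; positivity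
  have habs : ∀ a : ℤ, (H : ℤ) ≤ |a| → a ≠ 0 := fun a h h0 => by
    rw [h0, abs_zero] at h; omega
  have hcard : (#A : ℝ) ≤ 2 * M := card_le_two_mul_of_abs_le A fun a ha =>
    ⟨habs a (hA a ha).1.1, (hA a ha).1.2⟩
  have hT1 : ∀ a, ‖T a‖ ≤ 1 := fun a => by
    refine norm_expect_le_of_le _ _ _ zero_le_one fun x _ => ?_
    refine norm_expect_le_of_le _ _ _ zero_le_one fun i _ => ?_
    refine norm_expect_le_of_le _ _ _ zero_le_one fun j _ => ?_
    rw [norm_mul, norm_mul]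
    exact mul_le_one₀ (mul_le_one₀ (hF _) (norm_nonneg _) (hl _ _ _)) (norm_nonneg _) (hr _ _ _)
  have hε1 : ε ≤ 1 := by
    have : ∑ a ∈ A, ‖T a‖ ≤ #A := by
      rw [card_eq_sum_ones, Nat.cast_sum]
      exact sum_le_sum fun a _ => by rw [Nat.cast_one]; exact hT1 a
    have h2 : ε * (2 * M) ≤ 1 * (2 * M) := by linarith
    exact le_of_mul_le_mul_right h2 (by positivity)
  -- duality
  set X : ℤ → ℤ → ℝ := fun a a' => ‖𝔼 x, dualFunction J (dilate n a) (dilate n (c - a)) F (r a) x *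
        conj (dualFunction J (dilate n a') (dilate n (c - a')) F (r a') x)‖ with hX
  have hX0 : ∀ a a', 0 ≤ X a a' := fun a a' => norm_nonneg _
  have hX1 : ∀ a a', X a a' ≤ 1 := fun a a' => by
    refine norm_expect_le_of_le _ _ _ zero_le_one fun x _ => ?_
    rw [norm_mul, RCLike.norm_conj]
    exact mul_le_one₀ (norm_dualFunction_le _ _ _ hF (hr a) x) (norm_nonneg _)
      (norm_dualFunction_le _ _ _ hF (hr a') x)
  have hsq : ε ^ 2 * (2 * M) ≤ ∑ a ∈ A, ‖T a‖ ^ 2 := by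
    have h1 := sum_pow_le_of_card_le A (fun a => ‖T a‖) (fun _ _ => norm_nonneg _) hcard 1
    have h2 := pow_le_pow_left₀ (by positivity) hsum 2
    have h3 : (2 * (M : ℝ)) * (ε ^ 2 * (2 * M)) ≤ (2 * M) * ∑ a ∈ A, ‖T a‖ ^ 2 := by
      calc _ = (ε * (2 * M)) ^ 2 := by ring
        _ ≤ _ := h2
        _ ≤ _ := h1
        _ = _ := by norm_num
    exact le_of_mul_le_mul_left h3 (by positivity)
  have hpairs : ε ^ 4 * (2 * M) ^ 2 ≤ ∑ a ∈ A, ∑ a' ∈ A, X a a' := by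
    have h1 := sum_box_correlation_sq_le A J (fun a => dilate n a) (fun a => dilate n (c - a))
      (F := F) (l := l) (r := r) hF hl
    refine le_trans ?_ h1
    calc _ = (ε ^ 2 * (2 * M)) ^ 2 := by ring
      _ ≤ _ := pow_le_pow_left₀ (by positivity) hsq 2
  -- discard the pairs with a large common divisor
  obtain ⟨K, hK1, hK2⟩ : ∃ K : ℕ, 4 / ε ^ 4 ≤ K ∧ (K : ℝ) ≤ 5 / ε ^ 4 := by
    refine ⟨⌈4 / ε ^ 4⌉₊, Nat.le_ceil _, (Nat.ceil_lt_add_one (by positivity)).le.trans ?_⟩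
    have : 1 ≤ 1 / ε ^ 4 := by
      rw [le_div_iff₀ (by positivity), one_mul]; exact pow_le_one₀ hε.le hε1
    calc 4 / ε ^ 4 + 1 ≤ 4 / ε ^ 4 + 1 / ε ^ 4 := by linarith
      _ = _ := by ring
  have hKr : (0 : ℝ) < K := lt_of_lt_of_le (by positivity) hK1
  have hK : 0 < K := by exact_mod_cast hKr
  -- The first entry must be transversal to both directions `a'` and `c - a'` of the other box.
  set good : ℤ × ℤ → Prop := fun p => Int.gcd p.2 p.1 ≤ K ∧ Int.gcd (c - p.2) p.1 ≤ K with hgood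
  have hbad : (#{p ∈ A ×ˢ A | ¬ good p} : ℝ) ≤ 2 * (4 * (M : ℝ) ^ 2 / K) := by
    set L := {p ∈ Icc (-M : ℤ) M ×ˢ Icc (-M : ℤ) M | (p.1 ≠ 0 ∧ p.2 ≠ 0) ∧ K < Int.gcd p.1 p.2}
    have hsub : {p ∈ A ×ˢ A | ¬ good p} ⊆ L.image (fun p => (p.2, p.1)) ∪
        L.image (fun p => (p.2, c - p.1)) := by
      rintro ⟨a, a'⟩ hp
      simp only [mem_filter, mem_product, hgood, not_and_or, not_le] at hp
      obtain ⟨⟨ha, ha'⟩, hg⟩ := hp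
      have h1 := hA a ha
      have h2 := hA a' ha'
      rw [mem_union]
      rcases hg with hg | hg
      · left
        refine mem_image.2 ⟨(a', a), mem_filter.2 ⟨mem_product.2 ⟨?_, ?_⟩, ⟨?_, ?_⟩, hg⟩, rfl⟩
        · exact mem_Icc.2 (abs_le.1 h2.1.2)
        · exact mem_Icc.2 (abs_le.1 h1.1.2)
        · exact habs _ h2.1.1
        · exact habs _ h1.1.1
      · right
        refine mem_image.2 ⟨(c - a', a), mem_filter.2 ⟨mem_product.2 ⟨?_, ?_⟩, ⟨?_, ?_⟩, hg⟩, ?_⟩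
        · exact mem_Icc.2 (abs_le.1 h2.2.2)
        · exact mem_Icc.2 (abs_le.1 h1.1.2)
        · exact habs _ h2.2.1
        · exact habs _ h1.1.1
        · simp
    have h1 : #{p ∈ A ×ˢ A | ¬ good p} ≤ 2 * #L :=
      (card_le_card hsub).trans ((card_union_le _ _).trans (by
        have := card_image_le (s := L) (f := fun p : ℤ × ℤ => (p.2, p.1))
        have := card_image_le (s := L) (f := fun p : ℤ × ℤ => (p.2, c - p.1))
        omega))
    have h2 : (#{p ∈ A ×ˢ A | ¬ good p} : ℝ) ≤ 2 * #L := by exact_mod_cast h1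
    exact h2.trans (mul_le_mul_of_nonneg_left (card_large_gcd_le M K hK) (by norm_num))
  set S := ∑ p ∈ A ×ˢ A with good p, X p.1 p.2 with hS
  have hS1 : ε ^ 4 / 2 * (2 * M) ^ 2 ≤ S := by
    have h1 : ∑ a ∈ A, ∑ a' ∈ A, X a a' ≤ S + #{p ∈ A ×ˢ A | ¬ good p} := by
      rw [← sum_product', ← sum_filter_add_sum_filter_not (A ×ˢ A) good]
      refine add_le_add_right ?_ _
      rw [card_eq_sum_ones, Nat.cast_sum]
      exact sum_le_sum fun p _ => by rw [Nat.cast_one]; exact hX1 _ _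
    -- As `K ≥ 4 / ε⁴`, the discarded pairs account for at most half of the lower bound `hpairs`.
    have h2 : 2 * (4 * (M : ℝ) ^ 2 / K) ≤ ε ^ 4 / 2 * (2 * M) ^ 2 := by
      rw [← mul_div_assoc, div_le_iff₀ hKr]
      rw [div_le_iff₀ (by positivity)] at hK1
      have : (M : ℝ) ^ 2 * 4 ≤ (M : ℝ) ^ 2 * (K * ε ^ 4) :=
        mul_le_mul_of_nonneg_left hK1 (by positivity)
      linarith
    linarith
  set w : ℤ → ℝ := fun b => 𝔼 j ∈ J, 𝔼 k ∈ J, gU 2 (gDiff (dilate n b k - dilate n b j) F) with hw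
  have hw0 : ∀ b, 0 ≤ w b := fun b =>
    expect_nonneg fun _ _ => expect_nonneg fun _ _ => gU_nonneg _ _
  set C : ℝ := 32 * (K : ℝ) ^ 2 * Q ^ 2 with hC
  have hS2 : S ^ 16 ≤ ((2 * (M : ℝ)) ^ 2) ^ 15 * ((2 * M) * (C ^ 2 * ∑ a ∈ A, w (c - a))) := by
    have hc2 : (#{p ∈ A ×ˢ A | good p} : ℝ) ≤ (2 * (M : ℝ)) ^ 2 := by
      have h1 : (#{p ∈ A ×ˢ A | good p} : ℝ) ≤ #(A ×ˢ A) := by exact_mod_cast card_filter_le _ _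
      rw [card_product, Nat.cast_mul, ← sq] at h1
      exact h1.trans (pow_le_pow_left₀ (by positivity) hcard 2)
    refine (sum_pow_le_of_card_le _ _ (fun p _ => hX0 p.1 p.2) hc2 15).trans ?_
    refine mul_le_mul_of_nonneg_left ?_ (by positivity)
    calc _ ≤ ∑ p ∈ A ×ˢ A with good p, C ^ 2 * w (c - p.1) := by
          refine sum_le_sum fun p hp => ?_
          obtain ⟨hp1, hp2⟩ := mem_filter.1 hp
          obtain ⟨ha, ha'⟩ := mem_product.1 hp1
          have h1 := hA _ ha
          have h2 := hA _ ha'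
          exact dualFunction_correlation_pow_le hH hK hn h1.1.2 h2.1.2 h2.2.2 h1.1.1 hp2.1 hp2.2
            hF (hr p.1) (hr p.2)
      _ ≤ ∑ p ∈ A ×ˢ A, C ^ 2 * w (c - p.1) :=
          sum_le_sum_of_subset_of_nonneg (filter_subset _ _) fun p _ _ =>
            mul_nonneg (by positivity) (hw0 _)
      _ = #A * (C ^ 2 * ∑ a ∈ A, w (c - a)) := by
          rw [sum_product]
          simp only [sum_const, nsmul_eq_mul, mul_sum]
      _ ≤ _ := mul_le_mul_of_nonneg_right hcard
          (mul_nonneg (by positivity) (sum_nonneg fun _ _ => hw0 _))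
  set κ₁ : ℝ := 1 / (65536 * 640000) * ε ^ 80 / Q ^ 4 with hκ₁
  have hW : κ₁ * (2 * M) ≤ ∑ a ∈ A, w (c - a) := by
    exact lower_bound_of_pow_le hε hQ0 hKr hK2 (by positivity) hS1 hS2
      (sum_nonneg fun _ _ => hw0 _)
  -- concatenate the remaining direction
  have hinj : Set.InjOn (fun a => c - a) (A : Set ℤ) := fun a _ a' _ h => by simpa using h
  have hfin := gU_succ_lower (R := M) hH hn 2 hF (A.image fun a => c - a)
    (by
      intro b hb
      obtain ⟨a, ha, rfl⟩ := mem_image.1 hb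
      exact (hA a ha).2)
    (κ := κ₁) (by positivity) hM
    (by
      rw [sum_image hinj]
      refine hW.trans_eq (sum_congr rfl fun a _ => ?_)
      rw [hw, expect_comm])
  rw [← hQ] at hfin
  have e1 : κ₁ ^ 4 = (1 / (65536 * 640000)) ^ 4 * ε ^ 320 / Q ^ 16 := by
    rw [hκ₁, div_pow, mul_pow, ← pow_mul, ← pow_mul]
  rw [e1, div_le_iff₀ (by positivity)] at hfin
  have e2 : 24 * Q * gU 3 F * Q ^ 16 = 24 * (Q ^ 17 * gU 3 F) := by ring
  rw [show (2 + 1) = 3 from rfl, e2] at hfin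
  linarith

/-- Averages over many triples of directions `(a, c - a, c)` of three-dimensional box correlations
of `f` are controlled by the `U⁵`-norm of `f`. -/
theorem three_dimensional_control : ∃ κ : ℝ, 0 < κ ∧ ∀ (n H M : ℕ) [NeZero n], 0 < H → H ≤ M →
    16 * M * H ≤ n → ∀ (C : Finset ℤ) (A : ℤ → Finset ℤ),
    (∀ c ∈ C, (H : ℤ) ≤ |c| ∧ |c| ≤ 2 * M) →
    (∀ c ∈ C, ∀ a ∈ A c, ((H : ℤ) ≤ |a| ∧ |a| ≤ M) ∧ ((H : ℤ) ≤ |c - a| ∧ |c - a| ≤ M)) →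
    ∀ (f : ZMod n → ℂ) (w₀ w₁ w₂ : ℤ → ℤ → ZMod n → ℤ → ℤ → ℂ), (∀ x, ‖f x‖ ≤ 1) →
    (∀ c a x i j, ‖w₀ c a x i j‖ ≤ 1) → (∀ c a x i j, ‖w₁ c a x i j‖ ≤ 1) →
    (∀ c a x i j, ‖w₂ c a x i j‖ ≤ 1) → ∀ ε : ℝ, 0 ≤ ε →
    ε * (8 * (M : ℝ) ^ 2) ≤ ∑ c ∈ C, ∑ a ∈ A c,
      ‖𝔼 x, 𝔼 i ∈ Ico (0 : ℤ) H, 𝔼 j ∈ Ico (0 : ℤ) H, 𝔼 k ∈ Ico (0 : ℤ) H,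
        f (x + dilate n a i + dilate n (c - a) j + dilate n c k) *
          w₀ c a x i j * w₁ c a x i k * w₂ c a x j k‖ →
    κ * ε ^ 2560 ≤ (n / (H : ℝ) ^ 2) ^ 69 * gU 4 f := by
  obtain ⟨κ, hκ, hκ1, hB⟩ := two_dimensional_control
  refine ⟨κ ^ 4 / 24, by positivity, ?_⟩
  intro n H M _ hH hHM hn C A hC hA f w₀ w₁ w₂ hf hw₀ hw₁ hw₂ ε hε hsum
  set J := Ico (0 : ℤ) H with hJ
  set Q : ℝ := n / (H : ℝ) ^ 2 with hQ
  have hM : 0 < M := hH.trans_le hHM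
  have hM' : (0 : ℝ) < M := by exact_mod_cast hM
  have hH' : (0 : ℝ) < H := by exact_mod_cast hH
  have hn' : (0 : ℝ) < n := by
    exact_mod_cast Nat.pos_of_ne_zero (NeZero.ne n)
  have hn2 : 8 * M * H ≤ n := le_trans (by nlinarith [Nat.zero_le (M * H)]) hn
  have hQ0 : 0 < Q := by positivity
  have habs : ∀ a : ℤ, (H : ℤ) ≤ |a| → a ≠ 0 := fun a h h0 => by
    rw [h0, abs_zero] at h; omega
  have hcardA : ∀ c ∈ C, (#(A c) : ℝ) ≤ 2 * M := fun c hc =>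
    card_le_two_mul_of_abs_le _ fun a ha => ⟨habs a (hA c hc a ha).1.1, (hA c hc a ha).1.2⟩
  have hcardC : (#C : ℝ) ≤ 2 * (2 * M : ℕ) := card_le_two_mul_of_abs_le (R := 2 * M) _ fun c hc =>
    ⟨habs c (hC c hc).1, by push_cast; exact (hC c hc).2⟩
  have hcardC' : (#C : ℝ) ≤ 4 * M := hcardC.trans_eq (by push_cast; ring)
  set Z : ℤ → ℤ → ℂ := fun c a => 𝔼 x, 𝔼 i ∈ J, 𝔼 j ∈ J, 𝔼 k ∈ J,
        f (x + dilate n a i + dilate n (c - a) j + dilate n c k) *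
          w₀ c a x i j * w₁ c a x i k * w₂ c a x j k with hZ
  -- Duplicating `k` makes `f` a derivative along `c`. The translation by `dilate n c k'` keeps the
  -- arguments in the form required by the two-dimensional statement and does not change the norm.
  set F : ℤ → ℤ → ℤ → ZMod n → ℂ := fun c k k' y =>
    gDiff (dilate n c k - dilate n c k') f (y + dilate n c k') with hF
  have hF1 : ∀ c k k' x, ‖F c k k' x‖ ≤ 1 := fun c k k' x => norm_gDiff_le hf _ _
  set l : ℤ → ℤ → ℤ → ℤ → ZMod n → ℤ → ℂ := fun c k k' a x j =>
    w₂ c a x j k * conj (w₂ c a x j k') with hl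
  set r : ℤ → ℤ → ℤ → ℤ → ZMod n → ℤ → ℂ := fun c k k' a x i =>
    w₁ c a x i k * conj (w₁ c a x i k') with hr
  have hl1 : ∀ c k k' a x j, ‖l c k k' a x j‖ ≤ 1 := fun c k k' a x j => by
    rw [hl, norm_mul, RCLike.norm_conj]; exact mul_le_one₀ (hw₂ _ _ _ _ _) (norm_nonneg _) (hw₂ _ _ _ _ _)
  have hr1 : ∀ c k k' a x j, ‖r c k k' a x j‖ ≤ 1 := fun c k k' a x j => by
    rw [hr, norm_mul, RCLike.norm_conj]; exact mul_le_one₀ (hw₁ _ _ _ _ _) (norm_nonneg _) (hw₁ _ _ _ _ _)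
  set T : ℤ → ℤ → ℤ → ℤ → ℝ := fun c k k' a => ‖𝔼 x, 𝔼 i ∈ J, 𝔼 j ∈ J,
    F c k k' (x + dilate n a i + dilate n (c - a) j) * l c k k' a x j * r c k k' a x i‖ with hT
  -- The weight `w₀` is free of `k`, so Cauchy–Schwarz drops it; for fixed `(k, k')` the other two
  -- weights become functions of `(x, i)` and of `(x, j)`.
  have hZT : ∀ c a, ‖Z c a‖ ^ 2 ≤ 𝔼 k ∈ J, 𝔼 k' ∈ J, T c k k' a := by
    intro c a
    have h1 : ‖Z c a‖ ^ 2 ≤ 𝔼 x, 𝔼 i ∈ J, 𝔼 j ∈ J, ‖𝔼 k ∈ J,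
        f (x + dilate n a i + dilate n (c - a) j + dilate n c k) * (w₁ c a x i k * w₂ c a x j k)‖ ^ 2 := by
      refine (norm_expect_sq_le _ _).trans (expect_le_expect fun x _ => ?_)
      refine (norm_expect_sq_le _ _).trans (expect_le_expect fun i _ => ?_)
      have h2 : ∀ j, 𝔼 k ∈ J, f (x + dilate n a i + dilate n (c - a) j + dilate n c k) *
          w₀ c a x i j * w₁ c a x i k * w₂ c a x j k = w₀ c a x i j * 𝔼 k ∈ J,
          f (x + dilate n a i + dilate n (c - a) j + dilate n c k) *
            (w₁ c a x i k * w₂ c a x j k) := fun j => by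
        rw [mul_expect]; exact expect_congr rfl fun k _ => by ring
      simp only [h2]
      exact norm_expect_mul_sq_le _ _ _ fun j _ => hw₀ _ _ _ _ _
    have h0 : 0 ≤ 𝔼 x, 𝔼 i ∈ J, 𝔼 j ∈ J, ‖𝔼 k ∈ J,
        f (x + dilate n a i + dilate n (c - a) j + dilate n c k) *
          (w₁ c a x i k * w₂ c a x j k)‖ ^ 2 :=
      expect_nonneg fun _ _ => expect_nonneg fun _ _ => expect_nonneg fun _ _ => by positivity
    have h3 : ((𝔼 x, 𝔼 i ∈ J, 𝔼 j ∈ J, ‖𝔼 k ∈ J,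
        f (x + dilate n a i + dilate n (c - a) j + dilate n c k) *
          (w₁ c a x i k * w₂ c a x j k)‖ ^ 2 : ℝ) : ℂ) =
        𝔼 k ∈ J, 𝔼 k' ∈ J, 𝔼 x, 𝔼 i ∈ J, 𝔼 j ∈ J,
          F c k k' (x + dilate n a i + dilate n (c - a) j) * l c k k' a x j * r c k k' a x i := by
      simp only [ofReal_expect, norm_expect_sq_eq]
      symm
      refine (expect_rotate _ _ _ _).trans (expect_congr rfl fun x _ => ?_)
      refine (expect_rotate _ _ _ _).trans (expect_congr rfl fun i _ => ?_)
      refine (expect_rotate _ _ _ _).trans (expect_congr rfl fun j _ => ?_)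
      refine expect_congr rfl fun k _ => expect_congr rfl fun k' _ => ?_
      have e1 : x + dilate n a i + dilate n (c - a) j + dilate n c k' +
          (dilate n c k - dilate n c k') =
          x + dilate n a i + dilate n (c - a) j + dilate n c k := by abel
      simp only [hF, hl, hr, gDiff, map_mul, e1]
      ring
    refine h1.trans ?_
    rw [← Complex.norm_of_nonneg h0, h3]
    refine (RCLike.norm_expect_le (K := ℂ)).trans (expect_le_expect fun k _ => ?_)
    exact RCLike.norm_expect_le (K := ℂ)
  -- pass to the two-dimensional averages
  set e : ℤ → ℤ → ℤ → ℝ := fun c k k' => (∑ a ∈ A c, T c k k' a) / (2 * M) with he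
  have he0 : ∀ c k k', 0 ≤ e c k k' := fun c k k' => by
    rw [he]; exact div_nonneg (sum_nonneg fun _ _ => norm_nonneg _) (by positivity)
  have hsum2 : ε ^ 2 * (4 * M) ≤ ∑ c ∈ C, 𝔼 k ∈ J, 𝔼 k' ∈ J, e c k k' := by
    have h1 : (∑ c ∈ C, ∑ a ∈ A c, ‖Z c a‖) ^ 2 ≤
        (4 * M) * ∑ c ∈ C, (2 * M) * ∑ a ∈ A c, ‖Z c a‖ ^ 2 := by
      have h2 := sum_pow_le_of_card_le C (fun c => ∑ a ∈ A c, ‖Z c a‖)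
        (fun _ _ => sum_nonneg fun _ _ => norm_nonneg _) hcardC' 1
      rw [pow_one] at h2
      refine h2.trans (mul_le_mul_of_nonneg_left (sum_le_sum fun c hc => ?_) (by positivity))
      have h3 := sum_pow_le_of_card_le (A c) (fun a => ‖Z c a‖)
        (fun _ _ => norm_nonneg _) (hcardA c hc) 1
      rwa [pow_one] at h3
    have h2 : ∑ c ∈ C, (2 * M) * ∑ a ∈ A c, ‖Z c a‖ ^ 2 ≤
        (2 * (M : ℝ)) ^ 2 * ∑ c ∈ C, 𝔼 k ∈ J, 𝔼 k' ∈ J, e c k k' := by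
      rw [mul_sum]
      refine sum_le_sum fun c _ => ?_
      have h3 : ∑ a ∈ A c, 𝔼 k ∈ J, 𝔼 k' ∈ J, T c k k' a =
          (2 * M) * 𝔼 k ∈ J, 𝔼 k' ∈ J, e c k k' := by
        rw [← expect_sum_comm, mul_expect]
        refine expect_congr rfl fun k _ => ?_
        rw [← expect_sum_comm, mul_expect]
        refine expect_congr rfl fun k' _ => ?_
        rw [he]
        field_simp
      calc _ ≤ (2 * (M : ℝ)) * ∑ a ∈ A c, 𝔼 k ∈ J, 𝔼 k' ∈ J, T c k k' a :=
            mul_le_mul_of_nonneg_left (sum_le_sum fun a _ => hZT c a) (by positivity)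
        _ = _ := by rw [h3]; ring
    have h4 := pow_le_pow_left₀ (by positivity) hsum 2
    have h5 : (16 * (M : ℝ) ^ 3) * (ε ^ 2 * (4 * M)) ≤
        (16 * (M : ℝ) ^ 3) * ∑ c ∈ C, 𝔼 k ∈ J, 𝔼 k' ∈ J, e c k k' := by
      calc _ = (ε * (8 * (M : ℝ) ^ 2)) ^ 2 := by ring
        _ ≤ _ := h4
        _ ≤ _ := h1
        _ ≤ (4 * M) * ((2 * (M : ℝ)) ^ 2 * ∑ c ∈ C, 𝔼 k ∈ J, 𝔼 k' ∈ J, e c k k') :=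
            mul_le_mul_of_nonneg_left h2 (by positivity)
        _ = _ := by ring
    exact le_of_mul_le_mul_left h5 (by positivity)
  have hB' : ∀ c ∈ C, ∀ k k', κ * e c k k' ^ 320 ≤
      Q ^ 17 * gU 3 (gDiff (dilate n c k - dilate n c k') f) := by
    intro c hc k k'
    rw [← gU_translate 3 (gDiff (dilate n c k - dilate n c k') f) (dilate n c k')]
    refine hB n H M hH hHM hn2 c (A c) (hA c hc) (F c k k') (l c k k') (r c k k') (hF1 c k k')
      (hl1 c k k') (hr1 c k k') _ (he0 c k k') (le_of_eq ?_)
    rw [he, div_mul_cancel₀ _ (by positivity)]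
  -- The two-dimensional bound controls the power 320 of each `e c k k'`, so the lower bound is
  -- raised to that power by convexity.
  have hpow : (ε ^ 2) ^ 320 * (4 * M) ≤ ∑ c ∈ C, 𝔼 k ∈ J, 𝔼 k' ∈ J, e c k k' ^ 320 := by
    have h1 := sum_pow_le_of_card_le C (fun c => 𝔼 k ∈ J, 𝔼 k' ∈ J, e c k k')
        (fun c _ => expect_nonneg fun k _ => expect_nonneg fun k' _ => he0 c k k') hcardC' 319
    have h2 : ∑ c ∈ C, (𝔼 k ∈ J, 𝔼 k' ∈ J, e c k k') ^ 320 ≤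
        ∑ c ∈ C, 𝔼 k ∈ J, 𝔼 k' ∈ J, e c k k' ^ 320 := by
      refine sum_le_sum fun c _ => ?_
      refine (expect_pow_le _ _ (fun k _ => expect_nonneg fun k' _ => he0 c k k') 320
        (by norm_num)).trans (expect_le_expect fun k _ => ?_)
      exact expect_pow_le _ _ (fun k' _ => he0 c k k') 320 (by norm_num)
    have h3 := pow_le_pow_left₀ (by positivity) hsum2 320
    have h4 : (4 * (M : ℝ)) ^ 319 * ((ε ^ 2) ^ 320 * (4 * M)) ≤
        (4 * (M : ℝ)) ^ 319 * ∑ c ∈ C, 𝔼 k ∈ J, 𝔼 k' ∈ J, e c k k' ^ 320 := by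
      calc _ = (ε ^ 2 * (4 * (M : ℝ))) ^ 320 := by
            rw [mul_pow (ε ^ 2), pow_succ (4 * (M : ℝ)) 319]
            exact mul_left_comm _ _ _
        _ ≤ _ := h3
        _ ≤ _ := h1
        _ ≤ _ := mul_le_mul_of_nonneg_left h2 (by positivity)
    exact le_of_mul_le_mul_left h4 (by positivity)
  set κ₂ : ℝ := κ * (ε ^ 2) ^ 320 / Q ^ 17 with hκ₂
  have hκ₂0 : 0 ≤ κ₂ := by positivity
  -- The directions `c` reach `2M`, which is why `16 M H ≤ n` is required here rather than `8 M H ≤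
  -- n`.
  have hfin := gU_succ_lower (R := 2 * M) hH (by rw [← mul_assoc]; exact hn) 3 hf C
    (by intro c hc; push_cast; exact hC c hc) hκ₂0 (by positivity)
    (by
      rw [hκ₂, div_mul_eq_mul_div, div_le_iff₀ (by positivity)]
      calc _ = κ * ((ε ^ 2) ^ 320 * (4 * M)) := by push_cast; ring
        _ ≤ κ * ∑ c ∈ C, 𝔼 k ∈ J, 𝔼 k' ∈ J, e c k k' ^ 320 :=
            mul_le_mul_of_nonneg_left hpow hκ.le
        _ ≤ Q ^ 17 * ∑ c ∈ C, 𝔼 k ∈ J, 𝔼 k' ∈ J,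
              gU 3 (gDiff (dilate n c k - dilate n c k') f) := by
            simp only [mul_sum, mul_expect]
            exact sum_le_sum fun c hc => expect_le_expect fun k _ => expect_le_expect fun k' _ =>
              hB' c hc k k'
        _ = _ := mul_comm _ _)
  rw [← hQ, hκ₂, div_pow, mul_pow, ← pow_mul, ← pow_mul, ← pow_mul, div_le_iff₀ (by positivity)]
    at hfin
  have e2 : 24 * Q * gU (3 + 1) f * Q ^ (17 * 4) = 24 * (Q ^ 69 * gU 4 f) := by ring
  rw [e2] at hfin
  norm_num at hfin
  linarith

end BoxControl

/-! ### Linearising the quadratic configuration. -/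

section VanDerCorput

open Finset

theorem norm_sum_sq_eq {M : ℕ} (Y : Finset ℤ) (hY : Y ⊆ Icc 1 (M : ℤ)) (φ : ℤ → ℂ) :
    ((‖∑ y ∈ Y, φ y‖ ^ 2 : ℝ) : ℂ) =
      ∑ a ∈ Ioo (-M : ℤ) M, ∑ y ∈ Y with y + a ∈ Y, φ (y + a) * conj (φ y) := by
  rw [← Complex.normSq_eq_norm_sq, ← Complex.mul_conj, map_sum, sum_mul_sum, sum_comm]
  simp only [sum_filter]
  conv_rhs => rw [sum_comm]
  refine sum_congr rfl fun y hy => ?_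
  rw [← sum_filter]
  refine sum_nbij' (fun z => z - y) (fun a => y + a) ?_ ?_ ?_ ?_ ?_
  · intro z hz
    have h1 := mem_Icc.1 (hY hz)
    have h2 := mem_Icc.1 (hY hy)
    refine mem_filter.2 ⟨mem_Ioo.2 ⟨by omega, by omega⟩, by rwa [add_sub_cancel]⟩
  · intro a ha; exact (mem_filter.1 ha).2
  · intro z _; ring
  · intro a _; ring
  · intro z _; rw [add_sub_cancel]

/-- The differencing parameters `y` admissible for the shifts `a` and `b`. -/
noncomputable def shiftRange (M : ℕ) (a b : ℤ) : Finset ℤ :=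
  {y ∈ {y ∈ Icc 1 (M : ℤ) | y + a ∈ Icc 1 (M : ℤ)} |
    y + b ∈ {y ∈ Icc 1 (M : ℤ) | y + a ∈ Icc 1 (M : ℤ)}}

/-- An interval is needed: only there does translating the summation variable by a small amount cost
a small boundary error. -/
theorem shiftRange_eq_Icc (M : ℕ) (a b : ℤ) : ∃ lo hi : ℤ, shiftRange M a b = Icc lo hi := by
  refine ⟨max (max 1 (1 - a)) (max (1 - b) (1 - a - b)),
    min (min (M : ℤ) (M - a)) (min (M - b) (M - a - b)), ?_⟩
  ext y
  simp only [shiftRange, mem_filter, mem_Icc]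
  omega

theorem shiftRange_subset (M : ℕ) (a b : ℤ) : shiftRange M a b ⊆ Icc 1 (M : ℤ) :=
  (filter_subset _ _).trans (filter_subset _ _)

theorem card_Ioo_le (M : ℕ) : (#(Ioo (-M : ℤ) M) : ℝ) ≤ 2 * M := by
  have : #(Ioo (-M : ℤ) M) ≤ 2 * M := by rw [Int.card_Ioo]; omega
  exact_mod_cast this

/-- Two applications of Cauchy–Schwarz and van der Corput linearise the quadratic progression. -/
theorem linearise {D : ℕ} [NeZero D] (M : ℕ) (q : ℤ) {f₀ f₁ f₂ : ZMod D → ℂ}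
    (hf₀ : ∀ x, ‖f₀ x‖ ≤ 1) (hf₁ : ∀ x, ‖f₁ x‖ ≤ 1) :
    ‖𝔼 x, ∑ y ∈ Icc 1 (M : ℤ), f₀ x * f₁ (x + y) * f₂ (x + (q * y ^ 2 : ℤ))‖ ^ 4 ≤
      2 * M * ∑ a ∈ Ioo (-M : ℤ) M, ∑ b ∈ Ioo (-M : ℤ) M, ‖∑ y ∈ shiftRange M a b,
        𝔼 x, f₂ (x + (b - q * (a + b) ^ 2 : ℤ)) *
          conj (f₂ (x + (2 * q * (a * y) : ℤ) + (b + q * a ^ 2 - q * (a + b) ^ 2 : ℤ))) *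
          conj (f₂ (x + (2 * q * (b * y) : ℤ) + (q * b ^ 2 - q * (a + b) ^ 2 : ℤ))) *
          f₂ (x + (2 * q * ((a + b) * y) : ℤ))‖ := by
  set Y := Icc 1 (M : ℤ) with hY
  set I := Ioo (-M : ℤ) M with hI
  set P : ℤ → ZMod D → ℤ → ℂ := fun a x y =>
    f₂ (x - y + (q * (y + a) ^ 2 : ℤ)) * conj (f₂ (x - y + (q * y ^ 2 : ℤ))) with hP
  have h1 : ‖𝔼 x, ∑ y ∈ Y, f₀ x * f₁ (x + y) * f₂ (x + (q * y ^ 2 : ℤ))‖ ^ 2 ≤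
      ∑ a ∈ I, ‖𝔼 x, gDiff (a : ZMod D) f₁ x * ∑ y ∈ Y with y + a ∈ Y, P a x y‖ := by
    have h2 : ((𝔼 x, ‖∑ y ∈ Y, f₁ (x + y) * f₂ (x + (q * y ^ 2 : ℤ))‖ ^ 2 : ℝ) : ℂ) =
        ∑ a ∈ I, 𝔼 x, gDiff (a : ZMod D) f₁ x * ∑ y ∈ Y with y + a ∈ Y, P a x y := by
      rw [ofReal_expect]
      have h3 : ∀ x : ZMod D, ((‖∑ y ∈ Y, f₁ (x + y) * f₂ (x + (q * y ^ 2 : ℤ))‖ ^ 2 : ℝ) : ℂ) = _ :=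
        fun x => norm_sum_sq_eq (M := M) Y subset_rfl
          (fun y => f₁ (x + y) * f₂ (x + (q * y ^ 2 : ℤ)))
      simp only [h3]
      rw [expect_sum_comm]
      refine sum_congr rfl fun a _ => ?_
      simp only [mul_sum]
      rw [expect_sum_comm, expect_sum_comm]
      refine sum_congr rfl fun y _ => ?_
      -- After `x ↦ x - y` the two copies of `f₁` form a derivative at `x`, independent of `y`, so
      -- the second Cauchy–Schwarz can remove it.
      rw [← expect_sub_right (y : ZMod D)]
      refine expect_congr rfl fun x _ => ?_
      have e1 : x - (y : ZMod D) + ((y + a : ℤ) : ZMod D) = x + a := by push_cast; ring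
      simp only [hP, gDiff, map_mul, e1, sub_add_cancel]
      ring
    have h0 : 0 ≤ 𝔼 x, ‖∑ y ∈ Y, f₁ (x + y) * f₂ (x + (q * y ^ 2 : ℤ))‖ ^ 2 :=
      expect_nonneg fun _ _ => by positivity
    refine le_trans ?_ ((Complex.norm_of_nonneg h0).symm.le.trans
      ((congrArg norm h2).le.trans (norm_sum_le _ _)))
    simp only [mul_assoc, ← mul_sum]
    exact norm_expect_mul_sq_le _ _ _ fun x _ => hf₀ x
  have h4 : (∑ a ∈ I, ‖𝔼 x, gDiff (a : ZMod D) f₁ x * ∑ y ∈ Y with y + a ∈ Y, P a x y‖) ^ 2 ≤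
      2 * M * ∑ a ∈ I, 𝔼 x, ‖∑ y ∈ Y with y + a ∈ Y, P a x y‖ ^ 2 := by
    have h5 := sum_pow_le_of_card_le I
      (fun a => ‖𝔼 x, gDiff (a : ZMod D) f₁ x * ∑ y ∈ Y with y + a ∈ Y, P a x y‖)
      (fun _ _ => norm_nonneg _) (card_Ioo_le M) 1
    rw [pow_one] at h5
    refine h5.trans (mul_le_mul_of_nonneg_left (sum_le_sum fun a _ => ?_) (by positivity))
    exact norm_expect_mul_sq_le _ _ _ fun x _ => norm_gDiff_le hf₁ _ _
  have h6 : ∀ a, ((𝔼 x, ‖∑ y ∈ Y with y + a ∈ Y, P a x y‖ ^ 2 : ℝ) : ℂ) =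
      ∑ b ∈ I, ∑ y ∈ shiftRange M a b, 𝔼 x, f₂ (x + (b - q * (a + b) ^ 2 : ℤ)) *
          conj (f₂ (x + (2 * q * (a * y) : ℤ) + (b + q * a ^ 2 - q * (a + b) ^ 2 : ℤ))) *
          conj (f₂ (x + (2 * q * (b * y) : ℤ) + (q * b ^ 2 - q * (a + b) ^ 2 : ℤ))) *
          f₂ (x + (2 * q * ((a + b) * y) : ℤ)) := by
    intro a
    rw [ofReal_expect]
    have h3 : ∀ x : ZMod D, ((‖∑ y ∈ Y with y + a ∈ Y, P a x y‖ ^ 2 : ℝ) : ℂ) = _ :=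
      fun x => norm_sum_sq_eq (M := M) {y ∈ Y | y + a ∈ Y} (filter_subset _ _) (fun y => P a x y)
    simp only [h3]
    rw [expect_sum_comm]
    refine sum_congr rfl fun b _ => ?_
    rw [expect_sum_comm]
    refine sum_congr rfl fun y _ => ?_
    -- This translation cancels `q y²` in all four arguments and places the factor of shift `a + b`
    -- exactly at `x + 2q(a+b)y`, the one later kept as `f`.
    rw [← expect_add_right (((y + b - q * y ^ 2 - q * (a + b) ^ 2 : ℤ)) : ZMod D)]
    refine expect_congr rfl fun x _ => ?_
    have e1 : x + ((y + b - q * y ^ 2 - q * (a + b) ^ 2 : ℤ) : ZMod D) - ((y + b : ℤ) : ZMod D) +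
        ((q * (y + b + a) ^ 2 : ℤ) : ZMod D) = x + ((2 * q * ((a + b) * y) : ℤ) : ZMod D) := by
      push_cast; ring
    have e2 : x + ((y + b - q * y ^ 2 - q * (a + b) ^ 2 : ℤ) : ZMod D) - ((y + b : ℤ) : ZMod D) +
        ((q * (y + b) ^ 2 : ℤ) : ZMod D) = x + ((2 * q * (b * y) : ℤ) : ZMod D) +
          ((q * b ^ 2 - q * (a + b) ^ 2 : ℤ) : ZMod D) := by
      push_cast; ring
    have e3 : x + ((y + b - q * y ^ 2 - q * (a + b) ^ 2 : ℤ) : ZMod D) - (y : ZMod D) +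
        ((q * (y + a) ^ 2 : ℤ) : ZMod D) = x + ((2 * q * (a * y) : ℤ) : ZMod D) +
          ((b + q * a ^ 2 - q * (a + b) ^ 2 : ℤ) : ZMod D) := by
      push_cast; ring
    have e4 : x + ((y + b - q * y ^ 2 - q * (a + b) ^ 2 : ℤ) : ZMod D) - (y : ZMod D) +
        ((q * y ^ 2 : ℤ) : ZMod D) = x + ((b - q * (a + b) ^ 2 : ℤ) : ZMod D) := by
      push_cast; ring
    simp only [hP, map_mul, Complex.conj_conj, e1, e2, e3, e4]
    ring
  calc _ = (‖𝔼 x, ∑ y ∈ Y, f₀ x * f₁ (x + y) * f₂ (x + (q * y ^ 2 : ℤ))‖ ^ 2) ^ 2 := by ring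
    _ ≤ _ := pow_le_pow_left₀ (by positivity) h1 2
    _ ≤ _ := h4
    _ ≤ _ := by
      refine mul_le_mul_of_nonneg_left (sum_le_sum fun a _ => ?_) (by positivity)
      have h0 : 0 ≤ 𝔼 x, ‖∑ y ∈ Y with y + a ∈ Y, P a x y‖ ^ 2 :=
        expect_nonneg fun _ _ => by positivity
      rw [← Complex.norm_of_nonneg h0, h6]
      exact norm_sum_le _ _

theorem norm_sum_Icc_sub_translate_le (lo hi e : ℤ) (he : 0 ≤ e) (T : ℤ → ℂ)
    (hT : ∀ y, ‖T y‖ ≤ 1) :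
    ‖∑ y ∈ Icc lo hi, T y - ∑ y ∈ Icc lo hi, T (y + e)‖ ≤ 2 * e := by
  have h1 : ∑ y ∈ Icc lo hi, T (y + e) = ∑ y ∈ Icc (lo + e) (hi + e), T y := by
    refine sum_nbij' (fun y => y + e) (fun y => y - e) ?_ ?_ ?_ ?_ ?_
    · intro y hy; rw [mem_Icc] at hy ⊢; omega
    · intro y hy; rw [mem_Icc] at hy ⊢; omega
    · intro y _; ring
    · intro y _; ring
    · intro y _; rfl
  rw [h1, ← sum_sdiff_sub_sum_sdiff]
  have h2 : ∀ S : Finset ℤ, #S ≤ e.toNat → ‖∑ y ∈ S, T y‖ ≤ e := by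
    intro S hS
    refine (norm_sum_le _ _).trans ?_
    have h3 : ∑ y ∈ S, ‖T y‖ ≤ #S := by
      rw [card_eq_sum_ones, Nat.cast_sum]
      exact sum_le_sum fun y _ => by rw [Nat.cast_one]; exact hT y
    refine h3.trans ?_
    have h4 : (#S : ℤ) ≤ e := by omega
    exact_mod_cast h4
  have h5 : #(Icc lo hi \ Icc (lo + e) (hi + e)) ≤ e.toNat := by
    refine (card_le_card (t := Ico lo (lo + e)) fun y hy => ?_).trans (by rw [Int.card_Ico]; omega)
    simp only [mem_sdiff, mem_Icc, mem_Ico] at hy ⊢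
    omega
  have h6 : #(Icc (lo + e) (hi + e) \ Icc lo hi) ≤ e.toNat := by
    refine (card_le_card (t := Ioc hi (hi + e)) fun y hy => ?_).trans (by rw [Int.card_Ioc]; omega)
    simp only [mem_sdiff, mem_Icc, mem_Ioc] at hy ⊢
    omega
  refine (norm_sub_le _ _).trans ?_
  have := h2 _ h5
  have := h2 _ h6
  linarith

end VanDerCorput

/-! ### Three-dimensional boxes from linear configurations. -/

section CubeAverages

open Finset

variable {D : ℕ} [NeZero D]

/-- The correlation of `f` along a three-dimensional box with products of functions that do not
depend on one of the box coordinates. -/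
noncomputable def cubeCorrelation (H : ℕ) (q a b : ℤ) (f : ZMod D → ℂ)
    (w₀ w₁ w₂ : ZMod D → ℤ → ℤ → ℂ) (x : ZMod D) : ℂ :=
  𝔼 i ∈ Ico (0 : ℤ) H, 𝔼 j ∈ Ico (0 : ℤ) H, 𝔼 k ∈ Ico (0 : ℤ) H,
    f (x + (2 * q * (a * i + b * j + (a + b) * k) : ℤ)) * w₀ x i j * w₁ x i k * w₂ x j k

/-- A linear correlation along an interval is an average of correlations along
three-dimensional boxes. -/
theorem exists_cubeCorrelation (H : ℕ) (hH : 0 < H) (q a b : ℤ) {g₀ g₁ g₂ f : ZMod D → ℂ}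
    (h₀ : ∀ x, ‖g₀ x‖ ≤ 1) (h₁ : ∀ x, ‖g₁ x‖ ≤ 1) (h₂ : ∀ x, ‖g₂ x‖ ≤ 1) (hf : ∀ x, ‖f x‖ ≤ 1) :
    ∃ w₀ w₁ w₂ : ℤ → ZMod D → ℤ → ℤ → ℂ, (∀ p x i j, ‖w₀ p x i j‖ ≤ 1) ∧
      (∀ p x i j, ‖w₁ p x i j‖ ≤ 1) ∧ (∀ p x i j, ‖w₂ p x i j‖ ≤ 1) ∧ ∀ lo hi : ℤ,
      ‖∑ y ∈ Icc lo hi, 𝔼 x, g₀ x * g₁ (x + (2 * q * (a * y) : ℤ)) *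
        g₂ (x + (2 * q * (b * y) : ℤ)) * f (x + (2 * q * ((a + b) * y) : ℤ))‖ ≤
      ∑ p ∈ Icc lo hi, ‖𝔼 x, cubeCorrelation H q a b f (w₀ p) (w₁ p) (w₂ p) x‖ + 6 * H := by
  set τ : ℤ → ZMod D := fun m => ((2 * q * m : ℤ) : ZMod D) with hτ
  have hτadd : ∀ m m', τ (m + m') = τ m + τ m' := fun m m' => by
    simp only [hτ]; push_cast; ring
  -- After `y = p + i + j + k` and a translation by `-(a+b)p - bi - aj`, the factor `g₀` is free of
  -- `k`, `g₁` of `j` and `g₂` of `i`.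
  refine ⟨fun p x i j => g₀ (x + τ (-((a + b) * p) - b * i - a * j)),
    fun p x i k => g₁ (x + τ (a * p - (a + b) * p + (a - b) * i + a * k)),
    fun p x j k => g₂ (x + τ (b * p - (a + b) * p + (b - a) * j + b * k)),
    fun p x i j => h₀ _, fun p x i j => h₁ _, fun p x i j => h₂ _, fun lo hi => ?_⟩
  set J := Ico (0 : ℤ) H with hJ
  have hJne : J.Nonempty := ⟨0, by rw [hJ, mem_Ico]; omega⟩
  set T : ℤ → ℂ := fun y => 𝔼 x, g₀ x * g₁ (x + τ (a * y)) * g₂ (x + τ (b * y)) *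
    f (x + τ ((a + b) * y)) with hT
  have hT1 : ∀ y, ‖T y‖ ≤ 1 := fun y => by
    refine norm_expect_le_of_le _ _ _ zero_le_one fun x _ => ?_
    rw [norm_mul, norm_mul, norm_mul]
    exact mul_le_one₀ (mul_le_one₀ (mul_le_one₀ (h₀ _) (norm_nonneg _) (h₁ _)) (norm_nonneg _)
      (h₂ _)) (norm_nonneg _) (hf _)
  have hTp : ∀ p i j k, T (p + (i + j + k)) = 𝔼 x : ZMod D,
      f (x + τ (a * i + b * j + (a + b) * k)) * g₀ (x + τ (-((a + b) * p) - b * i - a * j)) *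
      g₁ (x + τ (a * p - (a + b) * p + (a - b) * i + a * k)) *
      g₂ (x + τ (b * p - (a + b) * p + (b - a) * j + b * k)) := by
    intro p i j k
    simp only [hT]
    rw [← expect_add_right (τ (-((a + b) * p) - b * i - a * j))]
    refine expect_congr rfl fun x _ => ?_
    have e1 : x + τ (-((a + b) * p) - b * i - a * j) + τ (a * (p + (i + j + k))) =
        x + τ (a * p - (a + b) * p + (a - b) * i + a * k) := by
      rw [add_assoc, ← hτadd]; congr 2; ring
    have e2 : x + τ (-((a + b) * p) - b * i - a * j) + τ (b * (p + (i + j + k))) =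
        x + τ (b * p - (a + b) * p + (b - a) * j + b * k) := by
      rw [add_assoc, ← hτadd]; congr 2; ring
    have e3 : x + τ (-((a + b) * p) - b * i - a * j) + τ ((a + b) * (p + (i + j + k))) =
        x + τ (a * i + b * j + (a + b) * k) := by
      rw [add_assoc, ← hτadd]; congr 2; ring
    rw [e1, e2, e3]
    ring
  have havg : 𝔼 i ∈ J, 𝔼 j ∈ J, 𝔼 k ∈ J, ∑ p ∈ Icc lo hi, T (p + (i + j + k)) =
      ∑ p ∈ Icc lo hi, 𝔼 x, cubeCorrelation H q a b f
        (fun x i j => g₀ (x + τ (-((a + b) * p) - b * i - a * j)))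
        (fun x i k => g₁ (x + τ (a * p - (a + b) * p + (a - b) * i + a * k)))
        (fun x j k => g₂ (x + τ (b * p - (a + b) * p + (b - a) * j + b * k))) x := by
    simp only [expect_sum_comm]
    refine sum_congr rfl fun p _ => ?_
    simp only [hTp, cubeCorrelation]
    symm
    rw [expect_comm]
    refine expect_congr rfl fun i _ => ?_
    rw [expect_comm]
    refine expect_congr rfl fun j _ => ?_
    rw [expect_comm]
  have hdiff : ‖∑ y ∈ Icc lo hi, T y -
      𝔼 i ∈ J, 𝔼 j ∈ J, 𝔼 k ∈ J, ∑ p ∈ Icc lo hi, T (p + (i + j + k))‖ ≤ 6 * H := by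
    have h3 : ∑ y ∈ Icc lo hi, T y - 𝔼 i ∈ J, 𝔼 j ∈ J, 𝔼 k ∈ J, ∑ p ∈ Icc lo hi,
        T (p + (i + j + k)) = 𝔼 i ∈ J, 𝔼 j ∈ J, 𝔼 k ∈ J,
        (∑ y ∈ Icc lo hi, T y - ∑ p ∈ Icc lo hi, T (p + (i + j + k))) := by
      simp only [expect_sub_distrib, expect_const hJne]
    rw [h3]
    refine norm_expect_le_of_le _ _ _ (by positivity) fun i hi' => ?_
    refine norm_expect_le_of_le _ _ _ (by positivity) fun j hj' => ?_
    refine norm_expect_le_of_le _ _ _ (by positivity) fun k hk' => ?_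
    rw [hJ, mem_Ico] at hi' hj' hk'
    refine (norm_sum_Icc_sub_translate_le lo hi (i + j + k) (by omega) T hT1).trans ?_
    -- Each of the three variables is below `H`, and a translation by `e` changes at most `e` terms
    -- at each end.
    have h4 : 2 * (i + j + k) ≤ 6 * H := by omega
    exact_mod_cast h4
  calc _ = ‖∑ y ∈ Icc lo hi, T y‖ := rfl
    _ ≤ _ := norm_le_norm_add_norm_sub' _ _
    _ ≤ _ := add_le_add (by rw [havg]; exact norm_sum_le _ _) hdiff

end CubeAverages

/-! ### Discarding shifts with a short direction. -/

section Nondegenerate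

open Finset

/-- Pairs of shifts `(a, b)` for which `a`, `b` and `a + b` are all at least `H` in modulus. -/
noncomputable def goodShifts (M H : ℕ) : Finset (ℤ × ℤ) :=
  {p ∈ Ioo (-M : ℤ) M ×ˢ Ioo (-M : ℤ) M |
    (H : ℤ) ≤ |p.1| ∧ (H : ℤ) ≤ |p.2| ∧ (H : ℤ) ≤ |p.1 + p.2|}

theorem card_bad_shifts_le (M H : ℕ) :
    (#{p ∈ Ioo (-M : ℤ) M ×ˢ Ioo (-M : ℤ) M |
      ¬ ((H : ℤ) ≤ |p.1| ∧ (H : ℤ) ≤ |p.2| ∧ (H : ℤ) ≤ |p.1 + p.2|)} : ℝ) ≤ 12 * H * M := by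
  set I := Ioo (-M : ℤ) M with hI
  set E := Ioo (-H : ℤ) H ×ˢ I with hE
  have hsub : {p ∈ I ×ˢ I | ¬ ((H : ℤ) ≤ |p.1| ∧ (H : ℤ) ≤ |p.2| ∧ (H : ℤ) ≤ |p.1 + p.2|)} ⊆
      E ∪ (E.image (fun p => (p.2, p.1)) ∪ E.image (fun p => (p.1 - p.2, p.2))) := by
    rintro ⟨a, b⟩ hp
    simp only [mem_filter, mem_product, not_and_or, not_le] at hp
    obtain ⟨⟨ha, hb⟩, h | h | h⟩ := hp
    · exact mem_union_left _ (mem_product.2 ⟨mem_Ioo.2 (abs_lt.1 h), hb⟩)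
    · refine mem_union_right _ (mem_union_left _ (mem_image.2 ⟨(b, a), ?_, rfl⟩))
      exact mem_product.2 ⟨mem_Ioo.2 (abs_lt.1 h), ha⟩
    · refine mem_union_right _ (mem_union_right _ (mem_image.2 ⟨(a + b, b), ?_, by simp⟩))
      exact mem_product.2 ⟨mem_Ioo.2 (abs_lt.1 h), hb⟩
  have h1 := (card_le_card hsub).trans ((card_union_le _ _).trans
    (add_le_add_right (card_union_le _ _) _))
  have h2 : #E ≤ 2 * H * (2 * M) := by
    rw [hE, card_product]
    refine Nat.mul_le_mul ?_ ?_
    · rw [Int.card_Ioo]; omega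
    · rw [hI, Int.card_Ioo]; omega
  have h3 := card_image_le (s := E) (f := fun p : ℤ × ℤ => (p.2, p.1))
  have h4 := card_image_le (s := E) (f := fun p : ℤ × ℤ => (p.1 - p.2, p.2))
  have h5 : #{p ∈ I ×ˢ I | ¬ ((H : ℤ) ≤ |p.1| ∧ (H : ℤ) ≤ |p.2| ∧ (H : ℤ) ≤ |p.1 + p.2|)} ≤
      3 * (2 * H * (2 * M)) := by omega
  have h6 : 3 * (2 * H * (2 * M)) = 12 * H * M := by ring
  rw [h6] at h5
  exact_mod_cast h5

/-- The error `36 H M²` consists of `24 H M²` from translating `y` in at most `(2M)²` good pairs and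
`12 H M²` from the bad pairs bounded trivially; it is harmless once `H` is a small multiple of `δ⁴
M`. -/
theorem exists_cubeCorrelation_of_quadratic {D : ℕ} [NeZero D] (M H : ℕ) (hH : 0 < H) (q : ℤ)
    {f₀ f₁ f₂ : ZMod D → ℂ} (hf₀ : ∀ x, ‖f₀ x‖ ≤ 1) (hf₁ : ∀ x, ‖f₁ x‖ ≤ 1)
    (hf₂ : ∀ x, ‖f₂ x‖ ≤ 1) :
    ∃ w₀ w₁ w₂ : ℤ → ℤ → ℤ → ZMod D → ℤ → ℤ → ℂ, (∀ a b p x i j, ‖w₀ a b p x i j‖ ≤ 1) ∧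
      (∀ a b p x i j, ‖w₁ a b p x i j‖ ≤ 1) ∧ (∀ a b p x i j, ‖w₂ a b p x i j‖ ≤ 1) ∧
      ‖𝔼 x, ∑ y ∈ Icc 1 (M : ℤ), f₀ x * f₁ (x + y) * f₂ (x + (q * y ^ 2 : ℤ))‖ ^ 4 ≤
      2 * M * (∑ s ∈ goodShifts M H, ∑ p ∈ Icc 1 (M : ℤ), ‖𝔼 x, cubeCorrelation H q s.1 s.2 f₂
        (w₀ s.1 s.2 p) (w₁ s.1 s.2 p) (w₂ s.1 s.2 p) x‖ + 36 * H * (M : ℝ) ^ 2) := by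
  have hconj : ∀ x, ‖conj (f₂ x)‖ ≤ 1 := fun x => by rw [RCLike.norm_conj]; exact hf₂ x
  have hcube := fun a b : ℤ => exists_cubeCorrelation H hH q a b
    (g₀ := fun x : ZMod D => f₂ (x + (b - q * (a + b) ^ 2 : ℤ)))
    (g₁ := fun x : ZMod D => conj (f₂ (x + (b + q * a ^ 2 - q * (a + b) ^ 2 : ℤ))))
    (g₂ := fun x : ZMod D => conj (f₂ (x + (q * b ^ 2 - q * (a + b) ^ 2 : ℤ)))) (f := f₂)
    (fun x => hf₂ _) (fun x => hconj _) (fun x => hconj _) hf₂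
  choose w₀ w₁ w₂ hw₀ hw₁ hw₂ hw using hcube
  refine ⟨w₀, w₁, w₂, hw₀, hw₁, hw₂, (linearise M q hf₀ hf₁).trans ?_⟩
  refine mul_le_mul_of_nonneg_left ?_ (by positivity)
  set X : ℤ → ℤ → ℝ := fun a b => ‖∑ y ∈ shiftRange M a b,
        𝔼 x, f₂ (x + (b - q * (a + b) ^ 2 : ℤ)) *
          conj (f₂ (x + (2 * q * (a * y) : ℤ) + (b + q * a ^ 2 - q * (a + b) ^ 2 : ℤ))) *
          conj (f₂ (x + (2 * q * (b * y) : ℤ) + (q * b ^ 2 - q * (a + b) ^ 2 : ℤ))) *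
          f₂ (x + (2 * q * ((a + b) * y) : ℤ))‖ with hX
  have hXM : ∀ a b, X a b ≤ M := by
    intro a b
    refine (norm_sum_le _ _).trans ?_
    have h1 : #(shiftRange M a b) ≤ M := by
      have := card_le_card (shiftRange_subset M a b)
      rw [Int.card_Icc] at this
      omega
    calc _ ≤ ∑ y ∈ shiftRange M a b, (1 : ℝ) := by
          refine sum_le_sum fun y _ => norm_expect_le_of_le _ _ _ zero_le_one fun x _ => ?_
          rw [norm_mul, norm_mul, norm_mul]
          exact mul_le_one₀ (mul_le_one₀ (mul_le_one₀ (hf₂ _) (norm_nonneg _) (hconj _))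
            (norm_nonneg _) (hconj _)) (norm_nonneg _) (hf₂ _)
      _ ≤ M := by
          rw [sum_const, nsmul_eq_mul, mul_one]
          exact_mod_cast h1
  have hXgood : ∀ a b, X a b ≤ ∑ p ∈ Icc 1 (M : ℤ), ‖𝔼 x, cubeCorrelation H q a b f₂
        (w₀ a b p) (w₁ a b p) (w₂ a b p) x‖ + 6 * H := by
    intro a b
    obtain ⟨lo, hi, hlohi⟩ := shiftRange_eq_Icc M a b
    have h1 := hw a b lo hi
    rw [← hlohi] at h1
    refine h1.trans (add_le_add_left ?_ _)
    exact sum_le_sum_of_subset_of_nonneg (shiftRange_subset M a b) fun _ _ _ => norm_nonneg _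
  rw [← sum_product', ← sum_filter_add_sum_filter_not _
    (fun p : ℤ × ℤ => (H : ℤ) ≤ |p.1| ∧ (H : ℤ) ≤ |p.2| ∧ (H : ℤ) ≤ |p.1 + p.2|)]
  have h1 : ∑ s ∈ goodShifts M H, X s.1 s.2 ≤ ∑ s ∈ goodShifts M H, ∑ p ∈ Icc 1 (M : ℤ),
      ‖𝔼 x, cubeCorrelation H q s.1 s.2 f₂
        (w₀ s.1 s.2 p) (w₁ s.1 s.2 p) (w₂ s.1 s.2 p) x‖ + 24 * H * (M : ℝ) ^ 2 := by
    refine (sum_le_sum fun s _ => hXgood s.1 s.2).trans ?_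
    rw [sum_add_distrib, sum_const, nsmul_eq_mul]
    refine add_le_add_right ?_ _
    have h2 : (#(goodShifts M H) : ℝ) ≤ (2 * M) ^ 2 := by
      have h3 : (#(goodShifts M H) : ℝ) ≤ #(Ioo (-M : ℤ) M ×ˢ Ioo (-M : ℤ) M) := by
        exact_mod_cast card_filter_le _ _
      rw [card_product, Nat.cast_mul, ← sq] at h3
      exact h3.trans (pow_le_pow_left₀ (by positivity) (card_Ioo_le M) 2)
    calc _ ≤ (2 * (M : ℝ)) ^ 2 * (6 * H) := mul_le_mul_of_nonneg_right h2 (by positivity)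
      _ = _ := by ring
  have h2 : ∑ s ∈ Ioo (-M : ℤ) M ×ˢ Ioo (-M : ℤ) M with
      ¬ ((H : ℤ) ≤ |s.1| ∧ (H : ℤ) ≤ |s.2| ∧ (H : ℤ) ≤ |s.1 + s.2|), X s.1 s.2 ≤
      12 * H * (M : ℝ) ^ 2 := by
    refine (sum_le_sum fun s _ => hXM s.1 s.2).trans ?_
    rw [sum_const, nsmul_eq_mul]
    calc _ ≤ (12 * H * M : ℝ) * M :=
          mul_le_mul_of_nonneg_right (card_bad_shifts_le M H) (by positivity)
      _ = _ := by ring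
  refine (add_le_add h1 h2).trans (le_of_eq ?_)
  ring

end Nondegenerate

/-! ### Splitting `ℤ/qnℤ` into residue classes modulo `q`. -/

section ResidueClasses

open Finset

/-- Multiplication by `q` is a well-defined homomorphism from `ℤ/nℤ` to `ℤ/qnℤ`; wrap-around in the
former becomes a multiple of `D`. -/
theorem cast_mul_val_add {q n D : ℕ} [NeZero n] (hD : D = q * n) (t : ZMod n) (m : ℤ) :
    (((q : ℤ) * ((t + (m : ZMod n)).val : ℤ) : ℤ) : ZMod D) =
      (((q : ℤ) * (t.val : ℤ) : ℤ) : ZMod D) + (((q : ℤ) * m : ℤ) : ZMod D) := by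
  rw [← Int.cast_add, ZMod.intCast_eq_intCast_iff_dvd_sub, hD]
  have h : (n : ℤ) ∣ ((t.val : ℤ) + m) - ((t + (m : ZMod n)).val : ℤ) := by
    rw [← ZMod.intCast_eq_intCast_iff_dvd_sub]
    simp
  obtain ⟨k, hk⟩ := h
  refine ⟨k, ?_⟩
  push_cast
  linear_combination (q : ℤ) * hk

theorem expect_residue_classes {q n D : ℕ} [NeZero n] [NeZero D] (hD : D = q * n)
    (F : ZMod D → ℂ) :
    𝔼 x, F x = 𝔼 u ∈ Icc 1 (q : ℤ), 𝔼 t : ZMod n, F ((u + q * t.val : ℤ) : ZMod D) := by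
  rw [← expect_product']
  symm
  have hinj : Set.InjOn (fun p : ℤ × ZMod n => ((p.1 + q * p.2.val : ℤ) : ZMod D))
      (Icc 1 (q : ℤ) ×ˢ (univ : Finset (ZMod n)) : Finset (ℤ × ZMod n)) := by
    rintro ⟨u, t⟩ hp ⟨u', t'⟩ hp' h
    simp only [coe_product, Set.mem_prod, mem_coe, mem_Icc] at hp hp'
    obtain ⟨⟨hu1, hu2⟩, -⟩ := hp
    obtain ⟨⟨hu1', hu2'⟩, -⟩ := hp'
    have ht : (t.val : ℤ) + 1 ≤ n := by exact_mod_cast ZMod.val_lt t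
    have ht' : (t'.val : ℤ) + 1 ≤ n := by exact_mod_cast ZMod.val_lt t'
    have hq : (0 : ℤ) < q := by omega
    have h1 := mul_le_mul_of_nonneg_left ht hq.le
    have h1' := mul_le_mul_of_nonneg_left ht' hq.le
    have h2 : 0 ≤ (q : ℤ) * t.val := by positivity
    have h2' : 0 ≤ (q : ℤ) * t'.val := by positivity
    dsimp only at h
    rw [ZMod.intCast_eq_intCast_iff_dvd_sub] at h
    -- Both representatives lie in `[1, D]`, so a congruence modulo `D` is an equality.
    have h3 : (u' + q * t'.val) - (u + q * t.val) = (0 : ℤ) := by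
      refine Int.eq_zero_of_abs_lt_dvd h ?_
      have hD' : (D : ℤ) = q * n := by rw [hD]; push_cast; rfl
      rw [hD', abs_lt]
      constructor <;> linarith
    have h4 : u = u' := by
      have h5 : (q : ℤ) ∣ u' - u := ⟨t.val - t'.val, by linear_combination h3⟩
      have h6 := Int.eq_zero_of_abs_lt_dvd h5 (by rw [abs_lt]; omega)
      omega
    subst h4
    have h7 : (q : ℤ) * (t'.val - t.val) = 0 := by linear_combination h3
    have h8 := (mul_eq_zero.1 h7).resolve_left hq.ne'
    have h9 : t.val = t'.val := by omega
    exact Prod.ext rfl (ZMod.val_injective n h9)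
  refine expect_nbij (fun p : ℤ × ZMod n => ((p.1 + q * p.2.val : ℤ) : ZMod D))
    (fun _ _ => mem_univ _) (fun _ _ => rfl) hinj ?_
  refine surjOn_of_injOn_of_card_le _ (fun _ _ => mem_coe.2 (mem_univ _)) hinj ?_
  rw [card_product, card_univ, card_univ, ZMod.card, ZMod.card, Int.card_Icc, hD]
  simp

end ResidueClasses

/-! ### Gowers norms on the integers and on cyclic groups. -/

section IntegerGowers

open Finset

/-- The sum of squares formula for the `U^(s+1)`-norm on the integers. -/
noncomputable def gowersSquares (s : ℕ) (f : ℤ → ℂ) : ℝ :=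
  ∑' h : Fin s → ℤ, ‖∑' x, mulDiffs (List.ofFn h) f x‖ ^ 2

theorem gowersSquares_support_finite (s : ℕ) {f : ℤ → ℂ} (hf : (Function.support f).Finite) :
    (Function.support fun h : Fin s → ℤ => ‖∑' x, mulDiffs (List.ofFn h) f x‖ ^ 2).Finite := by
  refine ((gowersSum_support_finite s hf).image Prod.snd).subset fun h hh => ?_
  by_contra hcon
  refine hh ?_
  have : ∀ x, mulDiffs (List.ofFn h) f x = 0 := fun x => by
    by_contra hx
    exact hcon ⟨(x, h), hx, rfl⟩
  simp [this]

/-- The last entry of the list is the derivative taken first, so it is split off with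
`Fin.snocEquiv`; this matches the recursion defining `gU`. -/
theorem gowersSquares_succ (s : ℕ) {f : ℤ → ℂ} (hf : (Function.support f).Finite) :
    gowersSquares (s + 1) f = ∑' k : ℤ, gowersSquares s (mulDiff k f) := by
  have hs : Summable fun h : Fin (s + 1) → ℤ => ‖∑' x, mulDiffs (List.ofFn h) f x‖ ^ 2 :=
    summable_of_hasFiniteSupport (gowersSquares_support_finite (s + 1) hf)
  let e : ℤ × (Fin s → ℤ) ≃ (Fin (s + 1) → ℤ) := Fin.snocEquiv fun _ => ℤ
  have key : ∀ p : ℤ × (Fin s → ℤ), mulDiffs (List.ofFn (e p)) f =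
      mulDiffs (List.ofFn p.2) (mulDiff p.1 f) := by
    intro p
    have : List.ofFn (e p) = List.ofFn p.2 ++ [p.1] := by
      rw [List.ofFn_succ']
      simp [e, Fin.snocEquiv, List.concat_eq_append]
    rw [this]
    simp [mulDiffs]
  unfold gowersSquares
  rw [← e.tsum_eq]
  have hs' := (e.summable_iff).2 hs
  simp only [Function.comp_def, key] at hs'
  simp only [key]
  rw [hs'.tsum_prod]

theorem gowersSquares_zero (s : ℕ) : gowersSquares s (fun _ => 0) = 0 := by
  have h : ∀ (l : List ℤ) x, mulDiffs l (fun _ => 0) x = 0 := fun l x => by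
    by_contra hx
    exact mulDiffs_support_subset l _ hx rfl
  simp [gowersSquares, h]

theorem gU_zero_fun {G : Type*} [AddCommGroup G] [Fintype G] (s : ℕ) :
    gU s (fun _ : G => (0 : ℂ)) = 0 := by
  induction s with
  | zero => simp [gU]
  | succ s ih =>
    rw [gU]
    have : ∀ h : G, gDiff h (fun _ : G => (0 : ℂ)) = fun _ => 0 := fun h => by
      funext x; simp [gDiff]
    simp [this, ih]

/-- Gowers norms of functions on a short progression can be computed in a cyclic group. -/
theorem gowersSquares_eq_gU {n ℓ q : ℕ} [NeZero n] (hq : 0 < q) (hn : 2 * ℓ ≤ n) (u : ℤ) (s : ℕ)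
    {f : ℤ → ℂ} (hf : ∀ x, f x ≠ 0 → ∃ t : ℤ, (0 ≤ t ∧ t < ℓ) ∧ x = u + q * t) :
    gowersSquares s f = (n : ℝ) ^ (s + 2) * gU s (fun t : ZMod n => f (u + q * t.val)) := by
  have hq' : (0 : ℤ) < q := by exact_mod_cast hq
  have hn0 : (n : ℝ) ≠ 0 := by exact_mod_cast NeZero.ne n
  have hval : ∀ v : ℤ, 0 ≤ v → v < n → (((v : ZMod n)).val : ℤ) = v := fun v h0 h1 => by
    rw [ZMod.val_intCast, Int.emod_eq_of_lt h0 h1]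
  have hbound : ∀ g : ℤ → ℂ, (∀ x, g x ≠ 0 → ∃ t : ℤ, (0 ≤ t ∧ t < ℓ) ∧ x = u + q * t) →
      ∀ t : ℤ, g (u + q * t) ≠ 0 → 0 ≤ t ∧ t < ℓ := by
    intro g hg t ht
    obtain ⟨t', ht', heq⟩ := hg _ ht
    have : (q : ℤ) * t = q * t' := by linarith
    rwa [mul_left_cancel₀ hq'.ne' this]
  have hsupp : ∀ g : ℤ → ℂ, (∀ x, g x ≠ 0 → ∃ t : ℤ, (0 ≤ t ∧ t < ℓ) ∧ x = u + q * t) →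
      Function.support g ⊆ ((Ico (0 : ℤ) ℓ).image fun t => u + q * t : Finset ℤ) := by
    intro g hg x hx
    obtain ⟨t, ht, rfl⟩ := hg x hx
    exact mem_coe.2 (mem_image.2 ⟨t, mem_Ico.2 ht, rfl⟩)
  induction s generalizing f with
  | zero =>
    have h1 : gowersSquares 0 f = ‖∑' x, f x‖ ^ 2 := by
      unfold gowersSquares
      rw [tsum_eq_single default fun b hb => absurd (Subsingleton.elim b default) hb]
      simp [mulDiffs]
    have h2 : ∑' x, f x = ∑ t : ZMod n, f (u + q * t.val) := by
      rw [tsum_eq_sum' (hsupp f hf), sum_image (fun a _ b _ h => by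
        have : (q : ℤ) * a = q * b := by simpa using h
        exact mul_left_cancel₀ hq'.ne' this)]
      symm
      rw [← sum_subset (subset_univ ((Ico (0 : ℤ) ℓ).image fun t : ℤ => (t : ZMod n))), sum_image]
      · refine sum_congr rfl fun t ht => ?_
        rw [mem_Ico] at ht
        rw [hval t ht.1 (by omega)]
      · intro a ha b hb h
        simp only [mem_coe, mem_Ico] at ha hb
        have := congrArg (fun z : ZMod n => (z.val : ℤ)) h
        simp only at this
        rwa [hval a ha.1 (by omega), hval b hb.1 (by omega)] at this
      · intro t _ ht
        by_contra hne
        have h3 := hbound f hf _ hne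
        refine ht (mem_image.2 ⟨t.val, mem_Ico.2 h3, ?_⟩)
        simp
    rw [h1, h2, gU, Fintype.expect_eq_sum_div_card, ZMod.card, norm_div, Complex.norm_natCast]
    field_simp
  | succ s ih =>
    have hfin : (Function.support f).Finite := (finite_toSet _).subset (hsupp f hf)
    set K := Ioo (-ℓ : ℤ) ℓ with hK
    have h1 : ∀ k ∉ K.image (fun k => (q : ℤ) * k), mulDiff k f = fun _ => 0 := by
      intro k hk
      funext x
      by_contra hne
      have hne' : f (x + k) * conj (f x) ≠ 0 := hne
      obtain ⟨t₁, ht₁, e₁⟩ := hf _ (left_ne_zero_of_mul hne')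
      obtain ⟨t₂, ht₂, e₂⟩ := hf x fun h0 => right_ne_zero_of_mul hne' (by simp [h0])
      refine hk (mem_image.2 ⟨t₁ - t₂, ?_, by linarith⟩)
      rw [hK, mem_Ioo]
      omega
    have h2 : ∀ k ∈ K, gowersSquares s (mulDiff (q * k) f) =
        (n : ℝ) ^ (s + 2) * gU s (gDiff (k : ZMod n) fun t : ZMod n => f (u + q * t.val)) := by
      intro k hk
      rw [hK, mem_Ioo] at hk
      have h3 : ∀ x, mulDiff (q * k) f x ≠ 0 → ∃ t : ℤ, (0 ≤ t ∧ t < ℓ) ∧ x = u + q * t := by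
        intro x hx
        have hx' : f (x + q * k) * conj (f x) ≠ 0 := hx
        exact hf x fun h0 => right_ne_zero_of_mul hx' (by simp [h0])
      rw [ih h3]
      congr 2
      funext t
      have h4 : mulDiff (q * k) f (u + q * t.val) =
          f (u + q * (t.val + k)) * conj (f (u + q * t.val)) := by
        rw [mulDiff]; congr 2; ring
      rw [h4]
      simp only [gDiff]
      by_cases h0 : f (u + q * t.val) = 0
      · rw [h0]; simp
      congr 1
      have ht := hbound f hf _ h0
      have h5 : (((t + (k : ZMod n)).val : ℕ) : ℤ) = ((t.val : ℤ) + k) % n := by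
        rw [← ZMod.val_intCast]
        simp
      rw [h5]
      -- Wrap-around occurs only when `t + k` is negative. Then `t + k + n > n - ℓ ≥ ℓ`, so the
      -- integer point and its wrapped copy both lie outside the support.
      by_cases hv : 0 ≤ (t.val : ℤ) + k
      · rw [Int.emod_eq_of_lt hv (by omega)]
      · have h6 : ((t.val : ℤ) + k) % n = t.val + k + n := by
          rw [← Int.add_emod_right, Int.emod_eq_of_lt (by omega) (by omega)]
        rw [h6]
        have h7 : f (u + q * (t.val + k)) = 0 := by
          by_contra hne; exact hv (hbound f hf _ hne).1
        have h8 : f (u + q * (t.val + k + n)) = 0 := by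
          by_contra hne
          have := (hbound f hf _ hne).2
          omega
        rw [h7, h8]
    rw [gowersSquares_succ s hfin, tsum_eq_sum (s := K.image fun k => (q : ℤ) * k)
      (fun k hk => by rw [h1 k hk, gowersSquares_zero]),
      sum_image (fun a _ b _ h => mul_left_cancel₀ hq'.ne' h), sum_congr rfl h2, ← mul_sum, gU,
      Fintype.expect_eq_sum_div_card, ZMod.card]
    have h9 : ∑ h : ZMod n, gU s (gDiff h fun t : ZMod n => f (u + q * t.val)) =
        ∑ k ∈ K, gU s (gDiff (k : ZMod n) fun t : ZMod n => f (u + q * t.val)) := by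
      rw [← sum_subset (subset_univ (K.image fun k : ℤ => (k : ZMod n))), sum_image]
      · intro a ha b hb h
        simp only [hK, mem_coe, mem_Ioo] at ha hb
        have h3 : (n : ℤ) ∣ b - a := (ZMod.intCast_eq_intCast_iff_dvd_sub _ _ _).1 h
        have h4 := Int.eq_zero_of_abs_lt_dvd h3 (by rw [abs_lt]; omega)
        omega
      · intro h _ hh
        have h3 : (gDiff h fun t : ZMod n => f (u + q * t.val)) = fun _ => 0 := by
          funext t
          by_contra hne
          have hne' : f (u + q * (t + h).val) * conj (f (u + q * t.val)) ≠ 0 := hne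
          have h4 := hbound f hf _ (left_ne_zero_of_mul hne')
          have h5 := hbound f hf t.val fun h0 => right_ne_zero_of_mul hne' (by rw [h0, map_zero])
          refine hh (mem_image.2 ⟨(t + h).val - t.val, ?_, ?_⟩)
          · rw [hK, mem_Ioo]; omega
          · push_cast
            simp
        rw [h3, gU_zero_fun]
    rw [h9]
    field_simp
    ring

end IntegerGowers

/-! ### Applying box control in each residue class. -/

section CyclicControl

open Finset

/-- The substitution `c = a + b` puts the pairs in the order used by the box control: first the
common direction `c`, then `a` with `b = c - a`. -/
theorem sum_goodShifts (M H : ℕ) (F : ℤ → ℤ → ℝ) :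
    ∑ s ∈ goodShifts M H, F s.1 s.2 =
      ∑ c ∈ Ioo (-2 * M : ℤ) (2 * M) with (H : ℤ) ≤ |c|,
        ∑ a ∈ Ioo (-M : ℤ) M with c - a ∈ Ioo (-M : ℤ) M ∧ (H : ℤ) ≤ |a| ∧ (H : ℤ) ≤ |c - a|,
          F a (c - a) := by
  rw [sum_sigma']
  refine sum_nbij' (fun s => ⟨s.1 + s.2, s.1⟩) (fun p => (p.2, p.1 - p.2)) ?_ ?_ ?_ ?_ ?_
  · rintro ⟨a, b⟩ h
    simp only [goodShifts, mem_filter, mem_product, mem_Ioo] at h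
    simp only [mem_sigma, mem_filter, mem_Ioo, add_sub_cancel_left]
    omega
  · rintro ⟨c, a⟩ h
    simp only [mem_sigma, mem_filter, mem_Ioo] at h
    simp only [goodShifts, mem_filter, mem_product, mem_Ioo, add_sub_cancel]
    omega
  · rintro ⟨a, b⟩ _
    simp
  · rintro ⟨c, a⟩ _
    simp
  · rintro ⟨a, b⟩ _
    simp

/-- Representatives run over `1, …, D` and `ZMod.val` over `0, …, D - 1`; the only mismatch is at
`D`, where `f` vanishes on both sides. -/
theorem cast_residue_eq {q n D : ℕ} [NeZero n] [NeZero D] (hD : D = q * n) {f : ℤ → ℂ}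
    (h0 : f 0 = 0) (h1 : f D = 0) {u : ℤ} (hu : u ∈ Icc 1 (q : ℤ)) (t : ZMod n) :
    f ((u + q * t.val : ℤ) : ZMod D).val = f (u + q * t.val) := by
  rw [mem_Icc] at hu
  have ht : (t.val : ℤ) + 1 ≤ n := by exact_mod_cast ZMod.val_lt t
  have hD' : (D : ℤ) = q * n := by rw [hD]; push_cast; rfl
  have h2 := mul_le_mul_of_nonneg_left ht (by omega : (0 : ℤ) ≤ q)
  have h3 : 0 ≤ (q : ℤ) * t.val := by positivity
  have h4 : u + q * t.val ≤ D := by linarith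
  rw [ZMod.val_intCast]
  rcases h4.lt_or_eq with h | h
  · rw [Int.emod_eq_of_lt (by linarith) h]
  · rw [h, Int.emod_self, h0, h1]

theorem cubeCorrelation_residue {q n D : ℕ} [NeZero n] [NeZero D] (hD : D = q * n) (H : ℕ)
    (a b : ℤ) {f : ℤ → ℂ} (h0 : f 0 = 0) (h1 : f D = 0) {u : ℤ} (hu : u ∈ Icc 1 (q : ℤ))
    (w₀ w₁ w₂ : ZMod D → ℤ → ℤ → ℂ) (t : ZMod n) :
    cubeCorrelation H q a b (fun x : ZMod D => f x.val) w₀ w₁ w₂ ((u + q * t.val : ℤ) : ZMod D) =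
      𝔼 i ∈ Ico (0 : ℤ) H, 𝔼 j ∈ Ico (0 : ℤ) H, 𝔼 k ∈ Ico (0 : ℤ) H,
        (fun t : ZMod n => f (u + q * t.val))
            (t + dilate n a i + dilate n b j + dilate n (a + b) k) *
          w₀ ((u + q * t.val : ℤ) : ZMod D) i j * w₁ ((u + q * t.val : ℤ) : ZMod D) i k *
          w₂ ((u + q * t.val : ℤ) : ZMod D) j k := by
  unfold cubeCorrelation
  refine expect_congr rfl fun i _ => expect_congr rfl fun j _ => expect_congr rfl fun k _ => ?_
  congr 3
  have h2 : t + dilate n a i + dilate n b j + dilate n (a + b) k =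
      t + ((2 * (a * i + b * j + (a + b) * k) : ℤ) : ZMod n) := by
    simp only [dilate_apply]
    push_cast
    ring
  dsimp only
  rw [h2, ← cast_residue_eq hD h0 h1 hu]
  have h3 : ((u + q * (t + ((2 * (a * i + b * j + (a + b) * k) : ℤ) : ZMod n)).val : ℤ) : ZMod D) =
      ((u + q * t.val : ℤ) : ZMod D) +
        ((2 * q * (a * i + b * j + (a + b) * k) : ℤ) : ZMod D) := by
    rw [Int.cast_add, cast_mul_val_add hD, ← Int.cast_add, ← Int.cast_add, ← Int.cast_add]
    congr 1
    ring
  rw [h3]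

/-- For each `p` and each class `u` the three-dimensional theorem applies with its own density `S p
u`. These average to at least `η`, and convexity passes to their powers of exponent 2560. -/
theorem cyclic_control : ∃ κ : ℝ, 0 < κ ∧ ∀ (n H M q D : ℕ) [NeZero n] [NeZero D], 0 < H →
    H ≤ M → 16 * M * H ≤ n → D = q * n → ∀ (f : ℤ → ℂ), OneBounded f → f 0 = 0 → f D = 0 →
    ∀ w₀ w₁ w₂ : ℤ → ℤ → ℤ → ZMod D → ℤ → ℤ → ℂ, (∀ a b p x i j, ‖w₀ a b p x i j‖ ≤ 1) →
      (∀ a b p x i j, ‖w₁ a b p x i j‖ ≤ 1) → (∀ a b p x i j, ‖w₂ a b p x i j‖ ≤ 1) →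
    ∀ η : ℝ, 0 ≤ η →
    η * (8 * (M : ℝ) ^ 2) * M ≤ ∑ s ∈ goodShifts M H, ∑ p ∈ Icc 1 (M : ℤ),
      ‖𝔼 x, cubeCorrelation H q s.1 s.2 (fun x : ZMod D => f x.val)
        (w₀ s.1 s.2 p) (w₁ s.1 s.2 p) (w₂ s.1 s.2 p) x‖ →
    κ * η ^ 2560 ≤ (n / (H : ℝ) ^ 2) ^ 69 *
      𝔼 u ∈ Icc 1 (q : ℤ), gU 4 (fun t : ZMod n => f (u + q * t.val)) := by
  obtain ⟨κ, hκ, hctrl⟩ := three_dimensional_control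
  refine ⟨κ, hκ, ?_⟩
  intro n H M q D _ _ hH hHM hn hD f hf hf0 hfD w₀ w₁ w₂ hw₀ hw₁ hw₂ η hη hsum
  have hM : 0 < M := hH.trans_le hHM
  have hM' : (0 : ℝ) < M := by exact_mod_cast hM
  set P := Icc 1 (M : ℤ) with hP
  set U := Icc 1 (q : ℤ) with hU
  have hPne : P.Nonempty := ⟨1, by rw [hP, mem_Icc]; omega⟩
  have hPcard : (#P : ℝ) = M := by rw [hP, Int.card_Icc]; simp
  set Q : ℝ := n / (H : ℝ) ^ 2 with hQ
  set Z : ℤ → ℤ → ℤ → ℤ → ℝ := fun u p a b =>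
    ‖𝔼 t : ZMod n, cubeCorrelation H q a b (fun x : ZMod D => f x.val)
      (w₀ a b p) (w₁ a b p) (w₂ a b p) ((u + q * t.val : ℤ) : ZMod D)‖ with hZ
  set S : ℤ → ℤ → ℝ := fun p u => (∑ s ∈ goodShifts M H, Z u p s.1 s.2) / (8 * (M : ℝ) ^ 2) with hS
  have hS0 : ∀ p u, 0 ≤ S p u := fun p u =>
    div_nonneg (sum_nonneg fun _ _ => norm_nonneg _) (by positivity)
  have hstep : ∀ p, ∀ u ∈ U,
      κ * S p u ^ 2560 ≤ Q ^ 69 * gU 4 (fun t : ZMod n => f (u + q * t.val)) := by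
    intro p u hu
    refine hctrl n H M hH hHM hn {c ∈ Ioo (-2 * M : ℤ) (2 * M) | (H : ℤ) ≤ |c|}
      (fun c => {a ∈ Ioo (-M : ℤ) M |
        c - a ∈ Ioo (-M : ℤ) M ∧ (H : ℤ) ≤ |a| ∧ (H : ℤ) ≤ |c - a|}) ?_ ?_
      (fun t : ZMod n => f (u + q * t.val))
      (fun c a t => w₀ a (c - a) p ((u + q * t.val : ℤ) : ZMod D))
      (fun c a t => w₁ a (c - a) p ((u + q * t.val : ℤ) : ZMod D))
      (fun c a t => w₂ a (c - a) p ((u + q * t.val : ℤ) : ZMod D))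
      (fun t => hf _) (fun _ _ _ => hw₀ _ _ _ _) (fun _ _ _ => hw₁ _ _ _ _)
      (fun _ _ _ => hw₂ _ _ _ _) (S p u) (hS0 p u) ?_
    · intro c hc
      rw [mem_filter, mem_Ioo] at hc
      refine ⟨hc.2, abs_le.2 ⟨by omega, by omega⟩⟩
    · intro c _ a ha
      rw [mem_filter, mem_Ioo, mem_Ioo] at ha
      exact ⟨⟨ha.2.2.1, abs_le.2 ⟨by omega, by omega⟩⟩, ha.2.2.2, abs_le.2 ⟨by omega, by omega⟩⟩
    · simp only [hS]
      rw [div_mul_cancel₀ _ (by positivity), sum_goodShifts M H (Z u p)]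
      refine le_of_eq (sum_congr rfl fun c _ => sum_congr rfl fun a _ => ?_)
      refine congrArg norm (expect_congr rfl fun t _ => ?_)
      refine (cubeCorrelation_residue hD H a (c - a) hf0 hfD hu _ _ _ t).trans ?_
      rw [add_sub_cancel]
  have hηS : η ≤ 𝔼 p ∈ P, 𝔼 u ∈ U, S p u := by
    have h1 : ∑ s ∈ goodShifts M H, ∑ p ∈ P, ‖𝔼 x, cubeCorrelation H q s.1 s.2
        (fun x : ZMod D => f x.val) (w₀ s.1 s.2 p) (w₁ s.1 s.2 p) (w₂ s.1 s.2 p) x‖ ≤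
        ∑ p ∈ P, 𝔼 u ∈ U, ∑ s ∈ goodShifts M H, Z u p s.1 s.2 := by
      rw [sum_comm]
      refine sum_le_sum fun p _ => ?_
      rw [expect_sum_comm]
      refine sum_le_sum fun s _ => ?_
      rw [expect_residue_classes hD]
      exact RCLike.norm_expect_le (K := ℂ)
    have h2 := hsum.trans h1
    rw [expect_eq_sum_div_card, hPcard, le_div_iff₀ hM']
    have h3 : ∑ p ∈ P, 𝔼 u ∈ U, S p u =
        (∑ p ∈ P, 𝔼 u ∈ U, ∑ s ∈ goodShifts M H, Z u p s.1 s.2) / (8 * (M : ℝ) ^ 2) := by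
      rw [sum_div]
      exact sum_congr rfl fun p _ => by rw [expect_div]
    rw [h3, le_div_iff₀ (by positivity)]
    linarith
  have h1 : η ^ 2560 ≤ 𝔼 p ∈ P, 𝔼 u ∈ U, S p u ^ 2560 :=
    calc η ^ 2560 ≤ (𝔼 p ∈ P, 𝔼 u ∈ U, S p u) ^ 2560 := pow_le_pow_left₀ hη hηS _
      _ ≤ 𝔼 p ∈ P, (𝔼 u ∈ U, S p u) ^ 2560 :=
        expect_pow_le _ _ (fun p _ => expect_nonneg fun u _ => hS0 p u) _ (by norm_num)
      _ ≤ _ := expect_le_expect fun p _ =>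
        expect_pow_le _ _ (fun u _ => hS0 p u) _ (by norm_num)
  calc κ * η ^ 2560 ≤ κ * 𝔼 p ∈ P, 𝔼 u ∈ U, S p u ^ 2560 := mul_le_mul_of_nonneg_left h1 hκ.le
    _ = 𝔼 p ∈ P, 𝔼 u ∈ U, κ * S p u ^ 2560 := by simp only [mul_expect]
    _ ≤ 𝔼 p ∈ P, 𝔼 u ∈ U, Q ^ 69 * gU 4 (fun t : ZMod n => f (u + q * t.val)) :=
      expect_le_expect fun p _ => expect_le_expect fun u hu => hstep p u hu
    _ = _ := by rw [expect_const hPne, mul_expect]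

end CyclicControl

/-! ### From the integers to cyclic groups and back. -/

section Transfer

open Finset

theorem val_add_intCast {D : ℕ} [NeZero D] (x : ZMod D) (m : ℤ) (h0 : 0 ≤ (x.val : ℤ) + m)
    (h1 : (x.val : ℤ) + m < D) : ((x + (m : ZMod D)).val : ℤ) = x.val + m := by
  have h : x + (m : ZMod D) = ((x.val + m : ℤ) : ZMod D) := by simp
  rw [h, ZMod.val_intCast, Int.emod_eq_of_lt h0 h1]

theorem SupportedIn.bounds {N : ℕ} {f : ℤ → ℂ} (hf : SupportedIn N f) {x : ℤ} (hx : f x ≠ 0) :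
    1 ≤ x ∧ x ≤ N := by
  have := hf hx
  simpa [intInterval] using this

theorem countingOp_eq_expect {N q M D : ℕ} [NeZero D] (hq : 0 < q)
    (hM : M = ⌊Real.sqrt ((N : ℝ) / q)⌋₊) (hMN : q * M ^ 2 ≤ N) (hD : 2 * N < D) {f₀ : ℤ → ℂ}
    (f₁ f₂ : ℤ → ℂ) (hf₀ : SupportedIn N f₀) :
    countingOp N q f₀ f₁ f₂ = D * 𝔼 x : ZMod D, ∑ y ∈ Icc 1 (M : ℤ),
      f₀ x.val * f₁ (x + (y : ZMod D)).val * f₂ (x + ((q * y ^ 2 : ℤ) : ZMod D)).val := by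
  have hint : intInterval (Real.sqrt ((N : ℝ) / q)) = Icc 1 (M : ℤ) := by
    rw [intInterval, hM, Int.natCast_floor_eq_floor (Real.sqrt_nonneg _)]
  have hDne : (D : ℂ) ≠ 0 := by exact_mod_cast NeZero.ne D
  rw [countingOp, hint, Fintype.expect_eq_sum_div_card, ZMod.card, mul_div_cancel₀ _ hDne,
    tsum_eq_sum' (s := univ.image fun x : ZMod D => (x.val : ℤ)),
    sum_image fun x _ y _ h => ZMod.val_injective D (by exact_mod_cast h)]
  · refine sum_congr rfl fun x _ => sum_congr rfl fun y hy => ?_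
    by_cases hx : f₀ x.val = 0
    · rw [hx]; ring
    have hb := hf₀.bounds hx
    rw [mem_Icc] at hy
    have hq' : (1 : ℤ) ≤ q := by exact_mod_cast hq
    have hMN' : (q : ℤ) * M ^ 2 ≤ N := by exact_mod_cast hMN
    have h1 : (q : ℤ) * y ^ 2 ≤ q * M ^ 2 :=
      mul_le_mul_of_nonneg_left (pow_le_pow_left₀ (by omega) hy.2 2) (by omega)
    -- Both shifts are at most `q M² ≤ N`, so all points stay in `[1, 2N]`, below `D`.
    have h2 : y ≤ q * y ^ 2 := by nlinarith
    rw [val_add_intCast x y (by omega) (by omega),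
      val_add_intCast x (q * y ^ 2) (by nlinarith) (by linarith)]
  · intro x hx
    have hx0 : f₀ x ≠ 0 := fun h => hx (by simp [h])
    have hb := hf₀.bounds hx0
    refine mem_coe.2 (mem_image.2 ⟨(x : ZMod D), mem_univ _, ?_⟩)
    rw [ZMod.val_intCast, Int.emod_eq_of_lt (by omega) (by omega)]

theorem norm_countingOp_le (N q : ℕ) {f₀ f₁ f₂ : ℤ → ℂ} (h₀ : OneBounded f₀) (h₁ : OneBounded f₁)
    (h₂ : OneBounded f₂) (hf₀ : SupportedIn N f₀) :
    ‖countingOp N q f₀ f₁ f₂‖ ≤ N * Real.sqrt ((N : ℝ) / q) := by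
  rw [countingOp, tsum_eq_sum' (s := Icc 1 (N : ℤ))]
  · have hterm : ∀ x y, ‖f₀ x * f₁ (x + y) * f₂ (x + (q : ℤ) * y ^ 2)‖ ≤ 1 := fun x y => by
      rw [norm_mul, norm_mul]
      exact mul_le_one₀ (mul_le_one₀ (h₀ _) (norm_nonneg _) (h₁ _)) (norm_nonneg _) (h₂ _)
    have hcard : (#(intInterval (Real.sqrt ((N : ℝ) / q))) : ℝ) ≤ Real.sqrt ((N : ℝ) / q) := by
      rw [intInterval, Int.card_Icc, add_sub_cancel_right, Int.floor_toNat]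
      exact Nat.floor_le (Real.sqrt_nonneg _)
    refine (norm_sum_le _ _).trans ?_
    calc _ ≤ ∑ x ∈ Icc 1 (N : ℤ), Real.sqrt ((N : ℝ) / q) := by
          refine sum_le_sum fun x _ => (norm_sum_le _ _).trans ?_
          refine (sum_le_sum fun y _ => hterm x y).trans ?_
          rw [sum_const, nsmul_eq_mul, mul_one]
          exact hcard
      _ = _ := by rw [sum_const, nsmul_eq_mul, Int.card_Icc]; simp
  · intro x hx
    have hx0 : f₀ x ≠ 0 := fun h => hx (by simp [h])
    exact mem_coe.2 (mem_Icc.2 (hf₀.bounds hx0))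

theorem gowersNormOn_five_pow {N n q : ℕ} [NeZero n] (hn : 2 * (N / q + 1) ≤ n)
    {f : ℤ → ℂ} (hf : SupportedIn N f) {u : ℤ} (hu : u ∈ Icc 1 (q : ℤ)) :
    gowersNormOn 5 (progression u q) f ^ (2 ^ 5) =
      (n : ℝ) ^ 6 * gU 4 (fun t : ZMod n => f (u + q * t.val)) := by
  rw [mem_Icc] at hu
  have hq : 0 < q := by omega
  set g := (progression u q).indicator f with hg
  have hgf : ∀ x, g x ≠ 0 → f x ≠ 0 ∧ x ∈ progression u q := fun x hx => by
    have h1 := Set.mem_of_indicator_ne_zero hx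
    rw [hg, Set.indicator_of_mem h1] at hx
    exact ⟨hx, h1⟩
  have hfin : (Function.support g).Finite :=
    (finite_toSet (intInterval N)).subset fun x hx => hf (hgf x hx).1
  have h1 : gowersNorm 5 g ^ (2 ^ 5) = gowersSquares 4 g := by
    have := (gowersNorm_pow (s := 5) (by norm_num) hfin).trans (gowersSum_succ 4 hfin)
    exact_mod_cast this
  rw [gowersNormOn, ← hg, h1, gowersSquares_eq_gU (ℓ := N / q + 1) hq hn u 4]
  · congr 2
    funext t
    exact Set.indicator_of_mem (Set.mem_range_self (t.val : ℤ)) f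
  · intro x hx
    obtain ⟨hfx, t, rfl⟩ := hgf x hx
    have hb := hf.bounds hfx
    have hq' : (0 : ℤ) < q := by exact_mod_cast hq
    dsimp only at hb
    refine ⟨t, ⟨?_, ?_⟩, rfl⟩
    · by_contra h
      have : (q : ℤ) * t ≤ q * (-1) := mul_le_mul_of_nonneg_left (by omega) hq'.le
      omega
    · have : t ≤ N / q := (Int.le_ediv_iff_mul_le hq').2 (by rw [mul_comm]; omega)
      push_cast
      omega

end Transfer

/-! ### Choice of parameters and conclusion. -/

section Main

open Finset

/-- The parameters of the argument: the length `M` of the progression and the side `H` of the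
boxes, for a counting operator of density `δ`. -/
theorem exists_box_side {N q M : ℕ} {δ : ℝ} (hq : 0 < q) (hδ : 0 < δ) (hδ1 : δ ≤ 1)
    (hN : 2 ^ 50 * (q : ℝ) * δ ^ (-72 : ℤ) ≤ N) (hM : M = ⌊Real.sqrt ((N : ℝ) / q)⌋₊) :
    0 < M ∧ q * M ^ 2 ≤ N ∧ N < 4 * (q * M ^ 2) ∧ ∃ H : ℕ, 0 < H ∧ H ≤ M ∧
      (H : ℝ) ≤ δ ^ 4 / 2 ^ 24 * M ∧ δ ^ 4 / 2 ^ 25 * M ≤ H := by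
  have hq' : (0 : ℝ) < q := by exact_mod_cast hq
  set r := Real.sqrt ((N : ℝ) / q) with hr
  have hr0 : 0 ≤ r := Real.sqrt_nonneg _
  have hr2 : r ^ 2 = N / q := Real.sq_sqrt (by positivity)
  have hr2' : q * r ^ 2 = N := by rw [hr2]; field_simp
  have hδ36 : δ ^ 36 ≤ δ ^ 4 := pow_le_pow_of_le_one hδ.le hδ1 (by norm_num)
  have hδ4 : δ ^ 4 ≤ 1 := pow_le_one₀ hδ.le hδ1
  have hbig : 2 ^ 25 ≤ δ ^ 36 * r := by
    refine le_of_sq_le_sq ?_ (by positivity)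
    rw [zpow_neg, ← div_eq_mul_inv, div_le_iff₀ (by positivity)] at hN
    have h1 : (2 : ℝ) ^ 50 * q ≤ δ ^ 72 * r ^ 2 * q :=
      hN.trans_eq (by rw [← hr2']; norm_cast; ring)
    have h2 := le_of_mul_le_mul_right h1 hq'
    calc ((2 : ℝ) ^ 25) ^ 2 = 2 ^ 50 := by norm_num
      _ ≤ δ ^ 72 * r ^ 2 := h2
      _ = _ := by ring
  have hbig4 : 2 ^ 25 ≤ δ ^ 4 * r := hbig.trans (mul_le_mul_of_nonneg_right hδ36 hr0)
  have hr1 : 1 ≤ r := by nlinarith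
  have hM1 : 1 ≤ M := by
    rw [hM]
    exact Nat.le_floor (by exact_mod_cast hr1)
  have hM1' : (1 : ℝ) ≤ M := by exact_mod_cast hM1
  have hMr : (M : ℝ) ≤ r := by rw [hM]; exact Nat.floor_le hr0
  have hrM : r < M + 1 := by rw [hM]; exact Nat.lt_floor_add_one r
  have hr2M : r < 2 * M := by linarith
  refine ⟨hM1, ?_, ?_, ⌊δ ^ 4 / 2 ^ 24 * M⌋₊, ?_⟩
  · have h : (q : ℝ) * M ^ 2 ≤ N := by
      rw [← hr2']
      exact mul_le_mul_of_nonneg_left (pow_le_pow_left₀ (by positivity) hMr 2) hq'.le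
    exact_mod_cast h
  · have h : (N : ℝ) < 4 * (q * M ^ 2) := by
      have h1 : r ^ 2 < (2 * M) ^ 2 := pow_lt_pow_left₀ hr2M hr0 (by norm_num)
      rw [← hr2']
      calc (q : ℝ) * r ^ 2 < q * (2 * M) ^ 2 := mul_lt_mul_of_pos_left h1 hq'
        _ = _ := by ring
    exact_mod_cast h
  -- This follows from `2^25 ≤ δ⁴ r` and `r < 2M`; being at least 1, the quantity loses at most a
  -- factor 2 when rounded down.
  · have hηM : 1 ≤ δ ^ 4 / 2 ^ 24 * M := by
      have : δ ^ 4 * r ≤ δ ^ 4 * (2 * M) := mul_le_mul_of_nonneg_left hr2M.le (by positivity)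
      linarith
    have hH1 : 1 ≤ ⌊δ ^ 4 / 2 ^ 24 * M⌋₊ := Nat.le_floor (by exact_mod_cast hηM)
    have hH1' : (1 : ℝ) ≤ ⌊δ ^ 4 / 2 ^ 24 * M⌋₊ := by exact_mod_cast hH1
    have hle : (⌊δ ^ 4 / 2 ^ 24 * M⌋₊ : ℝ) ≤ δ ^ 4 / 2 ^ 24 * M := Nat.floor_le (by positivity)
    have hlt := Nat.lt_floor_add_one (δ ^ 4 / 2 ^ 24 * M)
    refine ⟨hH1, ?_, hle, by linarith⟩
    have : (⌊δ ^ 4 / 2 ^ 24 * M⌋₊ : ℝ) ≤ M := hle.trans (by nlinarith)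
    exact_mod_cast this

/-- The inverse theorem, with an explicit polynomial dependence on the density. -/
theorem gU_control : ∃ κ : ℝ, 0 < κ ∧ ∀ (N q M n : ℕ) [NeZero n] (δ : ℝ) (f₀ f₁ f₂ : ℤ → ℂ),
    0 < q → 0 < δ → δ ≤ 1 → OneBounded f₀ → OneBounded f₁ → OneBounded f₂ → SupportedIn N f₀ →
    SupportedIn N f₂ → 2 ^ 50 * (q : ℝ) * δ ^ (-72 : ℤ) ≤ N →
    M = ⌊Real.sqrt ((N : ℝ) / q)⌋₊ → n = 16 * M ^ 2 →
    δ * N * Real.sqrt ((N : ℝ) / q) ≤ ‖countingOp N q f₀ f₁ f₂‖ →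
    κ * (δ ^ 4 / 2 ^ 21) ^ 2560 * (δ ^ 8) ^ 69 ≤ (2 ^ 54) ^ 69 *
      𝔼 u ∈ Icc 1 (q : ℤ), gU 4 (fun t : ZMod n => f₂ (u + q * t.val)) := by
  obtain ⟨κ, hκ, hctrl⟩ := cyclic_control
  refine ⟨κ, hκ, ?_⟩
  intro N q M n _ δ f₀ f₁ f₂ hq hδ hδ1 h₀ h₁ h₂ hs₀ hs₂ hN hM hn hΛ
  obtain ⟨hM0, hMN, hNM, H, hH0, hHM, hHle, hleH⟩ := exists_box_side hq hδ hδ1 hN hM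
  have hq' : (0 : ℝ) < q := by exact_mod_cast hq
  have hM' : (0 : ℝ) < M := by exact_mod_cast hM0
  have hH' : (0 : ℝ) < H := by exact_mod_cast hH0
  have hMN' : (q : ℝ) * M ^ 2 ≤ N := by exact_mod_cast hMN
  have hN0 : (0 : ℝ) < N := lt_of_lt_of_le (by positivity) hMN'
  set D := q * n with hD
  have : NeZero D := ⟨Nat.mul_ne_zero hq.ne' (NeZero.ne n)⟩
  have hDN : 2 * N < D := by rw [hD, hn]; nlinarith
  have hDN' : (D : ℝ) ≤ 16 * N := by
    rw [hD, hn]; push_cast; linarith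
  have hzero : ∀ x, ¬ (1 ≤ x ∧ x ≤ (N : ℤ)) → f₂ x = 0 := fun x hx => by
    by_contra h
    exact hx (hs₂.bounds h)
  obtain ⟨w₀, w₁, w₂, hw₀, hw₁, hw₂, hw⟩ := exists_cubeCorrelation_of_quadratic (D := D) M H hH0 q
    (f₀ := fun x => f₀ x.val) (f₁ := fun x => f₁ x.val) (f₂ := fun x => f₂ x.val)
    (fun x => h₀ _) (fun x => h₁ _) (fun x => h₂ _)
  set S := ∑ s ∈ goodShifts M H, ∑ p ∈ Icc 1 (M : ℤ), ‖𝔼 x, cubeCorrelation H q s.1 s.2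
    (fun x : ZMod D => f₂ x.val) (w₀ s.1 s.2 p) (w₁ s.1 s.2 p) (w₂ s.1 s.2 p) x‖ with hS
  rw [countingOp_eq_expect hq hM hMN hDN f₁ f₂ hs₀, norm_mul, Complex.norm_natCast] at hΛ
  set E := ‖𝔼 x : ZMod D, ∑ y ∈ Icc 1 (M : ℤ),
      f₀ x.val * f₁ (x + (y : ZMod D)).val * f₂ (x + ((q * y ^ 2 : ℤ) : ZMod D)).val‖ with hE
  have hE1 : δ * M / 16 ≤ E := by
    have hMr : (M : ℝ) ≤ Real.sqrt ((N : ℝ) / q) := by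
      rw [hM]; exact Nat.floor_le (Real.sqrt_nonneg _)
    have h1 : δ * N * M ≤ 16 * N * E :=
      (mul_le_mul_of_nonneg_left hMr (by positivity)).trans
        (hΛ.trans (mul_le_mul_of_nonneg_right hDN' (norm_nonneg _)))
    have h2 : N * (δ * M) ≤ N * (16 * E) := by linarith
    have := le_of_mul_le_mul_left h2 hN0
    linarith
  -- Fourth powers of `hE1` leave `δ⁴ M³ / 2^17` for `S` plus the error. The error is at most `36 δ⁴
  -- M³ / 2^24`, and `128 - 36 ≥ 64` leaves `δ⁴ M³ / 2^18`.
  have hSlow : δ ^ 4 / 2 ^ 21 * (8 * (M : ℝ) ^ 2) * M ≤ S := by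
    have h1 : (δ * M / 16) ^ 4 ≤ 2 * M * (S + 36 * H * (M : ℝ) ^ 2) :=
      (pow_le_pow_left₀ (by positivity) hE1 4).trans hw
    have h2 : 2 * M * (δ ^ 4 * M ^ 3 / 2 ^ 17) ≤ 2 * M * (S + 36 * H * (M : ℝ) ^ 2) :=
      le_trans (le_of_eq (by ring)) h1
    have h3 := le_of_mul_le_mul_left h2 (by positivity)
    have h4 : (H : ℝ) * M ^ 2 ≤ δ ^ 4 / 2 ^ 24 * M * M ^ 2 :=
      mul_le_mul_of_nonneg_right hHle (by positivity)
    have h5 : 0 ≤ δ ^ 4 * (M : ℝ) ^ 3 := by positivity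
    nlinarith
  have hmain := hctrl n H M q D hH0 hHM (by rw [hn]; nlinarith) rfl f₂ h₂
    (hzero 0 (by omega)) (hzero D (by omega)) w₀ w₁ w₂ hw₀ hw₁ hw₂ (δ ^ 4 / 2 ^ 21)
    (by positivity) hSlow
  set G := 𝔼 u ∈ Icc 1 (q : ℤ), gU 4 (fun t : ZMod n => f₂ (u + q * t.val)) with hG
  have hG0 : 0 ≤ G := expect_nonneg fun u _ => gU_nonneg _ _
  -- Here `n = 16 M²` and `H ≥ δ⁴ M / 2^25`, and `16 · 2^50 = 2^54`.
  have hQ : (n : ℝ) / (H : ℝ) ^ 2 * δ ^ 8 ≤ 2 ^ 54 := by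
    rw [div_mul_eq_mul_div, div_le_iff₀ (by positivity), hn]
    have h1 := pow_le_pow_left₀ (by positivity) hleH 2
    push_cast
    nlinarith
  calc κ * (δ ^ 4 / 2 ^ 21) ^ 2560 * (δ ^ 8) ^ 69
      ≤ (n / (H : ℝ) ^ 2) ^ 69 * G * (δ ^ 8) ^ 69 :=
        mul_le_mul_of_nonneg_right hmain (by positivity)
    _ = (n / (H : ℝ) ^ 2 * δ ^ 8) ^ 69 * G := by rw [mul_pow _ (δ ^ 8)]; ring
    _ ≤ (2 ^ 54) ^ 69 * G :=
        mul_le_mul_of_nonneg_right (pow_le_pow_left₀ (by positivity) hQ _) hG0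

/-- The exponent is `10792 = 4 · 2560 + 8 · 69`; since `δ ≤ 1`, any larger one is allowed. -/
theorem le_of_control_le {κ δ A B : ℝ} {K : ℕ} (hκ : 0 < κ) (hδ : 0 < δ) (hδ1 : δ ≤ 1)
    (hA : 0 < A) (hB : 0 < B) (hK : 10792 ≤ K) {G : ℝ}
    (h : κ * (δ ^ 4 / A) ^ 2560 * (δ ^ 8) ^ 69 ≤ B * G) :
    κ / (A ^ 2560 * B) * δ ^ K ≤ G := by
  have h1 : δ ^ K ≤ δ ^ 10792 := pow_le_pow_of_le_one hδ.le hδ1 hK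
  have h2 : κ / (A ^ 2560 * B) * δ ^ 10792 = κ * (δ ^ 4 / A) ^ 2560 * (δ ^ 8) ^ 69 / B := by
    rw [div_pow, ← pow_mul, ← pow_mul, mul_div_assoc', div_mul_eq_mul_div, div_mul_eq_mul_div,
      div_div, mul_assoc, ← pow_add]
  calc _ ≤ κ / (A ^ 2560 * B) * δ ^ 10792 := mul_le_mul_of_nonneg_left h1 (by positivity)
    _ ≤ G := by rw [h2, div_le_iff₀ hB]; linarith

/-- Control by Gowers norms, with an arbitrary sufficiently large exponent. -/
theorem gowersNormOn_control_of_exponent_le (K : ℕ) (hK : 10792 ≤ K) :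
    ∃ c C : ℝ, 0 < c ∧ 0 < C ∧
      ∀ (N q : ℕ) (δ : ℝ) (f₀ f₁ f₂ : ℤ → ℂ),
        0 < q → 0 < δ →
        OneBounded f₀ → OneBounded f₁ →
        OneBounded f₂ →
        SupportedIn N f₀ → SupportedIn N f₁ →
        SupportedIn N f₂ →
        C * (q : ℝ) * δ ^ (-72 : ℤ) ≤ (N : ℝ) →
        δ * (N : ℝ) * Real.sqrt ((N : ℝ) / (q : ℝ)) ≤
          ‖countingOp N q f₀ f₁ f₂‖ →
        c * δ ^ K * ((N : ℝ) / (q : ℝ)) ^ 6 ≤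
          𝔼 u ∈ intInterval (q : ℝ),
            gowersNormOn 5 (progression u q) f₂ ^ (2 ^ 5) := by
  obtain ⟨κ, hκ, hctrl⟩ := gU_control
  refine ⟨κ / ((2 ^ 21) ^ 2560 * (2 ^ 54) ^ 69), 2 ^ 50, by positivity, by positivity, ?_⟩
  intro N q δ f₀ f₁ f₂ hq hδ h₀ h₁ h₂ hs₀ _ hs₂ hN hΛ
  have hq' : (0 : ℝ) < q := by exact_mod_cast hq
  have hN0 : (0 : ℝ) < N := lt_of_lt_of_le (by positivity) hN
  -- The counting operator is trivially at most `N (N/q)^{1/2}`.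
  have hδ1 : δ ≤ 1 := by
    have h1 := hΛ.trans (norm_countingOp_le N q h₀ h₁ h₂ hs₀)
    have h2 : 0 < (N : ℝ) * Real.sqrt ((N : ℝ) / q) := by positivity
    rw [mul_assoc] at h1
    exact (mul_le_iff_le_one_left h2).1 h1
  obtain ⟨M, hM⟩ : ∃ M : ℕ, M = ⌊Real.sqrt ((N : ℝ) / q)⌋₊ := ⟨_, rfl⟩
  obtain ⟨hM0, -, hNM, -⟩ := exists_box_side hq hδ hδ1 hN hM
  obtain ⟨n, hn⟩ : ∃ n : ℕ, n = 16 * M ^ 2 := ⟨_, rfl⟩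
  have : NeZero n := ⟨by rw [hn]; positivity⟩
  have hmain := le_of_control_le hκ hδ hδ1 (by positivity)
    (by positivity) hK
    (hctrl N q M n δ f₀ f₁ f₂ hq hδ hδ1 h₀ h₁ h₂ hs₀ hs₂ hN hM hn hΛ)
  have hnN : 2 * (N / q + 1) ≤ n := by
    have h1 : N / q < 4 * M ^ 2 := (Nat.div_lt_iff_lt_mul hq).2 (by linarith)
    omega
  have hnq : (N : ℝ) / q ≤ n := by
    have h1 : (N : ℝ) < 4 * (q * M ^ 2) := by exact_mod_cast hNM
    rw [div_le_iff₀ hq', hn]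
    push_cast
    nlinarith
  have hint : intInterval (q : ℝ) = Finset.Icc 1 (q : ℤ) := by
    simp [intInterval]
  rw [hint, Finset.expect_congr rfl fun u hu => gowersNormOn_five_pow hnN hs₂ hu,
    ← Finset.mul_expect, mul_comm ((n : ℝ) ^ 6)]
  exact mul_le_mul hmain (pow_le_pow_left₀ (by positivity) hnq 6) (by positivity)
    (Finset.expect_nonneg fun u _ => gU_nonneg _ _)

end Main

end NonlinearRoth

theorem theorem5p2 :
    ∃ c C : ℝ, 0 < c ∧ 0 < C ∧
      ∀ (N q : ℕ) (δ : ℝ) (f₀ f₁ f₂ : ℤ → ℂ),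
        0 < q → 0 < δ →
        NonlinearRoth.OneBounded f₀ → NonlinearRoth.OneBounded f₁ →
        NonlinearRoth.OneBounded f₂ →
        NonlinearRoth.SupportedIn N f₀ → NonlinearRoth.SupportedIn N f₁ →
        NonlinearRoth.SupportedIn N f₂ →
        C * (q : ℝ) * δ ^ (-72 : ℤ) ≤ (N : ℝ) →
        δ * (N : ℝ) * Real.sqrt ((N : ℝ) / (q : ℝ)) ≤
          ‖NonlinearRoth.countingOp N q f₀ f₁ f₂‖ →
        c * δ ^ (2 ^ 33 : ℕ) * ((N : ℝ) / (q : ℝ)) ^ 6 ≤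
          𝔼 u ∈ NonlinearRoth.intInterval (q : ℝ),
            NonlinearRoth.gowersNormOn 5 (NonlinearRoth.progression u q) f₂ ^ (2 ^ 5) := by
  refine NonlinearRoth.gowersNormOn_control_of_exponent_le (2 ^ 33) ?_
  norm_num
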